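/- Let $N$ be a lattice of rank $n$ with dual lattice $M$, and let $\Sigma$ be a finite fan in $N_{\mathbb R}$, each of whose cones is generated by part of a $\mathbb Z$-basis of $N$, whose support is convex and contains no line through $0$. Let $v_0,\dots,v_{m-1}\in N$ be the primitive generators of the rays of $\Sigma$, and suppose that some $\underline\nu\in M$ satisfies $\langle\underline\nu,v_i\rangle=1$ for all $i$ (so the toric manifold $X=X_\Sigma$ is Calabi--Yau). Let the $v_i$ be numbered so that $v_0,\dots,v_{n-1}$ form a basis of $N$ and generate a cone of $\Sigma$, and let $\nu_0,\dots,\nu_{n-1}\in M$ be the dual basis. Let $\mathbf T\subset X$ be a toric fibre, i.e. an orbit of the compact torus in the open dense torus orbit of $X$. Let $\beta^{\mathbf T}_i\in\pi_2(X,\mathbf T)$, $0\le i\le m-1$, be the basic disk classes: $\beta^{\mathbf T}_i$ is the class of the holomorphic disk $\zeta\mapsto[c_0:\dots:c_i\zeta:\dots:c_{m-1}]$ in homogeneous coordinates, where $[c_0:\dots:c_{m-1}]\in\mathbf T$ is the base point; equivalently, in the affine chart of a maximal cone containing $v_i$, the coordinate belonging to $v_i$ is multiplied by $\zeta\in\Delta=\{|\zeta|\le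 1\}$ and the others are kept constant. More generally, let $L\subset X$ be $\mathbf T$ itself or any torus obtained from $\mathbf T$ by an isotopy $L_t$ ($t\in[0,1]$, $L_0=\mathbf T$, $L_1=L$) of embedded tori (for example a regular fibre of a non-toric torus fibration of $X$ that is isotopic to $\mathbf T$). Then for every $i$ there is exactly one class $\beta_i\in\pi_2(X,L)$ which corresponds to $\beta_i^{\mathbf T}$ under the isotopy, i.e. which is joined to it through disks with boundary on the $L_t$ (based at the moving base point), and the following holds. The group $\pi_2(X,L)$ is abelian; every class in $H_2(X,\mathbb Z)$ is represented by a sphere; sending such a class to the relative homotopy class of the sphere gives a well-defined injective homomorphism $H_2(X,\mathbb Z)\hookrightarrow\pi_2(X,L)$; the classes $$S_a:=\beta_{a+n-1}-\sum_{j=0}^{n-1}\langle\nu_j,v_{a+n-1}\rangle\,\beta_j\in\pi_2(X,L),\qquad a=1,\dots,m-n,$$ lie in its image; and $\{S_a\}_{a=1}^{m-n}$ is a basis (in particular a generating set) of $H_2(X,\mathbb Z)$. -/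

import Mathlib

open scoped TensorProduct unitInterval Topology.Homotopy
open CategoryTheory

noncomputable section

namespace ToricCY

/-! ### Fans -/

section Fans

variable {N : Type*} [AddCommGroup N]

/-- The lattice vector `u` regarded as the vector `1 ⊗ u` of `N_ℝ = ℝ ⊗ N`. -/
def toReal (u : N) : ℝ ⊗[ℤ] N := (1 : ℝ) ⊗ₜ[ℤ] u

/-- The convex cone in `N_ℝ` generated by a set of lattice vectors. -/
def latticeCone (s : Set N) : PointedCone ℝ (ℝ ⊗[ℤ] N) :=
  PointedCone.hull ℝ (toReal '' s)

/-- `u` is primitive: it is nonzero and not a proper positive multiple of a lattice vector. -/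
def IsPrimitive (u : N) : Prop := ∀ (k : ℕ) (w : N), u = k • w → k = 1

/-- A finite fan of cones in `N_ℝ`, each of which is generated by part of a `ℤ`-basis of `N`
(so that the associated toric variety is a manifold). -/
structure IsSmoothFan (S : Set (PointedCone ℝ (ℝ ⊗[ℤ] N))) : Prop where
  finite : S.Finite
  zero_mem : latticeCone (∅ : Set N) ∈ S
  smooth : ∀ C ∈ S, ∃ (b : Module.Basis (Fin (Module.finrank ℤ N)) ℤ N)
    (s : Set (Fin (Module.finrank ℤ N))), C = latticeCone (b '' s)
  face_mem : ∀ C ∈ S, ∀ D : PointedCone ℝ (ℝ ⊗[ℤ] N), D.IsFaceOf C → D ∈ S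
  inter_face : ∀ C ∈ S, ∀ D ∈ S, (C ⊓ D).IsFaceOf C

/-- The support of a fan: the union of its cones. -/
def fanSupport (S : Set (PointedCone ℝ (ℝ ⊗[ℤ] N))) : Set (ℝ ⊗[ℤ] N) :=
  ⋃ C ∈ S, (C : Set (ℝ ⊗[ℤ] N))

/-- `S` is the fan of a toric Calabi-Yau manifold: it is smooth, its support is convex and
contains no line through the origin, `v` enumerates without repetition the primitive generators
of the rays of `S`, and some dual lattice vector takes the value `1` on all of them. -/
structure IsCalabiYauFan (S : Set (PointedCone ℝ (ℝ ⊗[ℤ] N))) {m : ℕ} (v : Fin m → N) :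
    Prop where
  isSmoothFan : IsSmoothFan S
  convex_support : Convex ℝ (fanSupport S)
  no_line : ∀ x : ℝ ⊗[ℤ] N, (∀ t : ℝ, t • x ∈ fanSupport S) → x = 0
  injective : Function.Injective v
  range_eq : Set.range v = {u : N | IsPrimitive u ∧ latticeCone {u} ∈ S}
  calabiYau : ∃ ν : Module.Dual ℤ N, ∀ i, ν (v i) = 1

end Fans

/-! ### The toric manifold of a fan, in homogeneous coordinates -/

section ToricManifold

variable {N : Type*} [AddCommGroup N] {m : ℕ}
variable (S : Set (PointedCone ℝ (ℝ ⊗[ℤ] N))) (v : Fin m → N)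

/-- The points of `ℂ^m` whose vanishing coordinates correspond to the generators of a cone of the
fan. -/
def HomogeneousPoints : Type :=
  {z : Fin m → ℂ // latticeCone (v '' {i | z i = 0}) ∈ S}

instance : TopologicalSpace (HomogeneousPoints S v) :=
  inferInstanceAs (TopologicalSpace {z : Fin m → ℂ // latticeCone (v '' {i | z i = 0}) ∈ S})

/-- The group `G` of all `g ∈ (ℂˣ)^m` with `∏ g_i ^ ⟨μ, v_i⟩ = 1` for every `μ` in the dual
lattice, i.e. the kernel of the map `(ℂˣ)^m → N ⊗ ℂˣ` induced by `e_i ↦ v_i`. -/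
def quotientGroup : Subgroup (Fin m → ℂˣ) where
  carrier := {g | ∀ μ : Module.Dual ℤ N, ∏ i, g i ^ (μ (v i)) = 1}
  one_mem' := by intro μ; simp
  mul_mem' := by
    intro g h hg hh μ
    simp only [Pi.mul_apply, mul_zpow, Finset.prod_mul_distrib]
    rw [hg μ, hh μ, one_mul]
  inv_mem' := by
    intro g hg μ
    simp only [Pi.inv_apply, inv_zpow, Finset.prod_inv_distrib]
    rw [hg μ, inv_one]

/-- Two points are equivalent if they differ by coordinatewise multiplication with an element of
the group `G`. -/
def toricSetoid : Setoid (HomogeneousPoints S v) where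
  r z w := ∃ g ∈ quotientGroup v, ∀ i, w.1 i = g i * z.1 i
  iseqv :=
    { refl := fun z => ⟨1, one_mem _, fun i => by simp⟩
      symm := by
        rintro z w ⟨g, hg, h⟩
        exact ⟨g⁻¹, inv_mem hg, fun i => by rw [h i]; simp⟩
      trans := by
        rintro x y z ⟨g, hg, h⟩ ⟨k, hk, h'⟩
        exact ⟨k * g, mul_mem hk hg, fun i => by rw [h' i, h i]; simp [mul_assoc]⟩ }

/-- The toric manifold `X = X_Σ` of the fan with its complex (analytic) topology, as the quotient
of the homogeneous points by `G`. If `v_{i_1}, …, v_{i_n}` generate a maximal cone and are a basis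
of `N` with dual basis `ν_1, …, ν_n`, the functions `ζ_j = ∏ i, z_i ^ ⟨ν_j, v_i⟩` identify the open
set where `z_i ≠ 0` for all `i ∉ {i_1, …, i_n}` with the affine chart `ℂ^n` of that cone. -/
def ToricManifold : Type := Quotient (toricSetoid S v)

instance : TopologicalSpace (ToricManifold S v) :=
  inferInstanceAs (TopologicalSpace (Quotient (toricSetoid S v)))

variable {S v}

/-- The point of `X` with homogeneous coordinates `z`. -/
def toricMk (z : HomogeneousPoints S v) : ToricManifold S v := Quotient.mk (toricSetoid S v) z

theorem continuous_toricMk : Continuous (toricMk : HomogeneousPoints S v → ToricManifold S v) :=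
  continuous_quotient_mk'

theorem mem_of_forall_ne_zero (hS : IsCalabiYauFan S v) {z : Fin m → ℂ} (hz : ∀ i, z i ≠ 0) :
    latticeCone (v '' {i | z i = 0}) ∈ S := by
  have : {i | z i = 0} = (∅ : Set (Fin m)) := by ext i; simp [hz i]
  rw [this, Set.image_empty]
  exact hS.isSmoothFan.zero_mem

/-- The point of the open dense orbit of `X` with nonzero homogeneous coordinates `c`. -/
def torusPoint (hS : IsCalabiYauFan S v) (c : Fin m → ℂˣ) : ToricManifold S v :=
  toricMk ⟨fun i => c i, mem_of_forall_ne_zero hS fun i => (c i).ne_zero⟩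

variable (S v) in
/-- The toric fibre through `[c]`: the orbit of `[c]` under the compact torus, which consists of
the points having homogeneous coordinates `z` with `|z_i| = |c_i|` for all `i`. -/
def toricFibre (c : Fin m → ℂˣ) : Set (ToricManifold S v) :=
  {x | ∃ z : HomogeneousPoints S v, (∀ i, ‖z.1 i‖ = ‖(c i : ℂ)‖) ∧ toricMk z = x}

/-- `[c]` as the base point of the toric fibre through it. -/
def fibreBase (hS : IsCalabiYauFan S v) (c : Fin m → ℂˣ) : toricFibre S v c :=
  ⟨torusPoint hS c, _, fun _ => rfl, rfl⟩

end ToricManifold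

/-! ### Relative second homotopy groups -/

section Homotopy

variable {X : Type*} [TopologicalSpace X]

/-- Paths in `X` which start at `a` and end in `A`. -/
def RelPathSpace (A : Set X) (a : A) : Type _ := {γ : C(I, X) // γ 0 = a ∧ γ 1 ∈ A}

instance (A : Set X) (a : A) : TopologicalSpace (RelPathSpace A a) :=
  inferInstanceAs (TopologicalSpace {γ : C(I, X) // γ 0 = a ∧ γ 1 ∈ A})

/-- The constant path. -/
def RelPathSpace.base (A : Set X) (a : A) : RelPathSpace A a :=
  ⟨ContinuousMap.const I (a : X), rfl, a.2⟩

/-- The relative homotopy group `π₂(X, A, a)`, defined as the fundamental group of the space of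
paths from `a` to `A`: a loop `s ↦ γ_s` of such paths is a map of the square `(s, t) ↦ γ_s(t)`
which sends the side `t = 1` to `A` and the other three sides to `a`.
It is written additively; commutativity is not built in. -/
abbrev RelPi2 (A : Set X) (a : A) : Type _ :=
  Additive (FundamentalGroup (RelPathSpace A a) (RelPathSpace.base A a))

/-- The class in `π₂(X, A, a)` of a map of the square which sends the side `t = 1` to `A` and the
other three sides to `a`. -/
def squareClass {A : Set X} {a : A} (F : C(I × I, X)) (h0 : ∀ t, F (0, t) = a)
    (h1 : ∀ t, F (1, t) = a) (hl : ∀ s, F (s, 0) = a) (hr : ∀ s, F (s, 1) ∈ A) : RelPi2 A a :=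
  Additive.ofMul <| FundamentalGroup.fromPath <| Path.Homotopic.Quotient.mk
    { toFun := fun s => ⟨F.curry s, hl s, hr s⟩
      continuous_toFun := F.curry.continuous.subtype_mk _
      source' := Subtype.ext (ContinuousMap.ext h0)
      target' := Subtype.ext (ContinuousMap.ext h1) }

/-- The closed unit disk in `ℂ`. -/
abbrev Disk : Type := Metric.closedBall (0 : ℂ) 1

/-- The point `1` of the closed unit disk. -/
def diskOne : Disk := ⟨1, by simp⟩

/-- Maps `(Δ, ∂Δ, 1) → (X, A, a)` from the closed unit disk. -/
structure BasedDisk (A : Set X) (a : A) where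
  /-- the underlying map -/
  toMap : C(Disk, X)
  map_boundary : ∀ z : Disk, ‖(z : ℂ)‖ = 1 → toMap z ∈ A
  map_one : toMap diskOne = a

theorem chord_mem (p : I × I) :
    (1 - (p.2 : ℝ) : ℂ) + (p.2 : ℝ) * Complex.exp (2 * Real.pi * (p.1 : ℝ) * Complex.I) ∈
      Metric.closedBall (0 : ℂ) 1 := by
  rw [mem_closedBall_zero_iff]
  have h : ‖Complex.exp (2 * Real.pi * (p.1 : ℝ) * Complex.I)‖ = 1 := by
    have := Complex.norm_exp_ofReal_mul_I (2 * Real.pi * (p.1 : ℝ))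
    push_cast at this
    exact this
  have h1 : ‖(1 - (p.2 : ℝ) : ℂ)‖ = 1 - (p.2 : ℝ) := by
    rw [← Complex.ofReal_one, ← Complex.ofReal_sub, Complex.norm_real, Real.norm_eq_abs,
      abs_of_nonneg (sub_nonneg.2 p.2.2.2)]
  have h2 : ‖((p.2 : ℝ) : ℂ)‖ = (p.2 : ℝ) := by
    rw [Complex.norm_real, Real.norm_eq_abs, abs_of_nonneg p.2.2.1]
  calc _ ≤ _ := norm_add_le _ _
    _ = 1 := by rw [norm_mul, h, h1, h2]; ring

/-- The map from the square onto the closed unit disk for which `t ↦ chordMap (s, t)` runs along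
the chord from `1` to `exp (2 π i s)`. It collapses the sides `s = 0`, `s = 1` and `t = 0` to `1`
and is otherwise injective. -/
def chordMap : C(I × I, Disk) where
  toFun p := ⟨_, chord_mem p⟩
  continuous_toFun := by
    refine Continuous.subtype_mk ?_ _
    fun_prop

theorem chordMap_eq_one {p : I × I} (h : p.1 = 0 ∨ p.1 = 1 ∨ p.2 = 0) : chordMap p = diskOne := by
  apply Subtype.ext
  rcases h with h | h | h <;> simp [chordMap, diskOne, h, Complex.exp_two_pi_mul_I]

theorem norm_chordMap (s : I) : ‖(chordMap (s, 1) : ℂ)‖ = 1 := by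
  have := Complex.norm_exp_ofReal_mul_I (2 * Real.pi * (s : ℝ))
  push_cast at this
  simpa [chordMap] using this

/-- The class in `π₂(X, A, a)` of a disk. -/
def BasedDisk.toClass {A : Set X} {a : A} (u : BasedDisk A a) : RelPi2 A a :=
  squareClass (u.toMap.comp chordMap)
    (fun t => by simp [chordMap_eq_one (p := (0, t)) (Or.inl rfl), u.map_one])
    (fun t => by simp [chordMap_eq_one (p := (1, t)) (Or.inr (Or.inl rfl)), u.map_one])
    (fun s => by simp [chordMap_eq_one (p := (s, 0)) (Or.inr (Or.inr rfl)), u.map_one])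
    (fun s => u.map_boundary _ (norm_chordMap s))

/-- The class in `π₂(X, A, a)` of a map of the square which sends the whole boundary to `a`, i.e.
the natural map `π₂(X, a) → π₂(X, A, a)` on representatives. -/
def sphereClass (A : Set X) (a : A) (f : Ω^ (Fin 2) X (a : X)) : RelPi2 A a :=
  squareClass ((f : C(Fin 2 → I, X)).comp
      ⟨fun p => ![p.1, p.2], by
        refine continuous_pi fun i => ?_
        fin_cases i
        · exact continuous_fst
        · exact continuous_snd⟩)
    (fun _ => GenLoop.boundary f _ ⟨0, Or.inl rfl⟩) (fun _ => GenLoop.boundary f _ ⟨0, Or.inr rfl⟩)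
    (fun _ => GenLoop.boundary f _ ⟨1, Or.inl rfl⟩)
    (fun s => by
      have h : f ![s, 1] = a := GenLoop.boundary f _ ⟨1, Or.inr rfl⟩
      exact (congrArg (· ∈ A) h).mpr a.2)

/-- An isotopy of embeddings `A → X`, `t ∈ [0, 1]`, starting with the inclusion. -/
structure Isotopy (A : Set X) where
  /-- the family of maps -/
  toMap : C(I × A, X)
  map_zero : ∀ y : A, toMap (0, y) = y
  injective : ∀ t : I, Function.Injective fun y : A => toMap (t, y)

/-- The image `A_t` of `A` at time `t`. -/
def Isotopy.image {A : Set X} (Φ : Isotopy A) (t : I) : Set X := Set.range fun y => Φ.toMap (t, y)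

/-- The position of the point `a` at time `t`. -/
def Isotopy.point {A : Set X} (Φ : Isotopy A) (t : I) (a : A) : Φ.image t :=
  ⟨Φ.toMap (t, a), a, rfl⟩

/-- The classes `β ∈ π₂(X, A_0, a_0)` and `β' ∈ π₂(X, A_1, a_1)` correspond to each other under
the isotopy: they have representatives which are joined by a continuous family of
disks `(Δ, ∂Δ, 1) → (X, A_t, a_t)`. -/
def Isotopy.Corresponds {A : Set X} (Φ : Isotopy A) (a : A) (β : RelPi2 A a)
    (β' : RelPi2 (Φ.image 1) (Φ.point 1 a)) : Prop :=
  ∃ (u : BasedDisk A a) (u' : BasedDisk (Φ.image 1) (Φ.point 1 a)) (H : C(I × Disk, X)),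
    u.toClass = β ∧ u'.toClass = β' ∧
    (∀ z, H (0, z) = u.toMap z) ∧ (∀ z, H (1, z) = u'.toMap z) ∧
    (∀ (t : I) (z : Disk), ‖(z : ℂ)‖ = 1 → H (t, z) ∈ Φ.image t) ∧
    ∀ t : I, H (t, diskOne) = Φ.point t a

end Homotopy

/-! ### The second homology group and the Hurewicz map -/

section Homology

variable (X : Type) [TopologicalSpace X]

/-- Singular homology `H₂(X; ℤ)`. -/
abbrev H2 : ModuleCat.{0} ℤ :=
  ((AlgebraicTopology.singularHomologyFunctor (ModuleCat.{0} ℤ) 2).obj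
    (ModuleCat.of ℤ ℤ)).obj (TopCat.of X)

variable {X}

theorem simplex_add_mem (y : stdSimplex ℝ (Fin 3)) : y.1 1 + y.1 2 ∈ Set.Icc (0 : ℝ) 1 := by
  have h := y.2.2
  rw [Fin.sum_univ_three] at h
  exact ⟨add_nonneg (y.2.1 1) (y.2.1 2), by have := y.2.1 0; linarith⟩

theorem simplex_mem (y : stdSimplex ℝ (Fin 3)) : y.1 2 ∈ Set.Icc (0 : ℝ) 1 :=
  ⟨y.2.1 2, by have := (simplex_add_mem y).2; have := y.2.1 1; linarith⟩

/-- The affine map from the 2-simplex to the square with vertices `(0,0), (1,0), (1,1)`. -/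
def lowerTriangle : C(stdSimplex ℝ (Fin 3), Fin 2 → I) where
  toFun y := ![⟨_, simplex_add_mem y⟩, ⟨_, simplex_mem y⟩]
  continuous_toFun := by
    refine continuous_pi fun i => ?_
    fin_cases i
    · exact Continuous.subtype_mk (((continuous_apply 1).comp continuous_subtype_val).add
        ((continuous_apply 2).comp continuous_subtype_val)) _
    · exact Continuous.subtype_mk ((continuous_apply 2).comp continuous_subtype_val) _

/-- The affine map from the 2-simplex to the square with vertices `(0,0), (0,1), (1,1)`. -/
def upperTriangle : C(stdSimplex ℝ (Fin 3), Fin 2 → I) where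
  toFun y := ![⟨_, simplex_mem y⟩, ⟨_, simplex_add_mem y⟩]
  continuous_toFun := by
    refine continuous_pi fun i => ?_
    fin_cases i
    · exact Continuous.subtype_mk ((continuous_apply 2).comp continuous_subtype_val) _
    · exact Continuous.subtype_mk (((continuous_apply 1).comp continuous_subtype_val).add
        ((continuous_apply 2).comp continuous_subtype_val)) _

/-- A continuous map on the standard simplex as a singular simplex. -/
def singularSimplex (f : C(stdSimplex ℝ (Fin 3), X)) :
    (TopCat.toSSet.obj (TopCat.of X)).obj (Opposite.op (SimplexCategory.mk 2)) :=
  (TopCat.toSSetObjEquiv (TopCat.of X) (Opposite.op (SimplexCategory.mk 2))).symm f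

theorem triangle_eq {x : X} (f : Ω^ (Fin 2) X x) (i : Fin 3) (y : stdSimplex ℝ (Fin 3))
    (hy : y.1 i = 0) : f (lowerTriangle y) = f (upperTriangle y) := by
  have h := y.2.2
  rw [Fin.sum_univ_three] at h
  fin_cases i
  · have h1 : y.1 1 + y.1 2 = 1 := by simp at hy; linarith
    rw [GenLoop.boundary f (lowerTriangle y) ⟨0, Or.inr (Subtype.ext h1)⟩,
      GenLoop.boundary f (upperTriangle y) ⟨1, Or.inr (Subtype.ext h1)⟩]
  · congr 1
    have h1 : y.1 1 = 0 := hy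
    ext j
    fin_cases j <;> simp [lowerTriangle, upperTriangle, h1]
  · have h1 : y.1 2 = 0 := hy
    rw [GenLoop.boundary f (lowerTriangle y) ⟨1, Or.inl (Subtype.ext h1)⟩,
      GenLoop.boundary f (upperTriangle y) ⟨0, Or.inl (Subtype.ext h1)⟩]

theorem delta_eq {x : X} (f : Ω^ (Fin 2) X x) (i : Fin 3) :
    (TopCat.toSSet.obj (TopCat.of X)).δ i
        (singularSimplex ((f : C(Fin 2 → I, X)).comp lowerTriangle)) =
      (TopCat.toSSet.obj (TopCat.of X)).δ i
        (singularSimplex ((f : C(Fin 2 → I, X)).comp upperTriangle)) := by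
  apply (TopCat.toSSetObjEquiv (TopCat.of X) _).injective
  ext y
  refine triangle_eq f i (stdSimplex.map (SimplexCategory.δ i) y) ?_
  change FunOnFinite.linearMap ℝ ℝ _ y.1 i = 0
  rw [FunOnFinite.linearMap_apply_apply]
  refine Finset.sum_eq_zero fun j hj => ?_
  exact absurd (Finset.mem_filter.1 hj).2 (Fin.succAbove_ne i j)

/-- The singular chain "lower triangle minus upper triangle" of a map of the square. -/
def sphereChain {x : X} (f : Ω^ (Fin 2) X x) :
    ModuleCat.of ℤ ℤ ⟶
      ((TopCat.toSSet.obj (TopCat.of X)).chainComplex (ModuleCat.of ℤ ℤ)).X 2 :=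
  (TopCat.toSSet.obj (TopCat.of X)).ιChainComplex
      (singularSimplex ((f : C(Fin 2 → I, X)).comp lowerTriangle)) -
    (TopCat.toSSet.obj (TopCat.of X)).ιChainComplex
      (singularSimplex ((f : C(Fin 2 → I, X)).comp upperTriangle))

theorem sphereChain_d {x : X} (f : Ω^ (Fin 2) X x) :
    sphereChain f ≫
      ((TopCat.toSSet.obj (TopCat.of X)).chainComplex (ModuleCat.of ℤ ℤ)).d 2 1 = 0 := by
  rw [sphereChain, Preadditive.sub_comp, SSet.ιChainComplex_d, SSet.ιChainComplex_d, sub_eq_zero]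
  exact Finset.sum_congr rfl fun i _ => by rw [delta_eq]

/-- The Hurewicz map `π₂(X, x) → H₂(X; ℤ)` on representatives. -/
def hurewicz {x : X} (f : Ω^ (Fin 2) X x) : H2 X :=
  (HomologicalComplex.liftCycles _ (sphereChain f) 1 (by simp) (sphereChain_d f) ≫
    HomologicalComplex.homologyπ _ 2).hom (1 : ℤ)

/-- The elements `s_1, …, s_l` of `π₂(X, A, a)` are classes in `H₂(X; ℤ)` and form a basis of it.
Here `H₂(X; ℤ)` is regarded as a subgroup of `π₂(X, A, a)` through the injective homomorphism `ι`
which sends the homology class of a sphere to its relative homotopy class; `ι` is unique, because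
every class in `H₂(X; ℤ)` is the class of a sphere. -/
def IsBasisOfH2 (A : Set X) (a : A) {l : ℕ} (s : Fin l → RelPi2 A a) : Prop :=
  (∀ h : H2 X, ∃ f : Ω^ (Fin 2) X (a : X), hurewicz f = h) ∧
  ∃ ι : H2 X →+ RelPi2 A a,
    (∀ f : Ω^ (Fin 2) X (a : X), ι (hurewicz f) = sphereClass A a f) ∧
    Function.Injective ι ∧
    ∃ B : Module.Basis (Fin l) ℤ (H2 X), ∀ k, ι (B k) = s k

end Homology

/-! ### Basic disk classes and the classes `S_a` -/

section Classes

variable {N : Type*} [AddCommGroup N] {m : ℕ}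
variable {S : Set (PointedCone ℝ (ℝ ⊗[ℤ] N))} {v : Fin m → N}

theorem update_mem (hS : IsCalabiYauFan S v) (c : Fin m → ℂˣ) (i : Fin m) (ζ : ℂ) :
    latticeCone (v '' {k | Function.update (fun k => (c k : ℂ)) i (c i * ζ) k = 0}) ∈ S := by
  by_cases hζ : ζ = 0
  · have : {k | Function.update (fun k => (c k : ℂ)) i (c i * ζ) k = 0} = {i} := by
      ext k
      by_cases hk : k = i
      · subst hk; simp [hζ]
      · simp [hk]
    rw [this, Set.image_singleton]
    have : v i ∈ Set.range v := ⟨i, rfl⟩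
    rw [hS.range_eq] at this
    exact this.2
  · refine mem_of_forall_ne_zero hS fun k => ?_
    by_cases hk : k = i
    · subst hk; simp [hζ]
    · simp [hk]

/-- The `i`-th basic disk with boundary on the toric fibre through `[c]`: in homogeneous
coordinates, the holomorphic disk `ζ ↦ [c_0 : … : c_i ζ : … : c_{m-1}]`. In the affine chart of
any maximal cone containing `v_i` it multiplies the coordinate belonging to `v_i` by `ζ` and keeps
the other coordinates constant. -/
def basicDisk (hS : IsCalabiYauFan S v) (c : Fin m → ℂˣ) (i : Fin m) :
    BasedDisk (toricFibre S v c) (fibreBase hS c) where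
  toMap :=
    { toFun := fun ζ => toricMk ⟨_, update_mem hS c i (ζ : ℂ)⟩
      continuous_toFun := by
        refine continuous_toricMk.comp (Continuous.subtype_mk ?_ _)
        exact continuous_const.update i (continuous_const.mul continuous_subtype_val) }
  map_boundary := by
    intro ζ hζ
    refine ⟨_, fun k => ?_, rfl⟩
    by_cases hk : k = i
    · subst hk; simp [hζ]
    · simp [hk]
  map_one := by
    refine congrArg toricMk (Subtype.ext ?_)
    funext k
    by_cases hk : k = i
    · subst hk; simp [diskOne]
    · simp [hk]

/-- The basic disk class `β_i`. -/
def basicDiskClass (hS : IsCalabiYauFan S v) (c : Fin m → ℂˣ) (i : Fin m) :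
    RelPi2 (toricFibre S v c) (fibreBase hS c) :=
  (basicDisk hS c i).toClass

/-- For disk classes `β_0, …, β_{n+l-1}`, a basis `b_0, …, b_{n-1}` of `N` with dual basis
`ν_0, …, ν_{n-1}`, and vectors `v_0, …, v_{n+l-1}`, the class
`β_{n+k} - ∑ j, ⟨ν_j, v_{n+k}⟩ β_j`, where `k = 0, …, l-1`. (The sum is taken in the order of the
indices.) -/
def curveClass {G : Type*} [AddGroup G] {n l : ℕ} (b : Module.Basis (Fin n) ℤ N)
    (v : Fin (n + l) → N) (β : Fin (n + l) → G) (k : Fin l) : G :=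
  β (Fin.natAdd n k) -
    (List.ofFn fun j : Fin n => b.coord j (v (Fin.natAdd n k)) • β (Fin.castAdd l j)).sum

end Classes

end ToricCY

end

/-! Write `X = Z / G`, where `Z ⊂ ℂ^m` is the space of homogeneous points and `G` the quotient
group. Two properties of this quotient carry the proof. `Z` is open and contains every point with at
most one vanishing coordinate, so its complement has complex codimension at least two; by general
position (`homotopicRel_const_of_codimension_two`) loops and 2-spheres in `Z` based at a point with
nonzero coordinates contract. The `v i` span `N`, so `G` is the exponential of its Lie algebra and
`Z → X` is locally trivial; hence maps from compact contractible metric spaces lift to `Z`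
(`hasLocalTransport_toricMk`, `HasLocalTransport.exists_lift`).

A relative square for the toric fibre lifts to a square in `Z` whose coordinates do not vanish on
the boundary. The increments of their logarithms around the boundary (`boundaryLog`) are `2πi` times
winding numbers. They do not depend on the lift, because two lifts differ by a nowhere vanishing
function on the whole square. This gives a homomorphism `W` from the relative homotopy group to
`ℂ^m` (`exists_relPi2_hom`). It is injective (`toClass_eq_zero_of_boundaryLog`): if all windings
vanish, a logarithm of the boundary values contracts the boundary, and general position contracts
the rest. So the group is abelian. The `i`-th basic disk has winding vector `e_i`.

On the boundary of a sphere the lift stays in one `G`-orbit, so its winding vector `κ` satisfies `∑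
κ i • v i = 0`. Conversely every such relation gives a loop in an orbit, which bounds in `Z` and
yields a sphere (`exists_sphere_of_relation`). As `X` is simply connected, all of `H₂` is spherical
(`hurewicz_surjective`). A singular cocycle measuring the failure of chosen lifts of paths to fit
together defines the same winding vector on `H₂` (`exists_homology_hom`). This identifies `H₂` with
the relations among the `v i`, of which those expressing `v_{n+k}` in the basis `v_0, …, v_{n-1}`
form a basis. They are the winding vectors of the `S_a`.

For an isotopic torus, `X` is Hausdorff (`t2Space_toricManifold`) and the fibre compact, so a point
of `L_t` determines its origin in the fibre continuously. Adding a collar along which boundary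
values are moved from one torus to another gives an isomorphism of relative homotopy groups
(`Isotopy.exists_equiv`). Its graph on disks is the correspondence of classes, and it is compatible
with spheres and their homology classes (`Isotopy.exists_sphere`). -/

open scoped TensorProduct unitInterval Topology.Homotopy
open CategoryTheory

noncomputable section

namespace ToricCY

/-! ### Cones of the fan: generators, faces, sections and separation -/

section FanCombinatorics

variable {N : Type*} [AddCommGroup N]

/-- The real extension of an integral functional. -/
def realFunctional (μ : Module.Dual ℤ N) : (ℝ ⊗[ℤ] N) →ₗ[ℝ] ℝ :=
  Module.Dual.baseChange ℝ μ

@[simp]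
theorem realFunctional_toReal (μ : Module.Dual ℤ N) (u : N) :
    realFunctional μ (toReal u) = μ u := by
  simp [realFunctional, toReal]

theorem eq_of_realFunctional_coord {ι : Type*} [Finite ι] (b : Module.Basis ι ℤ N)
    {x y : ℝ ⊗[ℤ] N} (h : ∀ j, realFunctional (b.coord j) x = realFunctional (b.coord j) y) :
    x = y := by
  refine (b.baseChange ℝ).ext_elem fun j => ?_
  have key : ∀ z, (b.baseChange ℝ).repr z j = realFunctional (b.coord j) z := by
    intro z
    induction z using TensorProduct.induction_on with
    | zero => simp
    | tmul r u => simp [realFunctional, mul_comm]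
    | add u v hu hv => simp only [map_add, Finsupp.add_apply, hu, hv]
  rw [key, key, h]

theorem toReal_injective {ι : Type*} [Finite ι] (b : Module.Basis ι ℤ N) :
    Function.Injective (toReal : N → ℝ ⊗[ℤ] N) := by
  intro u w h
  refine b.ext_elem fun j => ?_
  have := congrArg (realFunctional (b.coord j)) h
  simpa using this

/-- The coefficients are indexed by all of `ι` and supported in `s`, so that expansions over
different index sets can be compared term by term. -/
theorem mem_latticeCone_image {ι : Type*} [Fintype ι] {v : ι → N} {s : Set ι} {x : ℝ ⊗[ℤ] N} :
    x ∈ latticeCone (v '' s) ↔ ∃ a : ι → ℝ, (∀ i, 0 ≤ a i) ∧ (∀ i, i ∉ s → a i = 0) ∧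
      x = ∑ i, a i • toReal (v i) := by
  classical
  constructor
  · intro hx
    induction hx using Submodule.span_induction with
    | mem x hx =>
      obtain ⟨_, ⟨i, hi, rfl⟩, rfl⟩ := hx
      refine ⟨Pi.single i 1, fun j => ?_, fun j hj => ?_, ?_⟩
      · rcases eq_or_ne j i with rfl | h <;> simp [*]
      · exact Pi.single_eq_of_ne (by rintro rfl; exact hj hi) _
      · simp [Pi.single_apply, ite_smul]
    | zero => exact ⟨0, by simp, by simp, by simp⟩
    | add x y _ _ hx hy =>
      obtain ⟨a, ha, ha', rfl⟩ := hx
      obtain ⟨c, hc, hc', rfl⟩ := hy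
      exact ⟨a + c, fun i => add_nonneg (ha i) (hc i), fun i hi => by simp [ha' i hi, hc' i hi],
        by simp [add_smul, Finset.sum_add_distrib]⟩
    | smul r x _ hx =>
      obtain ⟨a, ha, ha', rfl⟩ := hx
      refine ⟨fun i => r * a i, fun i => mul_nonneg r.2 (ha i), fun i hi => by simp [ha' i hi], ?_⟩
      refine (Finset.smul_sum (r := (r : ℝ))).trans (Finset.sum_congr rfl fun i _ => ?_)
      exact (mul_smul _ _ _).symm
  · rintro ⟨a, ha, ha', rfl⟩
    refine Submodule.sum_mem _ fun i _ => ?_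
    by_cases hi : i ∈ s
    · exact Submodule.smul_mem _ (⟨a i, ha i⟩ : {r : ℝ // 0 ≤ r})
        (Submodule.subset_span ⟨_, ⟨i, hi, rfl⟩, rfl⟩)
    · rw [ha' i hi, zero_smul]
      exact Submodule.zero_mem _

theorem toReal_mem_latticeCone {s : Set N} {u : N} (h : u ∈ s) : toReal u ∈ latticeCone s :=
  Submodule.subset_span ⟨u, h, rfl⟩

theorem mem_latticeCone_singleton {u : N} {x : ℝ ⊗[ℤ] N} (h : x ∈ latticeCone {u}) :
    ∃ r : ℝ, 0 ≤ r ∧ x = r • toReal u := by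
  have : ({u} : Set N) = (fun _ : Unit => u) '' Set.univ := by simp
  rw [this, mem_latticeCone_image] at h
  obtain ⟨a, ha, -, rfl⟩ := h
  exact ⟨a (), ha (), by simp⟩

/-- The `j`-th coordinate of `u` is `r`, so `r` is a natural number, and primitivity makes it `1`.
-/
theorem IsPrimitive.eq_of_smul {ι : Type*} [Finite ι] (b : Module.Basis ι ℤ N) {u w : N}
    (hu : IsPrimitive u) {j : ι} (hw : w = b j) {r : ℝ} (hr : 0 ≤ r)
    (h : toReal u = r • toReal w) : u = w := by
  subst hw
  have hk (i) : (b.coord i u : ℝ) = r * (b.coord i (b j) : ℝ) := by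
    have := congrArg (realFunctional (b.coord i)) h
    simpa using this
  have h1 : (b.coord j u : ℝ) = r := by simpa using hk j
  have h0 : 0 ≤ b.coord j u := by exact_mod_cast h1 ▸ hr
  obtain ⟨k, hk'⟩ := Int.eq_ofNat_of_zero_le h0
  have hu' : u = k • b j := by
    refine b.ext_elem fun i => ?_
    have := hk i
    rw [← h1, hk'] at this
    have h2 : b.coord i u = k * b.coord i (b j) := by exact_mod_cast this
    rw [map_nsmul, Finsupp.smul_apply, nsmul_eq_mul]
    exact h2
  rw [hu', hu k (b j) hu', one_smul]

variable {S : Set (PointedCone ℝ (ℝ ⊗[ℤ] N))} {m : ℕ} {v : Fin m → N}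

theorem IsCalabiYauFan.ray (hS : IsCalabiYauFan S v) (i : Fin m) :
    IsPrimitive (v i) ∧ latticeCone {v i} ∈ S := by
  have : v i ∈ Set.range v := ⟨i, rfl⟩
  rwa [hS.range_eq] at this

/-- If `v i` lies in `C`, its ray is the intersection with `C` and so a face of `C`. A basis vector
with positive coefficient in `v i` then lies in this face, that is, on the ray, and equals `v i` by
primitivity. -/
theorem IsCalabiYauFan.exists_basis (hS : IsCalabiYauFan S v) {C : PointedCone ℝ (ℝ ⊗[ℤ] N)}
    (hC : C ∈ S) : ∃ b : Module.Basis (Fin (Module.finrank ℤ N)) ℤ N,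
      ∀ i, toReal (v i) ∈ C → ∃ j, b j = v i := by
  obtain ⟨b, s, rfl⟩ := hS.isSmoothFan.smooth C hC
  refine ⟨b, fun i hi => ?_⟩
  obtain ⟨hprim, hray⟩ := hS.ray i
  have hle : latticeCone {v i} ≤ latticeCone (b '' s) := by
    refine Submodule.span_le.2 ?_
    rintro _ ⟨_, rfl, rfl⟩
    exact hi
  have hface := hS.isSmoothFan.inter_face _ hC _ hray
  rw [inf_eq_right.2 hle] at hface
  obtain ⟨a, ha, ha', hx⟩ := mem_latticeCone_image.1 hi
  obtain ⟨j, hj⟩ : ∃ j, 0 < a j := by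
    by_contra hcon
    push Not at hcon
    have h0 : v i = 0 := toReal_injective b (by
      rw [hx]
      simp [fun j => le_antisymm (hcon j) (ha j), toReal])
    exact absurd (hprim 0 0 (by simp [h0])) (by norm_num)
  have hjs : j ∈ s := by
    by_contra h
    exact hj.ne' (ha' j h)
  have hmem : toReal (b j) ∈ latticeCone {v i} := by
    refine hface.mem_of_smul_add_mem (y := ∑ k ∈ Finset.univ.erase j, a k • toReal (b k))
      (toReal_mem_latticeCone ⟨j, hjs, rfl⟩) ?_ hj ?_
    · refine Submodule.sum_mem _ fun k _ => ?_
      by_cases hk : k ∈ s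
      · exact Submodule.smul_mem _ (⟨a k, ha k⟩ : {r : ℝ // 0 ≤ r})
          (toReal_mem_latticeCone ⟨k, hk, rfl⟩)
      · rw [ha' k hk, zero_smul]
        exact Submodule.zero_mem _
    · rw [Finset.add_sum_erase _ (fun k => a k • toReal (b k)) (Finset.mem_univ j), ← hx]
      exact toReal_mem_latticeCone rfl
  obtain ⟨r, hr, hr'⟩ := mem_latticeCone_singleton hmem
  have hr0 : r ≠ 0 := by
    rintro rfl
    have := congrArg (realFunctional (b.coord j)) hr'
    simp at this
  refine ⟨j, (hprim.eq_of_smul b rfl (inv_nonneg.2 hr) ?_).symm⟩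
  rw [hr', smul_smul, inv_mul_cancel₀ hr0, one_smul]

/-- Both `v i` and the generators `v k`, `k ∈ J`, are members of one basis. Comparing the coordinate
that belongs to `v i` shows that some `v k` is the same basis vector. -/
theorem IsCalabiYauFan.mem_of_toReal_mem (hS : IsCalabiYauFan S v) {J : Set (Fin m)}
    (hJ : latticeCone (v '' J) ∈ S) {i : Fin m} (hi : toReal (v i) ∈ latticeCone (v '' J)) :
    i ∈ J := by
  obtain ⟨b, hb⟩ := hS.exists_basis hJ
  obtain ⟨j, hj⟩ := hb i hi
  obtain ⟨a, -, ha, hx⟩ := mem_latticeCone_image.1 hi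
  have h1 := congrArg (realFunctional (b.coord j)) hx
  rw [realFunctional_toReal, ← hj] at h1
  simp only [Module.Basis.coord_apply, Module.Basis.repr_self, Finsupp.single_eq_same,
    Int.cast_one, map_sum, map_smul, realFunctional_toReal, smul_eq_mul] at h1
  obtain ⟨k, -, hk⟩ := Finset.exists_ne_zero_of_sum_ne_zero (h1.symm ▸ one_ne_zero)
  have hkJ : k ∈ J := by
    by_contra h
    simp [ha k h] at hk
  obtain ⟨l, hl⟩ := hb k (toReal_mem_latticeCone ⟨k, hkJ, rfl⟩)
  have hlj : l = j := by
    by_contra h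
    apply hk
    rw [← hl, Module.Basis.repr_self, Finsupp.single_eq_of_ne (Ne.symm h)]
    simp
  rwa [hS.injective (hj.symm.trans (hlj ▸ hl))]

/-- The generators of a cone of the fan belong to a section of the map `ℤ^m → N`. -/
theorem IsCalabiYauFan.exists_section (hS : IsCalabiYauFan S v)
    (hspan : ∀ u : N, ∃ a : Fin m → ℤ, ∑ i, a i • v i = u) {J : Set (Fin m)}
    (hJ : latticeCone (v '' J) ∈ S) :
    ∃ τ : N →ₗ[ℤ] (Fin m → ℤ), (∀ u, ∑ i, τ u i • v i = u) ∧
      ∀ i ∈ J, τ (v i) = Pi.single i 1 := by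
  classical
  obtain ⟨b, hb⟩ := hS.exists_basis hJ
  -- The section sends a basis vector that is some `v i`, `i ∈ J`, to the unit vector `e_i`, and any
  -- other basis vector to an arbitrary preimage.
  have (j : Fin (Module.finrank ℤ N)) : ∃ a : Fin m → ℤ, ∑ i, a i • v i = b j ∧ ∀ i ∈ J, b j = v i → a = Pi.single i 1 := by
    by_cases h : ∃ i ∈ J, b j = v i
    · obtain ⟨i, hi, hij⟩ := h
      refine ⟨Pi.single i 1, by simp [Pi.single_apply, ite_smul, hij], fun k hk hkj => ?_⟩
      rw [hS.injective (hkj.symm.trans hij)]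
    · obtain ⟨a, ha⟩ := hspan (b j)
      exact ⟨a, ha, fun i hi hij => absurd ⟨i, hi, hij⟩ h⟩
  choose a ha ha' using this
  have hsec : (Fintype.linearCombination ℤ v) ∘ₗ b.constr ℤ a = LinearMap.id :=
    b.ext fun j => by
      simp [Fintype.linearCombination_apply, ha]
  refine ⟨b.constr ℤ a, fun u => ?_, fun i hi => ?_⟩
  · exact LinearMap.congr_fun hsec u
  · obtain ⟨j, hj⟩ := hb i (toReal_mem_latticeCone ⟨i, hi, rfl⟩)
    rw [← hj, Module.Basis.constr_basis]
    exact ha' j i hi hj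

/-- The functional `μ` that is `0` on the generators from `A` and `1` on the remaining generators of
the cone is nonnegative on the cone and cuts out the subcone as a face. -/
theorem IsCalabiYauFan.latticeCone_mem_of_subset (hS : IsCalabiYauFan S v)
    {A J : Set (Fin m)} (hJ : latticeCone (v '' J) ∈ S) (hAJ : A ⊆ J) :
    latticeCone (v '' A) ∈ S := by
  classical
  obtain ⟨b, hb⟩ := hS.exists_basis hJ
  have hj (i) (hi : i ∈ J) := hb i (toReal_mem_latticeCone ⟨i, hi, rfl⟩)
  let μ : Module.Dual ℤ N := b.constr ℤ fun k => if ∃ i ∈ A, v i = b k then 0 else 1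
  have hμ0 (i) (hi : i ∈ A) : μ (v i) = 0 := by
    obtain ⟨j, hj⟩ := hj i (hAJ hi)
    rw [← hj, Module.Basis.constr_basis, if_pos ⟨i, hi, hj.symm⟩]
  have hμ1 (i) (hi : i ∈ J) (hi' : i ∉ A) : μ (v i) = 1 := by
    obtain ⟨j, hj⟩ := hj i hi
    rw [← hj, Module.Basis.constr_basis, if_neg]
    rintro ⟨k, hk, e⟩
    exact hi' (hS.injective (e.trans hj) ▸ hk)
  have hnonneg (x) (hx : x ∈ latticeCone (v '' J)) : 0 ≤ realFunctional μ x := by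
    obtain ⟨a, ha, ha', rfl⟩ := mem_latticeCone_image.1 hx
    rw [map_sum]
    refine Finset.sum_nonneg fun i _ => ?_
    rw [map_smul, realFunctional_toReal]
    by_cases hi : i ∈ J
    · refine mul_nonneg (ha i) ?_
      by_cases hi' : i ∈ A
      · simp [hμ0 i hi']
      · simp [hμ1 i hi hi']
    · simp [ha' i hi]
  refine hS.isSmoothFan.face_mem _ hJ _ ⟨Submodule.span_mono (Set.image_mono (Set.image_mono hAJ)),
    fun {x y r} hx hy hr hxy => ?_⟩
  have h0 : realFunctional μ (r • x + y) = 0 := by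
    obtain ⟨a, ha, ha', e⟩ := mem_latticeCone_image.1 hxy
    rw [e, map_sum]
    refine Finset.sum_eq_zero fun i _ => ?_
    rw [map_smul, realFunctional_toReal]
    by_cases hi : i ∈ A
    · simp [hμ0 i hi]
    · simp [ha' i hi]
  rw [map_add, map_smul, smul_eq_mul] at h0
  have h1 := hnonneg x hx
  have h2 := hnonneg y hy
  have hx0 : realFunctional μ x = 0 := by
    have := mul_nonneg hr.le h1
    rcases mul_eq_zero.1 (le_antisymm (by linarith : r * realFunctional μ x ≤ 0) this) with h | h
    · exact absurd h hr.ne'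
    · exact h
  obtain ⟨a, ha, ha', rfl⟩ := mem_latticeCone_image.1 hx
  refine mem_latticeCone_image.2 ⟨a, ha, fun i hi => ?_, rfl⟩
  by_cases hiJ : i ∈ J
  · rw [map_sum, Finset.sum_eq_zero_iff_of_nonneg] at hx0
    · have := hx0 i (Finset.mem_univ i)
      simpa [hμ1 i hiJ hi] using this
    · intro k _
      rw [map_smul, realFunctional_toReal]
      by_cases hk : k ∈ J
      · refine mul_nonneg (ha k) ?_
        by_cases hi' : k ∈ A
        · simp [hμ0 k hi']
        · simp [hμ1 k hk hi']
      · simp [ha' k hk]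
  · exact ha' i hiJ

/-- A point common to both cones lies in their intersection, a face of the first. Each generator
with positive coefficient belongs to that face, hence to the second cone, hence to its generators.
-/
theorem IsCalabiYauFan.coeff_eq_zero (hS : IsCalabiYauFan S v) {A J : Set (Fin m)}
    (hA : latticeCone (v '' A) ∈ S) (hJ : latticeCone (v '' J) ∈ S) {a c : Fin m → ℝ}
    (ha : ∀ i, 0 ≤ a i) (ha' : ∀ i, i ∉ A → a i = 0) (hc : ∀ i, 0 ≤ c i)
    (hc' : ∀ i, i ∉ J → c i = 0) (h : ∑ i, a i • toReal (v i) = ∑ i, c i • toReal (v i))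
    {i : Fin m} (hi : i ∉ J) : a i = 0 := by
  by_contra h0
  have hpos : 0 < a i := lt_of_le_of_ne (ha i) (Ne.symm h0)
  have hiA : i ∈ A := by
    by_contra hh
    exact h0 (ha' i hh)
  have hx1 : ∑ i, a i • toReal (v i) ∈ latticeCone (v '' A) :=
    mem_latticeCone_image.2 ⟨a, ha, ha', rfl⟩
  have hx2 : ∑ i, a i • toReal (v i) ∈ latticeCone (v '' J) :=
    mem_latticeCone_image.2 ⟨c, hc, hc', h⟩
  have hface := hS.isSmoothFan.inter_face _ hA _ hJ
  have := hface.mem_of_smul_add_mem (y := ∑ k ∈ Finset.univ.erase i, a k • toReal (v k))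
      (toReal_mem_latticeCone ⟨i, hiA, rfl⟩) (by
        refine Submodule.sum_mem _ fun k _ => ?_
        by_cases hk : k ∈ A
        · exact Submodule.smul_mem _ (⟨a k, ha k⟩ : {r : ℝ // 0 ≤ r})
            (toReal_mem_latticeCone ⟨k, hk, rfl⟩)
        · rw [ha' k hk, zero_smul]
          exact Submodule.zero_mem _) hpos
      (by
        rw [Finset.add_sum_erase _ (fun k => a k • toReal (v k)) (Finset.mem_univ i)]
        exact ⟨hx1, hx2⟩)
  exact hi (hS.mem_of_toReal_mem hJ this.2)

/-- Two cones of the fan are separated by a linear functional which vanishes exactly on their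
intersection. -/
theorem IsCalabiYauFan.exists_separating (hS : IsCalabiYauFan S v) {n : ℕ}
    (b : Module.Basis (Fin n) ℤ N) {A J : Set (Fin m)}
    (hA : latticeCone (v '' A) ∈ S) (hJ : latticeCone (v '' J) ∈ S) :
    ∃ f : (Fin n → ℝ) →ₗ[ℝ] ℝ,
      (∀ i ∈ A ∩ J, f (fun j => (b.coord j (v i) : ℝ)) = 0) ∧
      (∀ i ∈ A \ J, 0 < f (fun j => (b.coord j (v i) : ℝ))) ∧
      ∀ i ∈ J \ A, f (fun j => (b.coord j (v i) : ℝ)) < 0 := by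
  classical
  let w : Fin m → Fin n → ℝ := fun i j => (b.coord j (v i) : ℝ)
  let L : (Fin m → ℝ) →ₗ[ℝ] (Fin n → ℝ) := Fintype.linearCombination ℝ w
  have hL (a c : Fin m → ℝ) (h : L a = L c) :
      ∑ i, a i • toReal (v i) = ∑ i, c i • toReal (v i) := by
    refine eq_of_realFunctional_coord b fun j => ?_
    have := congrFun h j
    simpa [L, w, Fintype.linearCombination_apply] using this
  -- The convex hull `L (D T)` of the generators in `A \ J` and the negatives of those in `J \ A` is
  -- to be separated from the span `W` of the common generators.
  let ε : Fin m → ℝ := fun i => if i ∈ A then 1 else -1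
  let D : (Fin m → ℝ) →ₗ[ℝ] (Fin m → ℝ) := LinearMap.pi fun i => ε i • LinearMap.proj i
  let T : Set (Fin m → ℝ) := {t ∈ stdSimplex ℝ (Fin m) | ∀ i, i ∉ symmDiff A J → t i = 0}
  let W : Submodule ℝ (Fin n → ℝ) :=
    Submodule.map L (Submodule.pi (A ∩ J)ᶜ fun _ => (⊥ : Submodule ℝ ℝ))
  have hTc : IsCompact T := by
    refine (isCompact_stdSimplex ℝ (Fin m)).inter_right ?_
    have : IsClosed (⋂ i, {t : Fin m → ℝ | i ∉ symmDiff A J → t i = 0}) := by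
      refine isClosed_iInter fun i => ?_
      by_cases h : i ∈ symmDiff A J
      · simp [h]
      · simpa [h] using isClosed_eq (continuous_apply i) continuous_const
    have e : (⋂ i, {t : Fin m → ℝ | i ∉ symmDiff A J → t i = 0}) =
        {t : Fin m → ℝ | ∀ i, i ∉ symmDiff A J → t i = 0} := Set.ext fun t => Set.mem_iInter
    rw [e] at this
    exact this
  have hTv : Convex ℝ T := by
    refine (convex_stdSimplex ℝ (Fin m)).inter ?_
    intro x hx y hy p q _ _ _ i hi
    simp [hx i hi, hy i hi]
  have hdisj : Disjoint ((L ∘ₗ D) '' T) (W : Set (Fin n → ℝ)) := by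
    rw [Set.disjoint_left]
    rintro _ ⟨t, ⟨ht, ht0⟩, rfl⟩ ⟨c, hc, hce⟩
    have hc0 (i) (hi : i ∉ A ∩ J) : c i = 0 := by
      have := (Submodule.mem_pi.1 hc) i hi
      simpa using this
    -- A common point would give `L (D t) = L c`. Moving the negative terms to the other side, with
    -- `c` split into positive and negative parts, turns this into two nonnegative expansions of one
    -- vector, over `A` and over `J`; `coeff_eq_zero` then forces `t = 0`, contrary to `∑ t i = 1`.
    let p : Fin m → ℝ := fun i => if i ∈ A then t i + max (- c i) 0 else 0
    let q : Fin m → ℝ := fun i => if i ∈ J then (if i ∈ A then 0 else t i) + max (c i) 0 else 0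
    have hpq : L p = L q := by
      rw [← sub_eq_zero, ← map_sub]
      have : p - q = D t - c := by
        funext i
        have h1 : c i = max (c i) 0 - max (- c i) 0 := by
          rcases le_total (c i) 0 with h | h
          · simp [max_eq_right h, max_eq_left (neg_nonneg.2 h)]
          · simp [max_eq_left h, max_eq_right (neg_nonpos.2 h)]
        simp only [p, q, D, ε, Pi.sub_apply, LinearMap.pi_apply, LinearMap.smul_apply,
          LinearMap.proj_apply, smul_eq_mul]
        by_cases hiA : i ∈ A <;> by_cases hiJ : i ∈ J
        · have := ht0 i (by simp [Set.mem_symmDiff, hiA, hiJ])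
          simp only [hiA, hiJ, if_true, this]
          linarith
        · have := hc0 i (by simp [hiJ])
          simp [hiA, hiJ, this]
        · have := hc0 i (by simp [hiA])
          simp [hiA, hiJ, this]
        · have := hc0 i (by simp [hiA])
          have := ht0 i (by simp [Set.mem_symmDiff, hiA, hiJ])
          simp [*]
      rw [this, map_sub, hce]
      simp
    have hp (i) : 0 ≤ p i := by
      simp only [p]; split_ifs
      · exact add_nonneg (ht.1 i) (le_max_right _ _)
      · exact le_rfl
    have hq (i) : 0 ≤ q i := by
      simp only [q]; split_ifs
      · exact add_nonneg le_rfl (le_max_right _ _)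
      · exact add_nonneg (ht.1 i) (le_max_right _ _)
      · exact le_rfl
    have hp' (i) (hi : i ∉ A) : p i = 0 := by simp [p, hi]
    have hq' (i) (hi : i ∉ J) : q i = 0 := by simp [q, hi]
    have e := hL p q hpq
    have ht00 : ∀ i, t i = 0 := by
      intro i
      by_cases hiA : i ∈ A <;> by_cases hiJ : i ∈ J
      · exact ht0 i (by simp [Set.mem_symmDiff, hiA, hiJ])
      · have h := hS.coeff_eq_zero hA hJ hp hp' hq hq' e hiJ
        simp only [p, hiA, if_true] at h
        linarith [ht.1 i, le_max_right (-c i) 0]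
      · have h := hS.coeff_eq_zero hJ hA hq hq' hp hp' e.symm hiA
        simp only [q, hiA, hiJ, if_true, if_false] at h
        linarith [ht.1 i, le_max_right (c i) 0]
      · exact ht0 i (by simp [Set.mem_symmDiff, hiA, hiJ])
    have := ht.2
    simp [ht00] at this
  obtain ⟨f, s, r, hs, hsr, hr⟩ := geometric_hahn_banach_compact_closed (hTv.linear_image (L ∘ₗ D))
    (hTc.image (LinearMap.continuous_of_finiteDimensional _)) W.convex
    (Submodule.closed_of_finiteDimensional W) hdisj
  have hr0 : r < 0 := by simpa using hr 0 W.zero_mem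
  -- A linear functional that is bounded below on a subspace vanishes there.
  have hW (x) (hx : x ∈ W) : f x = 0 := by
    by_contra h
    have := hr ((r / f x) • x) (W.smul_mem _ hx)
    rw [map_smul, smul_eq_mul, div_mul_cancel₀ _ h] at this
    exact lt_irrefl _ this
  have hsingle (i) : L (Pi.single i 1) = w i := by
    simp [L]
  have hT (i) (hi : i ∈ symmDiff A J) : ε i * f (w i) < 0 := by
    have hmem : (Pi.single i 1 : Fin m → ℝ) ∈ T := by
      refine ⟨single_mem_stdSimplex ℝ i, fun k hk => Pi.single_eq_of_ne ?_ _⟩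
      rintro rfl
      exact hk hi
    have h1 := hs _ ⟨_, hmem, rfl⟩
    have h2 : (L ∘ₗ D) (Pi.single i 1) = ε i • w i := by
      rw [← hsingle, ← map_smul, LinearMap.comp_apply]
      congr 1
      funext k
      rcases eq_or_ne k i with rfl | h
      · simp [D]
      · simp [D, h]
    rw [h2, map_smul, smul_eq_mul] at h1
    linarith
  refine ⟨-f.toLinearMap, fun i hi => ?_, fun i hi => ?_, fun i hi => ?_⟩
  · have : w i ∈ W := by
      refine ⟨Pi.single i 1, Submodule.mem_pi.2 fun k hk => ?_, hsingle i⟩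
      have : k ≠ i := by rintro rfl; exact hk hi
      simp [this]
    exact neg_eq_zero.2 (hW _ this)
  · have := hT i (Or.inl hi)
    simp only [ε, if_pos hi.1, one_mul] at this
    exact neg_pos.2 this
  · have := hT i (Or.inr hi)
    simp only [ε, if_neg hi.2, neg_mul, one_mul] at this
    exact this

end FanCombinatorics

/-! ### Singular 2-chains modulo boundaries -/

section SingularChains

open Simplicial

variable (X : Type) [TopologicalSpace X]

/-- The singular simplicial set. -/
abbrev Sing : SSet.{0} := TopCat.toSSet.obj (TopCat.of X)

/-- The singular chain complex with integral coefficients. -/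
abbrev SingChain : ChainComplex (ModuleCat.{0} ℤ) ℕ := (Sing X).chainComplex (ModuleCat.of ℤ ℤ)

variable {X}

/-- The class of a singular 2-simplex modulo boundaries. -/
def cell (x : (Sing X) _⦋2⦌) : (SingChain X).opcycles 2 :=
  ((Sing X).ιChainComplex x ≫ (SingChain X).pOpcycles 2).hom (1 : ℤ)

theorem cell_boundary (y : (Sing X) _⦋3⦌) :
    cell ((Sing X).δ 0 y) - cell ((Sing X).δ 1 y) + cell ((Sing X).δ 2 y)
      - cell ((Sing X).δ 3 y) = 0 := by
  have h : (Sing X).ιChainComplex (R := ModuleCat.of ℤ ℤ) y ≫ (SingChain X).d 3 2 ≫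
      (SingChain X).pOpcycles 2 = 0 := by simp
  rw [← Category.assoc, SSet.ιChainComplex_d, Preadditive.sum_comp, Fin.sum_univ_four] at h
  have := congrArg (fun f => f.hom (1 : ℤ)) h
  simp at this
  simp only [cell]
  simp
  rw [← this]
  abel_nf

/-- Identities in `H₂` are verified among chains modulo boundaries, where single simplices have
classes and no cycle condition has to be carried along. -/
theorem homologyι_injective :
    Function.Injective ((SingChain X).homologyι 2).hom :=
  (ModuleCat.mono_iff_injective _).1 inferInstance

theorem homologyι_hurewicz {x : X} (f : Ω^ (Fin 2) X x) :
    ((SingChain X).homologyι 2).hom (hurewicz f) =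
      cell (singularSimplex ((f : C(Fin 2 → I, X)).comp lowerTriangle)) -
        cell (singularSimplex ((f : C(Fin 2 → I, X)).comp upperTriangle)) := by
  have h : (SingChain X).liftCycles (sphereChain f) 1 (by simp) (sphereChain_d f) ≫
      (SingChain X).homologyπ 2 ≫ (SingChain X).homologyι 2 =
      sphereChain f ≫ (SingChain X).pOpcycles 2 := by
    rw [HomologicalComplex.homology_π_ι, HomologicalComplex.liftCycles_i_assoc]
  have := congrArg (fun f => f.hom (1 : ℤ)) h
  have e : sphereChain f ≫ (SingChain X).pOpcycles 2 = (Sing X).ιChainComplex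
      (singularSimplex ((f : C(Fin 2 → I, X)).comp lowerTriangle)) ≫ (SingChain X).pOpcycles 2 -
      (Sing X).ιChainComplex (singularSimplex ((f : C(Fin 2 → I, X)).comp upperTriangle)) ≫
        (SingChain X).pOpcycles 2 := Preadditive.sub_comp _ _ _
  exact this.trans (congrArg (fun f => f.hom (1 : ℤ)) e)

/-- A function on singular 2-simplices which vanishes on boundaries, as a homomorphism. -/
theorem exists_cocycle_hom {A : Type} [AddCommGroup A] (φ : (Sing X) _⦋2⦌ → A)
    (hφ : ∀ y : (Sing X) _⦋3⦌, φ ((Sing X).δ 0 y) - φ ((Sing X).δ 1 y) + φ ((Sing X).δ 2 y)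
      - φ ((Sing X).δ 3 y) = 0) :
    ∃ Φ : (SingChain X).opcycles 2 →+ A, ∀ x, Φ (cell x) = φ x := by
  let toA (a : A) : ModuleCat.of ℤ ℤ ⟶ ModuleCat.of ℤ A :=
    ModuleCat.ofHom (LinearMap.toSpanSingleton ℤ A a)
  let D : (SingChain X).X 2 ⟶ ModuleCat.of ℤ A :=
    ((Sing X).isColimitChainComplexXCofan (ModuleCat.of ℤ ℤ) 2).desc
      (Limits.Cofan.mk _ fun x => toA (φ x))
  have hD (x) : (Sing X).ιChainComplex x ≫ D = toA (φ x) :=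
    ((Sing X).isColimitChainComplexXCofan (ModuleCat.of ℤ ℤ) 2).fac _ ⟨x⟩
  have hd : (SingChain X).d 3 2 ≫ D = 0 := by
    refine SSet.chainComplex_hom_ext fun y => ?_
    rw [← Category.assoc, SSet.ιChainComplex_d, Preadditive.sum_comp, Fin.sum_univ_four]
    simp only [Preadditive.zsmul_comp, hD]
    ext
    have := hφ y
    simp [toA]
    rw [← this]
    abel
  refine ⟨((SingChain X).descOpcycles D 3 (by simp) hd).hom.toAddMonoidHom, fun x => ?_⟩
  have : (Sing X).ιChainComplex x ≫ (SingChain X).pOpcycles 2 ≫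
      (SingChain X).descOpcycles D 3 (by simp) hd = toA (φ x) := by
    rw [HomologicalComplex.p_descOpcycles, hD]
  have := congrArg (fun f => f.hom (1 : ℤ)) this
  refine Eq.trans ?_ (this.trans (by simp [toA]))
  rfl

/-- Let `Q` be the linear extension of `q` to 1-chains. The operator `1 - Q ∘ d` fixes every cycle,
while by assumption it maps each simplex into the image of `P` modulo boundaries. -/
theorem eq_top_of_cell_sub_mem (q : (Sing X) _⦋1⦌ → (Sing X) _⦋2⦌)
    (P : AddSubgroup (H2 X))
    (h : ∀ x : (Sing X) _⦋2⦌, ∃ a ∈ P, ((SingChain X).homologyι 2).hom a =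
      cell x - (cell (q ((Sing X).δ 0 x)) - cell (q ((Sing X).δ 1 x)) +
        cell (q ((Sing X).δ 2 x)))) : P = ⊤ := by
  let Q : (SingChain X).X 1 ⟶ (SingChain X).X 2 :=
    ((Sing X).isColimitChainComplexXCofan (ModuleCat.of ℤ ℤ) 1).desc
      (Limits.Cofan.mk _ fun x => (Sing X).ιChainComplex (q x))
  have hQ (x) : (Sing X).ιChainComplex x ≫ Q = (Sing X).ιChainComplex (q x) :=
    ((Sing X).isColimitChainComplexXCofan (ModuleCat.of ℤ ℤ) 1).fac _ ⟨x⟩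
  let M : AddSubgroup ((SingChain X).opcycles 2) :=
    AddSubgroup.map ((SingChain X).homologyι 2).hom.toAddMonoidHom P
  let π : (SingChain X).opcycles 2 ⟶ ModuleCat.of ℤ ((SingChain X).opcycles 2 ⧸ M) :=
    ModuleCat.ofHom
      { QuotientAddGroup.mk' M with
        map_smul' := fun n x => (congrArg (QuotientAddGroup.mk' M)
          (int_smul_eq_zsmul _ n x)).trans (map_zsmul (QuotientAddGroup.mk' M) n x) }
  have key : (𝟙 _ - (SingChain X).d 2 1 ≫ Q) ≫ (SingChain X).pOpcycles 2 ≫ π = 0 := by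
    refine SSet.chainComplex_hom_ext fun x => ?_
    obtain ⟨a, ha, hx⟩ := h x
    have e : (Sing X).ιChainComplex x ≫ (𝟙 _ - (SingChain X).d 2 1 ≫ Q) =
        (Sing X).ιChainComplex x - ((Sing X).ιChainComplex (q ((Sing X).δ 0 x)) -
          (Sing X).ιChainComplex (q ((Sing X).δ 1 x)) +
          (Sing X).ιChainComplex (q ((Sing X).δ 2 x))) := by
      rw [Preadditive.comp_sub, ← Category.assoc _ _ Q, SSet.ιChainComplex_d,
        Preadditive.sum_comp, Fin.sum_univ_three]
      simp [hQ, sub_eq_add_neg]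
    rw [← Category.assoc, e, Limits.comp_zero]
    ext
    have hm : ((SingChain X).homologyι 2).hom a ∈ M := ⟨a, ha, rfl⟩
    rw [hx] at hm
    have := (QuotientAddGroup.eq_zero_iff _).2 hm
    simp only [Preadditive.sub_comp, Preadditive.add_comp]
    exact this
  refine eq_top_iff.2 fun y _ => ?_
  obtain ⟨z, rfl⟩ := (ModuleCat.epi_iff_surjective ((SingChain X).homologyπ 2)).1 inferInstance y
  have e1 : (SingChain X).homologyπ 2 ≫ (SingChain X).homologyι 2 ≫ π =
      (SingChain X).iCycles 2 ≫ ((SingChain X).d 2 1 ≫ Q) ≫ (SingChain X).pOpcycles 2 ≫ π := by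
    rw [Preadditive.sub_comp, sub_eq_zero, Category.id_comp] at key
    rw [HomologicalComplex.homology_π_ι_assoc, ← key]
  rw [Category.assoc, HomologicalComplex.iCycles_d_assoc, Limits.zero_comp] at e1
  have e2 := congrArg (fun f => f.hom z) e1
  have e3 : ((SingChain X).homologyι 2).hom (((SingChain X).homologyπ 2).hom z) ∈ M :=
    (QuotientAddGroup.eq_zero_iff _).1 e2
  obtain ⟨a, ha, hz⟩ := e3
  rw [← homologyι_injective hz]
  exact ha

end SingularChains

/-! ### Horn filling in the singular simplicial set -/

section HornFilling

open Simplicial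

theorem stdSimplex_map_of_injective {A B : Type*} [Fintype A] [Fintype B] {f : A → B}
    (hf : Function.Injective f) (y : stdSimplex ℝ A) (j : A) :
    (stdSimplex.map f y).1 (f j) = y.1 j := by
  classical
  change FunOnFinite.linearMap ℝ ℝ f y.1 (f j) = y.1 j
  rw [FunOnFinite.linearMap_apply_apply, Finset.sum_eq_single j]
  · intro b hb hne
    exact absurd (hf (Finset.mem_filter.1 hb).2) hne
  · intro h
    simp at h

theorem stdSimplex_map_of_notMem {A B : Type*} [Fintype A] [Fintype B] {f : A → B} {i : B}
    (hi : ∀ j, f j ≠ i) (y : stdSimplex ℝ A) : (stdSimplex.map f y).1 i = 0 := by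
  classical
  change FunOnFinite.linearMap ℝ ℝ f y.1 i = 0
  rw [FunOnFinite.linearMap_apply_apply]
  exact Finset.sum_eq_zero fun j hj => absurd (Finset.mem_filter.1 hj).2 (hi j)

theorem exists_face_eq {n : ℕ} {i : Fin (n + 2)} {y : stdSimplex ℝ (Fin (n + 2))}
    (hy : y.1 i = 0) : ∃ z : stdSimplex ℝ (Fin (n + 1)), stdSimplex.map i.succAbove z = y := by
  refine ⟨⟨fun j => y.1 (i.succAbove j), fun j => y.2.1 _, ?_⟩, ?_⟩
  · have := y.2.2
    rwa [Fin.sum_univ_succAbove _ i, hy, zero_add] at this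
  · refine Subtype.ext (funext fun j => ?_)
    rcases eq_or_ne j i with rfl | hj
    · rw [stdSimplex_map_of_notMem (fun j => Fin.succAbove_ne _ j), hy]
    · obtain ⟨k, rfl⟩ := Fin.exists_succAbove_eq hj
      rw [stdSimplex_map_of_injective Fin.succAbove_right_injective]

theorem face_injective {n : ℕ} (i : Fin (n + 2)) :
    Function.Injective (stdSimplex.map (S := ℝ) (i.succAbove : Fin (n + 1) → Fin (n + 2))) := by
  intro y z h
  refine Subtype.ext (funext fun j => ?_)
  rw [← stdSimplex_map_of_injective (Fin.succAbove_right_injective (p := i)) y, h,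
    stdSimplex_map_of_injective Fin.succAbove_right_injective]

/-- The retraction of a simplex onto the horn obtained by removing the face opposite to `k`. -/
theorem exists_horn_retraction {n : ℕ} (k : Fin (n + 2)) :
    ∃ r : C(stdSimplex ℝ (Fin (n + 2)), stdSimplex ℝ (Fin (n + 2))),
      (∀ y, ∃ i, i ≠ k ∧ (r y).1 i = 0) ∧ ∀ i y, i ≠ k → y.1 i = 0 → r y = y := by
  classical
  have hne : (Finset.univ : Finset (Fin (n + 1))).Nonempty := Finset.univ_nonempty
  let μ (y : Fin (n + 2) → ℝ) : ℝ := Finset.univ.inf' hne fun j => y (k.succAbove j)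
  have hμ (y : Fin (n + 2) → ℝ) (j) : μ y ≤ y (k.succAbove j) := Finset.inf'_le _ (Finset.mem_univ j)
  have hμ0 (y : stdSimplex ℝ (Fin (n + 2))) : 0 ≤ μ y.1 :=
    Finset.le_inf' _ _ fun j _ => y.2.1 _
  -- The point is pushed towards the vertex `k` until another coordinate vanishes: the smallest of
  -- the other `n + 1` coordinates is subtracted from all of them and their total loss is added at
  -- `k`.
  let g (y : Fin (n + 2) → ℝ) : Fin (n + 2) → ℝ :=
    k.insertNth (y k + (n + 1) * μ y) fun j => y (k.succAbove j) - μ y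
  have hg : Continuous g := by
    have : Continuous μ := Continuous.finset_inf'_apply hne fun j _ => continuous_apply _
    exact Continuous.finInsertNth k (by fun_prop) (by fun_prop)
  refine ⟨⟨fun y => ⟨g y.1, ?_, ?_⟩, ?_⟩, ?_, ?_⟩
  · intro j
    rcases eq_or_ne j k with rfl | hj
    · simp only [g, Fin.insertNth_apply_same]
      have := hμ0 y; have := y.2.1 j; positivity
    · obtain ⟨j, rfl⟩ := Fin.exists_succAbove_eq hj
      simpa [g] using hμ y.1 j
  · have := y.2.2
    rw [Fin.sum_univ_succAbove _ k] at this ⊢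
    simp only [g, Fin.insertNth_apply_same, Fin.insertNth_apply_succAbove,
      Finset.sum_sub_distrib, Finset.sum_const, Finset.card_univ, Fintype.card_fin, nsmul_eq_mul]
    push_cast
    linarith
  · exact (hg.comp continuous_subtype_val).subtype_mk _
  · intro y
    obtain ⟨j, -, hj⟩ := Finset.exists_mem_eq_inf' hne fun j => y.1 (k.succAbove j)
    refine ⟨k.succAbove j, Fin.succAbove_ne _ _, ?_⟩
    simp only [ContinuousMap.coe_mk, g, Fin.insertNth_apply_succAbove]
    exact sub_eq_zero.2 hj.symm
  · intro i y hi hy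
    obtain ⟨j, rfl⟩ := Fin.exists_succAbove_eq hi
    have h0 : μ y.1 = 0 := le_antisymm ((hμ y.1 j).trans hy.le) (hμ0 y)
    refine Subtype.ext (funext fun l => ?_)
    rcases eq_or_ne l k with rfl | hl
    · simp [g, h0]
    · obtain ⟨l, rfl⟩ := Fin.exists_succAbove_eq hl
      simp [g, h0]

variable {X : Type} [TopologicalSpace X]

/-- A singular simplex as a continuous map. -/
def simplexMap {n : ℕ} (x : (Sing X) _⦋n⦌) : C(stdSimplex ℝ (Fin (n + 1)), X) :=
  TopCat.toSSetObjEquiv (TopCat.of X) (Opposite.op ⦋n⦌) x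

/-- A continuous map as a singular simplex. -/
def ofSimplexMap {n : ℕ} (f : C(stdSimplex ℝ (Fin (n + 1)), X)) : (Sing X) _⦋n⦌ :=
  (TopCat.toSSetObjEquiv (TopCat.of X) (Opposite.op ⦋n⦌)).symm f

@[simp]
theorem simplexMap_ofSimplexMap {n : ℕ} (f : C(stdSimplex ℝ (Fin (n + 1)), X)) :
    simplexMap (ofSimplexMap f) = f := Equiv.apply_symm_apply _ f

theorem simplexMap_injective {n : ℕ} :
    Function.Injective (simplexMap : (Sing X) _⦋n⦌ → _) := Equiv.injective _

theorem simplexMap_δ {n : ℕ} (x : (Sing X) _⦋n + 1⦌) (i : Fin (n + 2)) (y) :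
    simplexMap ((Sing X).δ i x) y = simplexMap x (stdSimplex.map i.succAbove y) := rfl

theorem simplexMap_σ {n : ℕ} (x : (Sing X) _⦋n⦌) (i : Fin (n + 1)) (y) :
    simplexMap ((Sing X).σ i x) y = simplexMap x (stdSimplex.map i.predAbove y) := rfl

/-- Horn filling in the singular simplicial set. -/
theorem exists_horn_filler {n : ℕ} (k : Fin (n + 3)) (x : Fin (n + 3) → (Sing X) _⦋n + 1⦌)
    (h : ∀ i j : Fin (n + 2), i ≤ j → j.succ ≠ k → i.castSucc ≠ k →
      (Sing X).δ i (x j.succ) = (Sing X).δ j (x i.castSucc)) :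
    ∃ y : (Sing X) _⦋n + 2⦌, ∀ j, j ≠ k → (Sing X).δ j y = x j := by
  classical
  have hlt : ∀ (a b : Fin (n + 3)), a < b → a ≠ k → b ≠ k →
      ∀ y z : stdSimplex ℝ (Fin (n + 2)), stdSimplex.map a.succAbove y = stdSimplex.map b.succAbove z →
        simplexMap (x a) y = simplexMap (x b) z := by
    intro a b hab ha hb y z hyz
    obtain ⟨j, rfl⟩ := Fin.eq_succ_of_ne_zero (Fin.ne_zero_of_lt hab)
    obtain ⟨i, rfl⟩ := Fin.eq_castSucc_of_ne_last (Fin.ne_last_of_lt hab)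
    have hij : i ≤ j := Fin.castSucc_lt_succ_iff.1 hab
    -- A point common to the two faces lies in their common face of codimension two, where the
    -- compatibility hypothesis applies.
    have hzi : z.1 i = 0 := by
      rw [← stdSimplex_map_of_injective (Fin.succAbove_right_injective (p := j.succ)) z, ← hyz,
        Fin.succAbove_of_castSucc_lt _ _ hab]
      exact stdSimplex_map_of_notMem (fun l => Fin.succAbove_ne _ l) y
    obtain ⟨w, rfl⟩ := exists_face_eq hzi
    have hc : j.succ.succAbove ∘ i.succAbove = i.castSucc.succAbove ∘ j.succAbove :=
      funext fun l => by
        have := SimplexCategory.δ_comp_δ hij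
        exact congrArg (fun f => f.toOrderHom l) this
    rw [stdSimplex.map_comp_apply] at hyz
    change stdSimplex.map _ y = stdSimplex.map (j.succ.succAbove ∘ i.succAbove) w at hyz
    rw [hc] at hyz
    have hy : y = stdSimplex.map j.succAbove w := by
      apply face_injective i.castSucc
      rw [hyz, stdSimplex.map_comp_apply]
    rw [hy, ← simplexMap_δ, ← simplexMap_δ, h i j hij hb ha]
  have hglue : ∀ (a b : Fin (n + 3)), a ≠ k → b ≠ k →
      ∀ y z : stdSimplex ℝ (Fin (n + 2)), stdSimplex.map a.succAbove y = stdSimplex.map b.succAbove z →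
        simplexMap (x a) y = simplexMap (x b) z := by
    intro a b ha hb y z hyz
    rcases lt_trichotomy a b with hab | rfl | hab
    · exact hlt a b hab ha hb y z hyz
    · rw [face_injective a hyz]
    · exact (hlt b a hab hb ha z y hyz.symm).symm
  obtain ⟨r, hr, hr'⟩ := exists_horn_retraction k
  choose s hsk hs0 using hr
  choose d hd using fun y => exists_face_eq (hs0 y)
  -- The value is read off on any face containing the retracted point; `hglue` makes the choice
  -- irrelevant.
  let g : stdSimplex ℝ (Fin (n + 3)) → X := fun y => simplexMap (x (s y)) (d y)
  have hg : ∀ a y z, a ≠ k → stdSimplex.map a.succAbove z = r y → g y = simplexMap (x a) z :=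
    fun a y z ha hz => hglue _ _ (hsk y) ha _ _ ((hd y).trans hz.symm)
  have hcont : Continuous g := by
    let f : {a : Fin (n + 3) // a ≠ k} → Set (stdSimplex ℝ (Fin (n + 3))) :=
      fun a => {y | (r y).1 a = 0}
    refine LocallyFinite.continuous (f := f) (locallyFinite_of_finite f) ?_ ?_ ?_
    · exact Set.eq_univ_of_forall fun y => Set.mem_iUnion.2 ⟨⟨s y, hsk y⟩, hs0 y⟩
    · intro a
      exact isClosed_eq ((continuous_apply _).comp (continuous_subtype_val.comp r.continuous))
        continuous_const
    · rintro ⟨a, ha⟩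
      -- A left inverse of the vertex map of the face gives a continuous formula for `g` on the
      -- closed set where the retraction lands in that face.
      obtain ⟨p, hp⟩ := (Fin.succAbove_right_injective (p := a)).hasLeftInverse
      have : Set.EqOn g (fun y => simplexMap (x a) (stdSimplex.map p (r y))) (f ⟨a, ha⟩) := by
        intro y hy
        obtain ⟨z, hz⟩ := exists_face_eq hy
        change g y = simplexMap (x a) (stdSimplex.map p (r y))
        rw [hg a y z ha hz, ← hz, stdSimplex.map_comp_apply]
        have : p ∘ a.succAbove = id := funext hp
        change _ = simplexMap (x a) (stdSimplex.map (p ∘ a.succAbove) z)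
        rw [this, stdSimplex.map_id_apply]
      refine ContinuousOn.congr (Continuous.continuousOn ?_) this
      exact (simplexMap (x a)).continuous.comp
        ((stdSimplex.continuous_map p).comp r.continuous)
  refine ⟨ofSimplexMap ⟨g, hcont⟩, fun j hj => simplexMap_injective (ContinuousMap.ext fun y => ?_)⟩
  rw [simplexMap_δ, simplexMap_ofSimplexMap]
  refine hg j _ y hj (hr' j _ hj ?_).symm
  exact stdSimplex_map_of_notMem (fun l => Fin.succAbove_ne _ l) y

end HornFilling

/-! ### Triangles in simply connected spaces -/

section Hurewicz

open Simplicial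

variable {X : Type} [TopologicalSpace X]

/-- The map from the square to the 2-simplex which sends `r = 0` to the long edge, `r = 1` to the
two other edges, and collapses `t = 0` and `t = 1` to vertices. -/
def bigonMap : C(I × I, stdSimplex ℝ (Fin 3)) where
  toFun p := ⟨![1 - p.2 - p.1 * min (p.2 : ℝ) (1 - p.2), 2 * (p.1 * min (p.2 : ℝ) (1 - p.2)),
      p.2 - p.1 * min (p.2 : ℝ) (1 - p.2)], by
    have h0 := p.1.2.1
    have h1 := p.1.2.2
    have h2 : 0 ≤ min (p.2 : ℝ) (1 - p.2) := le_min p.2.2.1 (sub_nonneg.2 p.2.2.2)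
    have h3 : (p.1 : ℝ) * min (p.2 : ℝ) (1 - p.2) ≤ min (p.2 : ℝ) (1 - p.2) :=
      mul_le_of_le_one_left h2 h1
    have h4 := min_le_left (p.2 : ℝ) (1 - p.2)
    have h5 := min_le_right (p.2 : ℝ) (1 - p.2)
    constructor
    · intro i
      fin_cases i
      · simp; linarith
      · simp; positivity
      · simp; linarith
    · simp [Fin.sum_univ_three]; ring⟩
  continuous_toFun := by
    refine Continuous.subtype_mk (continuous_pi fun i => ?_) _
    fin_cases i <;> simp <;> fun_prop

theorem bigonMap_surjective : Function.Surjective bigonMap := by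
  intro y
  have hs := y.2.2
  rw [Fin.sum_univ_three] at hs
  have n0 := y.2.1 0
  have n1 := y.2.1 1
  have n2 := y.2.1 2
  have hM : y.1 1 / 2 ≤ min (y.1 2 + y.1 1 / 2) (1 - (y.1 2 + y.1 1 / 2)) :=
    le_min (by linarith) (by linarith)
  obtain ⟨r, hr0, hr1, hr⟩ : ∃ r : ℝ, 0 ≤ r ∧ r ≤ 1 ∧
      r * min (y.1 2 + y.1 1 / 2) (1 - (y.1 2 + y.1 1 / 2)) = y.1 1 / 2 := by
    rcases n1.eq_or_lt with h | h
    · exact ⟨0, le_rfl, zero_le_one, by rw [← h]; simp⟩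
    · have : 0 < min (y.1 2 + y.1 1 / 2) (1 - (y.1 2 + y.1 1 / 2)) := by linarith
      exact ⟨_, by positivity, (div_le_one this).2 hM, div_mul_cancel₀ _ this.ne'⟩
  refine ⟨(⟨r, hr0, hr1⟩, ⟨y.1 2 + y.1 1 / 2, by constructor <;> linarith⟩), ?_⟩
  refine Subtype.ext (funext fun i => ?_)
  fin_cases i
  · simp only [bigonMap, ContinuousMap.coe_mk, hr]; simp; linarith
  · simp only [bigonMap, ContinuousMap.coe_mk, hr]; simp; ring
  · simp only [bigonMap, ContinuousMap.coe_mk, hr]; simp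

/-- The only identifications occur at `t = 0` and `t = 1`, where a homotopy of paths is stationary,
so such a homotopy descends to the simplex. -/
theorem bigonMap_eq {p q : I × I} (h : bigonMap p = bigonMap q) :
    p.2 = q.2 ∧ (p.1 = q.1 ∨ p.2 = 0 ∨ p.2 = 1) := by
  have h1 := congrFun (congrArg Subtype.val h) 1
  have h2 := congrFun (congrArg Subtype.val h) 2
  simp only [bigonMap, ContinuousMap.coe_mk, Matrix.cons_val] at h1 h2
  have ht : (p.2 : ℝ) = q.2 := by linarith
  refine ⟨Subtype.ext ht, ?_⟩
  rw [← ht] at h1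
  rcases mul_eq_mul_right_iff.1 (mul_left_cancel₀ two_ne_zero h1) with h | h
  · exact Or.inl (Subtype.ext h)
  · rcases min_choice (p.2 : ℝ) (1 - p.2) with e | e
    · exact Or.inr (Or.inl (Subtype.ext (e ▸ h)))
    · exact Or.inr (Or.inr (Subtype.ext (sub_eq_zero.1 (e ▸ h)).symm))

/-- The point of the 1-simplex with second coordinate `t`. -/
def edgePoint : C(I, stdSimplex ℝ (Fin 2)) where
  toFun t := ⟨![1 - t, t], by
    constructor
    · intro i
      fin_cases i
      · exact sub_nonneg.2 t.2.2
      · exact t.2.1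
    · simp⟩
  continuous_toFun := by
    refine Continuous.subtype_mk (continuous_pi fun i => ?_) _
    fin_cases i <;> simp <;> fun_prop

theorem stdSimplex_one_mem (y : stdSimplex ℝ (Fin 2)) : y.1 1 ∈ I :=
  ⟨y.2.1 1, by have h := y.2.2; rw [Fin.sum_univ_two] at h; linarith [y.2.1 0]⟩

theorem edgePoint_eq (y : stdSimplex ℝ (Fin 2)) : edgePoint ⟨y.1 1, stdSimplex_one_mem y⟩ = y := by
  have h := y.2.2
  rw [Fin.sum_univ_two] at h
  refine Subtype.ext (funext fun i => ?_)
  fin_cases i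
  · simp [edgePoint]; linarith
  · rfl

theorem stdSimplex_zero_subsingleton (y z : stdSimplex ℝ (Fin 1)) : y = z := by
  refine Subtype.ext (funext fun i => ?_)
  have h := y.2.2
  have h' := z.2.2
  rw [Fin.sum_univ_one] at h h'
  rw [Subsingleton.elim i 0, h, h']

theorem face_zero_edge (y : stdSimplex ℝ (Fin 1)) :
    stdSimplex.map (0 : Fin 2).succAbove y = edgePoint 1 := by
  have h := y.2.2
  rw [Fin.sum_univ_one] at h
  refine Subtype.ext (funext fun i => ?_)
  fin_cases i
  · exact (stdSimplex_map_of_notMem (fun l => Fin.succAbove_ne _ l) y).trans (by simp [edgePoint])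
  · exact (stdSimplex_map_of_injective (Fin.succAbove_right_injective (p := (0 : Fin 2))) y 0).trans
      (by simp [edgePoint, h])

theorem face_one_edge (y : stdSimplex ℝ (Fin 1)) :
    stdSimplex.map (1 : Fin 2).succAbove y = edgePoint 0 := by
  have h := y.2.2
  rw [Fin.sum_univ_one] at h
  refine Subtype.ext (funext fun i => ?_)
  fin_cases i
  · exact (stdSimplex_map_of_injective (Fin.succAbove_right_injective (p := (1 : Fin 2))) y 0).trans
      (by simp [edgePoint, h])
  · exact (stdSimplex_map_of_notMem (fun l => Fin.succAbove_ne _ l) y).trans (by simp [edgePoint])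

/-- A 1-simplex as a path. -/
def edgePath (e : (Sing X) _⦋1⦌) {a b : X} (ha : simplexMap e (edgePoint 0) = a)
    (hb : simplexMap e (edgePoint 1) = b) : Path a b where
  toContinuousMap := (simplexMap e).comp edgePoint
  source' := ha
  target' := hb

theorem face_edgePoint (i : Fin 3) (t : I) :
    (stdSimplex.map i.succAbove (edgePoint t)).1 = i.insertNth 0 (edgePoint t).1 := by
  refine funext fun j => ?_
  rcases eq_or_ne j i with rfl | hj
  · rw [stdSimplex_map_of_notMem (fun l => Fin.succAbove_ne _ l), Fin.insertNth_apply_same]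
  · obtain ⟨k, rfl⟩ := Fin.exists_succAbove_eq hj
    rw [stdSimplex_map_of_injective Fin.succAbove_right_injective, Fin.insertNth_apply_succAbove]

/-- In a simply connected space, every triangle of singular 1-simplices bounds a 2-simplex. -/
theorem exists_triangle [SimplyConnectedSpace X] (e₀ e₁ e₂ : (Sing X) _⦋1⦌)
    (h₀ : (Sing X).δ 0 e₁ = (Sing X).δ 0 e₀) (h₁ : (Sing X).δ 1 e₀ = (Sing X).δ 0 e₂)
    (h₂ : (Sing X).δ 1 e₁ = (Sing X).δ 1 e₂) :
    ∃ t : (Sing X) _⦋2⦌, (Sing X).δ 0 t = e₀ ∧ (Sing X).δ 1 t = e₁ ∧ (Sing X).δ 2 t = e₂ := by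
  let y : stdSimplex ℝ (Fin 1) := ⟨fun _ => 1, fun _ => zero_le_one, by simp⟩
  have h₀' : simplexMap e₁ (edgePoint 1) = simplexMap e₀ (edgePoint 1) := by
    exact (congrArg (simplexMap e₁) (face_zero_edge y)).symm.trans
      ((DFunLike.congr_fun (congrArg simplexMap h₀) y).trans
        (congrArg (simplexMap e₀) (face_zero_edge y)))
  have h₁' : simplexMap e₀ (edgePoint 0) = simplexMap e₂ (edgePoint 1) := by
    exact (congrArg (simplexMap e₀) (face_one_edge y)).symm.trans
      ((DFunLike.congr_fun (congrArg simplexMap h₁) y).trans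
        (congrArg (simplexMap e₂) (face_zero_edge y)))
  have h₂' : simplexMap e₁ (edgePoint 0) = simplexMap e₂ (edgePoint 0) := by
    exact (congrArg (simplexMap e₁) (face_one_edge y)).symm.trans
      ((DFunLike.congr_fun (congrArg simplexMap h₂) y).trans
        (congrArg (simplexMap e₂) (face_one_edge y)))
  obtain ⟨H⟩ := SimplyConnectedSpace.paths_homotopic (edgePath e₁ h₂' h₀')
    ((edgePath e₂ rfl rfl).trans (edgePath e₀ h₁' rfl))
  have hq : Topology.IsQuotientMap bigonMap :=
    bigonMap.continuous.isClosedMap.isQuotientMap bigonMap.continuous bigonMap_surjective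
  have hH : ∀ p q, bigonMap p = bigonMap q → H p = H q := by
    rintro ⟨r, t⟩ ⟨r', t'⟩ h
    obtain ⟨h1, h2⟩ := bigonMap_eq h
    simp only at h1 h2
    subst h1
    rcases h2 with rfl | rfl | rfl
    · rfl
    · simp
    · simp
  let g : C(stdSimplex ℝ (Fin 3), X) := hq.lift H.toContinuousMap hH
  have hg : ∀ p, g (bigonMap p) = H p := fun p =>
    DFunLike.congr_fun (hq.lift_comp H.toContinuousMap hH) p
  have hface (i : Fin 3) (e : (Sing X) _⦋1⦌)
      (h : ∀ t, g (stdSimplex.map i.succAbove (edgePoint t)) = simplexMap e (edgePoint t)) :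
      (Sing X).δ i (ofSimplexMap g) = e := by
    refine simplexMap_injective (ContinuousMap.ext fun z => ?_)
    rw [simplexMap_δ, simplexMap_ofSimplexMap, ← edgePoint_eq z, h]
  refine ⟨ofSimplexMap g, hface 0 e₀ fun t => ?_, hface 1 e₁ fun t => ?_, hface 2 e₂ fun t => ?_⟩
  -- At `r = 1` the bigon runs through edge 2 for `t ≤ 1/2` and then through edge 0, in step with
  -- the halves of the concatenated path.
  · have ht : ((1 + t) / 2 : ℝ) ∈ I := ⟨by linarith [t.2.1], by linarith [t.2.2]⟩
    have : stdSimplex.map (0 : Fin 3).succAbove (edgePoint t) = bigonMap (1, ⟨(1 + t) / 2, ht⟩) := by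
      refine Subtype.ext ((face_edgePoint 0 t).trans (funext fun i => ?_))
      have : min ((1 + t) / 2 : ℝ) (1 - (1 + t) / 2) = 1 - (1 + t) / 2 :=
        min_eq_right (by linarith [t.2.1])
      fin_cases i <;> simp [bigonMap, edgePoint, this] <;> ring
    rw [this, hg]
    refine (H.apply_one _).trans ?_
    change ((edgePath e₂ rfl rfl).trans (edgePath e₀ h₁' rfl)) _ = _
    rw [Path.trans_apply]
    split_ifs with h
    · have h0 : (t : ℝ) = 0 := le_antisymm (by simp at h; linarith) t.2.1
      have h0 : t = 0 := Subtype.ext h0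
      subst h0
      rw [h₁']
      refine congrArg (simplexMap e₂) (congrArg edgePoint (Subtype.ext ?_))
      simp
    · refine congrArg (simplexMap e₀) (congrArg edgePoint (Subtype.ext ?_))
      simp; ring
  · have : stdSimplex.map (1 : Fin 3).succAbove (edgePoint t) = bigonMap (0, t) := by
      refine Subtype.ext ((face_edgePoint 1 t).trans (funext fun i => ?_))
      fin_cases i
      · simp [bigonMap, edgePoint, Fin.insertNth_apply_below]
      · simp [bigonMap]
      · simp [bigonMap, edgePoint, Fin.insertNth_apply_above]
    rw [this, hg]
    exact H.apply_zero _
  · have ht : (t / 2 : ℝ) ∈ I := ⟨by linarith [t.2.1], by linarith [t.2.2]⟩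
    have : stdSimplex.map (2 : Fin 3).succAbove (edgePoint t) = bigonMap (1, ⟨t / 2, ht⟩) := by
      refine Subtype.ext ((face_edgePoint 2 t).trans (funext fun i => ?_))
      have : min (t / 2 : ℝ) (1 - t / 2) = t / 2 := min_eq_left (by linarith [t.2.2])
      fin_cases i
      · simp [bigonMap, edgePoint, this, Fin.insertNth_apply_below]; ring
      · simp [bigonMap, edgePoint, this, Fin.insertNth_apply_below]; ring
      · simp [bigonMap, edgePoint, this]
    rw [this, hg]
    refine (H.apply_one _).trans ?_
    change ((edgePath e₂ rfl rfl).trans (edgePath e₀ h₁' rfl)) _ = _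
    rw [Path.trans_apply, dif_pos (by simp; linarith [t.2.2])]
    refine congrArg (simplexMap e₂) (congrArg edgePoint (Subtype.ext ?_))
    simp; ring

end Hurewicz

/-! ### Surjectivity of the Hurewicz map in degree two -/

section HurewiczSurjective

open Simplicial

variable {X : Type} [TopologicalSpace X]

/-- The constant singular simplex. -/
def constSimplex (n : ℕ) (x : X) : (Sing X) _⦋n⦌ := ofSimplexMap (ContinuousMap.const _ x)

theorem singular_δ_δ {n : ℕ} {i j : Fin (n + 2)} (h : i ≤ j) (x : (Sing X) _⦋n + 2⦌) :
    (Sing X).δ i ((Sing X).δ j.succ x) = (Sing X).δ j ((Sing X).δ i.castSucc x) :=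
  ConcreteCategory.congr_hom ((Sing X).δ_comp_δ h) x

section Tetrahedron

variable {x₀ x₁ x₂ x₃ : (Sing X) _⦋2⦌}

theorem exists_tetrahedron_zero (h₁ : (Sing X).δ 1 x₂ = (Sing X).δ 1 x₁)
    (h₂ : (Sing X).δ 1 x₃ = (Sing X).δ 2 x₁) (h₃ : (Sing X).δ 2 x₃ = (Sing X).δ 2 x₂) :
    ∃ y : (Sing X) _⦋3⦌, (Sing X).δ 1 y = x₁ ∧ (Sing X).δ 2 y = x₂ ∧ (Sing X).δ 3 y = x₃ := by
  obtain ⟨y, hy⟩ := exists_horn_filler (X := X) (n := 1) 0 ![x₁, x₁, x₂, x₃] (by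
    intro i j
    fin_cases i <;> fin_cases j <;> intro hij hj hi <;>
      first
        | exact absurd rfl hi
        | exact absurd hij (by decide)
        | exact h₁
        | exact h₂
        | exact h₃)
  exact ⟨y, hy 1 (by decide), hy 2 (by decide), hy 3 (by decide)⟩

theorem exists_tetrahedron_one (h₁ : (Sing X).δ 0 x₂ = (Sing X).δ 1 x₀)
    (h₂ : (Sing X).δ 0 x₃ = (Sing X).δ 2 x₀) (h₃ : (Sing X).δ 2 x₃ = (Sing X).δ 2 x₂) :
    ∃ y : (Sing X) _⦋3⦌, (Sing X).δ 0 y = x₀ ∧ (Sing X).δ 2 y = x₂ ∧ (Sing X).δ 3 y = x₃ := by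
  obtain ⟨y, hy⟩ := exists_horn_filler (X := X) (n := 1) 1 ![x₀, x₀, x₂, x₃] (by
    intro i j
    fin_cases i <;> fin_cases j <;> intro hij hj hi <;>
      first
        | exact absurd rfl hi
        | exact absurd rfl hj
        | exact absurd hij (by decide)
        | exact h₁
        | exact h₂
        | exact h₃)
  exact ⟨y, hy 0 (by decide), hy 2 (by decide), hy 3 (by decide)⟩

theorem exists_tetrahedron_two (h₁ : (Sing X).δ 0 x₁ = (Sing X).δ 0 x₀)
    (h₂ : (Sing X).δ 0 x₃ = (Sing X).δ 2 x₀) (h₃ : (Sing X).δ 1 x₃ = (Sing X).δ 2 x₁) :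
    ∃ y : (Sing X) _⦋3⦌, (Sing X).δ 0 y = x₀ ∧ (Sing X).δ 1 y = x₁ ∧ (Sing X).δ 3 y = x₃ := by
  obtain ⟨y, hy⟩ := exists_horn_filler (X := X) (n := 1) 2 ![x₀, x₁, x₀, x₃] (by
    intro i j
    fin_cases i <;> fin_cases j <;> intro hij hj hi <;>
      first
        | exact absurd rfl hi
        | exact absurd rfl hj
        | exact absurd hij (by decide)
        | exact h₁
        | exact h₂
        | exact h₃)
  exact ⟨y, hy 0 (by decide), hy 1 (by decide), hy 3 (by decide)⟩

end Tetrahedron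

/-- All edges of the 2-simplex are constant. -/
def IsSpherical (a : X) (x : (Sing X) _⦋2⦌) : Prop := ∀ i, (Sing X).δ i x = constSimplex 1 a

theorem isSpherical_constSimplex (a : X) : IsSpherical a (constSimplex 2 a) := fun _ => rfl

/-- Every edge of the `k`-th face is also an edge of another face. -/
theorem IsSpherical.of_tetrahedron {a : X} {y : (Sing X) _⦋3⦌} (k : Fin 4)
    (h : ∀ j, j ≠ k → IsSpherical a ((Sing X).δ j y)) : IsSpherical a ((Sing X).δ k y) := by
  intro i
  have e01 : (Sing X).δ 0 ((Sing X).δ 1 y) = (Sing X).δ 0 ((Sing X).δ 0 y) :=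
    singular_δ_δ (i := 0) (j := 0) (by decide) y
  have e02 : (Sing X).δ 0 ((Sing X).δ 2 y) = (Sing X).δ 1 ((Sing X).δ 0 y) :=
    singular_δ_δ (i := 0) (j := 1) (by decide) y
  have e03 : (Sing X).δ 0 ((Sing X).δ 3 y) = (Sing X).δ 2 ((Sing X).δ 0 y) :=
    singular_δ_δ (i := 0) (j := 2) (by decide) y
  have e12 : (Sing X).δ 1 ((Sing X).δ 2 y) = (Sing X).δ 1 ((Sing X).δ 1 y) :=
    singular_δ_δ (i := 1) (j := 1) (by decide) y
  have e13 : (Sing X).δ 1 ((Sing X).δ 3 y) = (Sing X).δ 2 ((Sing X).δ 1 y) :=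
    singular_δ_δ (i := 1) (j := 2) (by decide) y
  have e23 : (Sing X).δ 2 ((Sing X).δ 3 y) = (Sing X).δ 2 ((Sing X).δ 2 y) :=
    singular_δ_δ (i := 2) (j := 2) (by decide) y
  fin_cases k
  · have h1 := h 1 (by decide); have h2 := h 2 (by decide); have h3 := h 3 (by decide)
    fin_cases i
    · exact e01.symm.trans (h1 0)
    · exact e02.symm.trans (h2 0)
    · exact e03.symm.trans (h3 0)
  · have h1 := h 0 (by decide); have h2 := h 2 (by decide); have h3 := h 3 (by decide)
    fin_cases i
    · exact e01.trans (h1 0)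
    · exact e12.symm.trans (h2 1)
    · exact e13.symm.trans (h3 1)
  · have h1 := h 0 (by decide); have h2 := h 1 (by decide); have h3 := h 3 (by decide)
    fin_cases i
    · exact e02.trans (h1 1)
    · exact e12.trans (h2 1)
    · exact e23.symm.trans (h3 2)
  · have h1 := h 0 (by decide); have h2 := h 1 (by decide); have h3 := h 2 (by decide)
    fin_cases i
    · exact e03.trans (h1 2)
    · exact e13.trans (h2 2)
    · exact e23.trans (h3 2)

/-- The tetrahedron with faces `x`, `y` and a constant simplex in positions 0, 2, 3 has the sum as
its face 1. For negatives the faces 0, 1, 3 are `x` and two constants, and face 2 is the result. -/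
theorem exists_isSpherical_add {a : X} {x y : (Sing X) _⦋2⦌} (hx : IsSpherical a x)
    (hy : IsSpherical a y) : ∃ z, IsSpherical a z ∧
      cell z - cell (constSimplex 2 a) =
        (cell x - cell (constSimplex 2 a)) + (cell y - cell (constSimplex 2 a)) := by
  have hc := isSpherical_constSimplex a
  obtain ⟨w, w0, w2, w3⟩ := exists_tetrahedron_one (x₀ := x) (x₂ := y) (x₃ := constSimplex 2 a)
    (by rw [hy, hx]) (by rw [hc, hx]) (by rw [hc, hy])
  refine ⟨(Sing X).δ 1 w, IsSpherical.of_tetrahedron 1 fun j hj => ?_, ?_⟩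
  · fin_cases j
    · exact w0.symm ▸ hx
    · exact absurd rfl hj
    · exact w2.symm ▸ hy
    · exact w3.symm ▸ hc
  · have := cell_boundary w
    rw [w0, w2, w3] at this
    rw [← sub_eq_zero, ← neg_eq_zero, ← this]
    abel

theorem exists_isSpherical_neg {a : X} {x : (Sing X) _⦋2⦌} (hx : IsSpherical a x) :
    ∃ z, IsSpherical a z ∧
      cell z - cell (constSimplex 2 a) = -(cell x - cell (constSimplex 2 a)) := by
  have hc := isSpherical_constSimplex a
  obtain ⟨w, w0, w1, w3⟩ := exists_tetrahedron_two (x₀ := x) (x₁ := constSimplex 2 a)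
    (x₃ := constSimplex 2 a) (by rw [hc, hx]) (by rw [hc, hx]) rfl
  refine ⟨(Sing X).δ 2 w, IsSpherical.of_tetrahedron 2 fun j hj => ?_, ?_⟩
  · fin_cases j
    · exact w0.symm ▸ hx
    · exact w1.symm ▸ hc
    · exact absurd rfl hj
    · exact w3.symm ▸ hc
  · have := cell_boundary w
    rw [w0, w1, w3] at this
    rw [← sub_eq_zero, ← this]
    abel

/-- The retraction of the square onto its lower triangle, in barycentric coordinates. -/
def squareToTriangle : C(Fin 2 → I, stdSimplex ℝ (Fin 3)) where
  toFun p := ⟨![1 - p 0, p 0 - min (p 0 : ℝ) (p 1), min (p 0 : ℝ) (p 1)], by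
    constructor
    · intro i
      fin_cases i
      · exact sub_nonneg.2 (p 0).2.2
      · exact sub_nonneg.2 (min_le_left _ _)
      · exact le_min (p 0).2.1 (p 1).2.1
    · simp [Fin.sum_univ_three]⟩
  continuous_toFun := by
    refine Continuous.subtype_mk (continuous_pi fun i => ?_) _
    fin_cases i <;> simp <;> fun_prop

theorem IsSpherical.simplexMap_eq {a : X} {x : (Sing X) _⦋2⦌} (hx : IsSpherical a x) {i : Fin 3}
    {y : stdSimplex ℝ (Fin 3)} (hy : y.1 i = 0) : simplexMap x y = a := by
  obtain ⟨z, rfl⟩ := exists_face_eq hy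
  rw [← simplexMap_δ, hx]
  rfl

/-- Compose with the retraction of the square onto its lower triangle: the lower triangle reproduces
`x`, and the upper one is mapped into edge 1 and becomes constant. -/
theorem exists_genLoop_of_isSpherical {a : X} {x : (Sing X) _⦋2⦌} (hx : IsSpherical a x) :
    ∃ f : Ω^ (Fin 2) X a, ((SingChain X).homologyι 2).hom (hurewicz f) =
      cell x - cell (constSimplex 2 a) := by
  refine ⟨⟨(simplexMap x).comp squareToTriangle, ?_⟩, ?_⟩
  · rintro y ⟨i, hi⟩
    have hy0 := (y 0).2
    have hy1 := (y 1).2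
    fin_cases i
    · rcases hi with hi | hi
      · exact hx.simplexMap_eq (i := 2) (by
          have : y 0 = 0 := hi
          simp [squareToTriangle, this, (y 1).2.1])
      · exact hx.simplexMap_eq (i := 0) (by
          have : y 0 = 1 := hi
          simp [squareToTriangle, this])
    · rcases hi with hi | hi
      · exact hx.simplexMap_eq (i := 2) (by
          have : y 1 = 0 := hi
          simp [squareToTriangle, this, (y 0).2.1])
      · exact hx.simplexMap_eq (i := 1) (by
          have : y 1 = 1 := hi
          simp [squareToTriangle, this, (y 0).2.2])
  · rw [homologyι_hurewicz]
    congr 2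
    · refine simplexMap_injective (ContinuousMap.ext fun y => ?_)
      change simplexMap x (squareToTriangle (lowerTriangle y)) = simplexMap x y
      congr 1
      have h := y.2.2
      rw [Fin.sum_univ_three] at h
      have h1 := y.2.1 1
      refine Subtype.ext (funext fun i => ?_)
      fin_cases i
      · simp [squareToTriangle, lowerTriangle]; linarith
      · simp [squareToTriangle, lowerTriangle, h1]
      · simp [squareToTriangle, lowerTriangle, h1]
    · refine simplexMap_injective (ContinuousMap.ext fun y => ?_)
      refine hx.simplexMap_eq (i := 1) ?_
      have h1 : y.1 2 ≤ y.1 1 + y.1 2 := le_add_of_nonneg_left (y.2.1 1)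
      change y.1 2 - min (y.1 2) (y.1 1 + y.1 2) = 0
      rw [min_eq_left h1, sub_self]

/-- For the class of the degenerate simplex, the boundary of the doubly degenerate tetrahedron is
one constant simplex followed by three copies of `σ 1 p` with signs `-`, `+`, `-`. -/
theorem degenerate_faces {a : X} {p : (Sing X) _⦋1⦌} (hp : (Sing X).δ 0 p = constSimplex 0 a) :
    (Sing X).δ 0 ((Sing X).σ 1 p) = constSimplex 1 a ∧ (Sing X).δ 1 ((Sing X).σ 1 p) = p ∧
      (Sing X).δ 2 ((Sing X).σ 1 p) = p ∧
      cell ((Sing X).σ 1 p) = cell (constSimplex 2 a) := by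
  have key (m : ℕ) (g : Fin (m + 1) → Fin 2) (hg : g = fun _ => 1) (y) :
      simplexMap p (stdSimplex.map g y) = a := by
    have : g = (0 : Fin 2).succAbove ∘ fun _ => (0 : Fin 1) := by rw [hg]; rfl
    have e : simplexMap ((Sing X).δ 0 p) (stdSimplex.map (fun _ => (0 : Fin 1)) y) = a := by
      rw [hp]; rfl
    rw [simplexMap_δ] at e
    rw [← e, this]
    exact congrArg _ (stdSimplex.map_comp_apply _ _ y).symm
  have key' (m : ℕ) (g : Fin 2 → Fin 2) (hg : g = id) (y) :
      simplexMap p (stdSimplex.map g y) = simplexMap p y := by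
    rw [hg, stdSimplex.map_id_apply]
  have a1 : (Sing X).δ 1 ((Sing X).σ 1 p) = p := by
    refine simplexMap_injective (ContinuousMap.ext fun y => ?_)
    rw [simplexMap_δ, simplexMap_σ, stdSimplex.map_comp_apply]
    exact key' 1 _ (by decide) y
  have a2 : (Sing X).δ 2 ((Sing X).σ 1 p) = p := by
    refine simplexMap_injective (ContinuousMap.ext fun y => ?_)
    rw [simplexMap_δ, simplexMap_σ, stdSimplex.map_comp_apply]
    exact key' 1 _ (by decide) y
  refine ⟨?_, a1, a2, ?_⟩
  · refine simplexMap_injective (ContinuousMap.ext fun y => ?_)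
    rw [simplexMap_δ, simplexMap_σ, stdSimplex.map_comp_apply]
    exact key _ _ (by decide) y
  · have := cell_boundary ((Sing X).σ 2 ((Sing X).σ 1 p))
    have h0 : (Sing X).δ 0 ((Sing X).σ 2 ((Sing X).σ 1 p)) = constSimplex 2 a := by
      refine simplexMap_injective (ContinuousMap.ext fun y => ?_)
      rw [simplexMap_δ, simplexMap_σ, simplexMap_σ, stdSimplex.map_comp_apply,
        stdSimplex.map_comp_apply]
      exact key _ _ (by decide) y
    have h1 (i : Fin 4) (hi : (1 : Fin 2).predAbove ∘ (2 : Fin 3).predAbove ∘ i.succAbove =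
        (1 : Fin 2).predAbove) :
        (Sing X).δ i ((Sing X).σ 2 ((Sing X).σ 1 p)) = (Sing X).σ 1 p := by
      refine simplexMap_injective (ContinuousMap.ext fun y => ?_)
      rw [simplexMap_δ, simplexMap_σ, simplexMap_σ, simplexMap_σ, stdSimplex.map_comp_apply,
        stdSimplex.map_comp_apply]
      exact congrArg (fun g => simplexMap p (stdSimplex.map g y)) hi
    rw [h0, h1 1 (by decide), h1 2 (by decide), h1 3 (by decide)] at this
    rw [eq_comm, ← sub_eq_zero, ← this]
    abel

/-- **Hurewicz**: in a simply connected space every second homology class is spherical. -/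
theorem hurewicz_surjective [SimplyConnectedSpace X] (a : X) (h : H2 X) :
    ∃ f : Ω^ (Fin 2) X a, hurewicz f = h := by
  -- The spherical classes form a subgroup. The constant simplex is subtracted because a simplex
  -- with constant edges is not by itself a cycle.
  let P : AddSubgroup (H2 X) :=
    { carrier := {h | ∃ z, IsSpherical a z ∧
        ((SingChain X).homologyι 2).hom h = cell z - cell (constSimplex 2 a)}
      zero_mem' := ⟨_, isSpherical_constSimplex a, by rw [sub_self]; exact map_zero _⟩
      add_mem' := by
        rintro b c ⟨x, hx, hb⟩ ⟨y, hy, hc⟩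
        obtain ⟨z, hz, e⟩ := exists_isSpherical_add hx hy
        exact ⟨z, hz, by rw [e, ← hb, ← hc]; exact map_add _ _ _⟩
      neg_mem' := by
        rintro b ⟨x, hx, hb⟩
        obtain ⟨z, hz, e⟩ := exists_isSpherical_neg hx
        exact ⟨z, hz, by rw [e, ← hb]; exact map_neg _ _⟩ }
  suffices hP : P = ⊤ by
    obtain ⟨z, hz, e⟩ : h ∈ P := hP ▸ AddSubgroup.mem_top h
    obtain ⟨f, hf⟩ := exists_genLoop_of_isSpherical hz
    exact ⟨f, homologyι_injective (hf.trans e.symm)⟩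
  have hp (v : (Sing X) _⦋0⦌) :
      ∃ p : (Sing X) _⦋1⦌, (Sing X).δ 0 p = constSimplex 0 a ∧ (Sing X).δ 1 p = v := by
    let γ : Path (simplexMap v (stdSimplex.map (fun _ => 0) (edgePoint 0))) a :=
      PathConnectedSpace.somePath _ _
    refine ⟨ofSimplexMap ⟨fun y => γ ⟨y.1 1, stdSimplex_one_mem y⟩, ?_⟩, ?_, ?_⟩
    · exact γ.continuous.comp (((continuous_apply 1).comp continuous_subtype_val).subtype_mk _)
    · refine simplexMap_injective (ContinuousMap.ext fun y => ?_)
      rw [simplexMap_δ, simplexMap_ofSimplexMap]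
      change γ _ = a
      convert γ.target
      exact congrFun (congrArg Subtype.val (face_zero_edge y)) 1
    · refine simplexMap_injective (ContinuousMap.ext fun y => ?_)
      rw [simplexMap_δ, simplexMap_ofSimplexMap, stdSimplex_zero_subsingleton y]
      refine Eq.trans ?_ γ.source
      refine congrArg γ (Subtype.ext ?_)
      exact congrFun (congrArg Subtype.val (face_one_edge _)) 1
  choose p hp0 hp1 using hp
  -- Cone over the edge `e` with apex `a`, whose other sides are the chosen paths from the vertices
  -- to `a`. These cones are the correction terms of `eq_top_of_cell_sub_mem`.
  have hq (e : (Sing X) _⦋1⦌) : ∃ t : (Sing X) _⦋2⦌, (Sing X).δ 0 t = p ((Sing X).δ 0 e) ∧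
      (Sing X).δ 1 t = p ((Sing X).δ 1 e) ∧ (Sing X).δ 2 t = e :=
    exists_triangle _ _ _ (by rw [hp0, hp0]) (by rw [hp1]) (by rw [hp1])
  choose q hq0 hq1 hq2 using hq
  refine eq_top_of_cell_sub_mem q P fun x => ?_
  suffices ∃ z, IsSpherical a z ∧ cell z - cell (constSimplex 2 a) =
      cell x - (cell (q ((Sing X).δ 0 x)) - cell (q ((Sing X).δ 1 x)) +
        cell (q ((Sing X).δ 2 x))) by
    obtain ⟨z, hz, e⟩ := this
    obtain ⟨f, hf⟩ := exists_genLoop_of_isSpherical hz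
    exact ⟨hurewicz f, ⟨z, hz, hf⟩, hf.trans e⟩
  have e01 : (Sing X).δ 0 ((Sing X).δ 1 x) = (Sing X).δ 0 ((Sing X).δ 0 x) :=
    singular_δ_δ (i := 0) (j := 0) (by decide) x
  have e02 : (Sing X).δ 0 ((Sing X).δ 2 x) = (Sing X).δ 1 ((Sing X).δ 0 x) :=
    singular_δ_δ (i := 0) (j := 1) (by decide) x
  have e12 : (Sing X).δ 1 ((Sing X).δ 2 x) = (Sing X).δ 1 ((Sing X).δ 1 x) :=
    singular_δ_δ (i := 1) (j := 1) (by decide) x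
  have f01 (y : (Sing X) _⦋3⦌) : (Sing X).δ 0 ((Sing X).δ 1 y) = (Sing X).δ 0 ((Sing X).δ 0 y) :=
    singular_δ_δ (i := 0) (j := 0) (by decide) y
  have f02 (y : (Sing X) _⦋3⦌) : (Sing X).δ 0 ((Sing X).δ 2 y) = (Sing X).δ 1 ((Sing X).δ 0 y) :=
    singular_δ_δ (i := 0) (j := 1) (by decide) y
  have f03 (y : (Sing X) _⦋3⦌) : (Sing X).δ 0 ((Sing X).δ 3 y) = (Sing X).δ 2 ((Sing X).δ 0 y) :=
    singular_δ_δ (i := 0) (j := 2) (by decide) y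
  have f12 (y : (Sing X) _⦋3⦌) : (Sing X).δ 1 ((Sing X).δ 2 y) = (Sing X).δ 1 ((Sing X).δ 1 y) :=
    singular_δ_δ (i := 1) (j := 1) (by decide) y
  have f13 (y : (Sing X) _⦋3⦌) : (Sing X).δ 1 ((Sing X).δ 3 y) = (Sing X).δ 2 ((Sing X).δ 1 y) :=
    singular_δ_δ (i := 1) (j := 2) (by decide) y
  have f23 (y : (Sing X) _⦋3⦌) : (Sing X).δ 2 ((Sing X).δ 3 y) = (Sing X).δ 2 ((Sing X).δ 2 y) :=
    singular_δ_δ (i := 2) (j := 2) (by decide) y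
  -- With the cones over the edges 0 and 1 attached to `x`, the missing face of `t` represents `x`
  -- minus those cones with their signs, and it has the same edges as the cone over edge 2.
  obtain ⟨t, t0, t1, t3⟩ := exists_tetrahedron_two (x₀ := q ((Sing X).δ 0 x))
    (x₁ := q ((Sing X).δ 1 x)) (x₃ := x) (by rw [hq0, hq0, e01]) (by rw [hq2]) (by rw [hq2])
  obtain ⟨y0, y1, y2, yc⟩ := degenerate_faces (hp0 ((Sing X).δ 1 ((Sing X).δ 0 x)))
  obtain ⟨-, x1, x2, -⟩ := degenerate_faces (hp0 ((Sing X).δ 1 ((Sing X).δ 1 x)))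
  have s0 : (Sing X).δ 0 ((Sing X).δ 2 t) = p ((Sing X).δ 1 ((Sing X).δ 0 x)) := by
    rw [f02, t0, hq1]
  have s1 : (Sing X).δ 1 ((Sing X).δ 2 t) = p ((Sing X).δ 1 ((Sing X).δ 1 x)) := by
    rw [f12, t1, hq1]
  have s2 : (Sing X).δ 2 ((Sing X).δ 2 t) = (Sing X).δ 2 x := by rw [← f23, t3]
  -- Gluing two triangles with equal edges leaves a triangle whose edges are a constant, `p` and
  -- `p`. It represents their difference plus a constant simplex.
  obtain ⟨u, u0, u2, u3⟩ := exists_tetrahedron_one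
    (x₀ := (Sing X).σ 1 (p ((Sing X).δ 1 ((Sing X).δ 0 x)))) (x₂ := (Sing X).δ 2 t)
    (x₃ := q ((Sing X).δ 2 x)) (by rw [s0, y1]) (by rw [y2, hq0, e02]) (by rw [s2, hq2])
  have r0 : (Sing X).δ 0 ((Sing X).δ 1 u) = constSimplex 1 a := by rw [f01, u0, y0]
  have r1 : (Sing X).δ 1 ((Sing X).δ 1 u) = p ((Sing X).δ 1 ((Sing X).δ 1 x)) := by
    rw [← f12, u2, s1]
  have r2 : (Sing X).δ 2 ((Sing X).δ 1 u) = p ((Sing X).δ 1 ((Sing X).δ 1 x)) := by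
    rw [← f13, u3, hq1, e12]
  -- Contracting along `p` makes all edges constant. The two copies of `σ 1 p` enter with opposite
  -- signs, so the class is unchanged.
  obtain ⟨w, w1, w2, w3⟩ := exists_tetrahedron_zero (x₁ := (Sing X).δ 1 u)
    (x₂ := (Sing X).σ 1 (p ((Sing X).δ 1 ((Sing X).δ 1 x))))
    (x₃ := (Sing X).σ 1 (p ((Sing X).δ 1 ((Sing X).δ 1 x)))) (by rw [x1, r1]) (by rw [x1, r2]) rfl
  refine ⟨(Sing X).δ 0 w, fun i => ?_, ?_⟩
  · obtain ⟨z0, -, -, -⟩ := degenerate_faces (hp0 ((Sing X).δ 1 ((Sing X).δ 1 x)))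
    fin_cases i
    · exact (f01 w).symm.trans (by rw [w1, r0])
    · exact (f02 w).symm.trans (by rw [w2, z0])
    · exact (f03 w).symm.trans (by rw [w3, z0])
  · have ht := cell_boundary t
    have hu := cell_boundary u
    have hw := cell_boundary w
    rw [t0, t1, t3] at ht
    rw [u0, u2, u3, yc] at hu
    rw [w1, w2, w3, add_sub_cancel_right] at hw
    have hu' : cell ((Sing X).δ 1 u) = cell (constSimplex 2 a) + cell ((Sing X).δ 2 t) -
        cell (q ((Sing X).δ 2 x)) := by
      rw [eq_comm, ← sub_eq_zero, ← hu]
      abel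
    rw [sub_eq_zero.1 hw, hu', ← sub_eq_zero.1 ht]
    abel

end HurewiczSurjective

/-! ### Invariance of the Hurewicz class under free homotopies -/

section HurewiczInvariance

open Simplicial

variable {X : Type} [TopologicalSpace X]

theorem affineSimplex_mem {n : ℕ} (p : Fin (n + 1) → Fin 3 → I) (y : stdSimplex ℝ (Fin (n + 1)))
    (j : Fin 3) : ∑ i, y.1 i * (p i j : ℝ) ∈ I := by
  refine ⟨Finset.sum_nonneg fun i _ => mul_nonneg (y.2.1 i) (p i j).2.1, ?_⟩
  rw [← y.2.2]
  exact Finset.sum_le_sum fun i _ => mul_le_of_le_one_right (y.2.1 i) (p i j).2.2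

/-- The affine simplex in the cube with given vertices. -/
def affineSimplex {n : ℕ} (p : Fin (n + 1) → Fin 3 → I) :
    C(stdSimplex ℝ (Fin (n + 1)), Fin 3 → I) where
  toFun y j := ⟨_, affineSimplex_mem p y j⟩
  continuous_toFun := by
    refine continuous_pi fun j => Continuous.subtype_mk ?_ _
    exact continuous_finsetSum _ fun i _ =>
      ((continuous_apply i).comp continuous_subtype_val).mul continuous_const

theorem affineSimplex_coe {n : ℕ} (p : Fin (n + 1) → Fin 3 → I) (y : stdSimplex ℝ (Fin (n + 1)))
    (j : Fin 3) : (affineSimplex p y j : ℝ) = ∑ i, y.1 i * (p i j : ℝ) := rfl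

theorem affineSimplex_face {n : ℕ} (p : Fin (n + 2) → Fin 3 → I) (i : Fin (n + 2))
    (y : stdSimplex ℝ (Fin (n + 1))) :
    affineSimplex p (stdSimplex.map i.succAbove y) = affineSimplex (p ∘ i.succAbove) y := by
  refine funext fun j => Subtype.ext ?_
  change ∑ l, (stdSimplex.map i.succAbove y).1 l * (p l j : ℝ) = ∑ l, y.1 l * (p (i.succAbove l) j : ℝ)
  rw [Fin.sum_univ_succAbove _ i, stdSimplex_map_of_notMem fun l => Fin.succAbove_ne _ l]
  simp only [zero_mul, zero_add]
  refine Finset.sum_congr rfl fun l _ => ?_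
  rw [stdSimplex_map_of_injective Fin.succAbove_right_injective]

/-- The class of an affine triangle in the cube under a map of the cube. -/
def triangleCell (H : C(Fin 3 → I, X)) (a b c : Fin 3 → I) : (SingChain X).opcycles 2 :=
  cell (ofSimplexMap (H.comp (affineSimplex ![a, b, c])))

theorem triangleCell_boundary (H : C(Fin 3 → I, X)) (a b c d : Fin 3 → I) :
    triangleCell H b c d - triangleCell H a c d + triangleCell H a b d - triangleCell H a b c
      = 0 := by
  have key (i : Fin 4) (q : Fin 3 → Fin 3 → I) (hq : ![a, b, c, d] ∘ i.succAbove = q) :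
      (Sing X).δ i (ofSimplexMap (H.comp (affineSimplex ![a, b, c, d]))) =
        ofSimplexMap (H.comp (affineSimplex q)) := by
    refine simplexMap_injective (ContinuousMap.ext fun y => ?_)
    rw [simplexMap_δ, simplexMap_ofSimplexMap, simplexMap_ofSimplexMap, ContinuousMap.comp_apply,
      affineSimplex_face, hq]
    rfl
  have := cell_boundary (ofSimplexMap (H.comp (affineSimplex ![a, b, c, d])))
  rwa [key 0 ![b, c, d] (by ext i; fin_cases i <;> rfl),
    key 1 ![a, c, d] (by ext i; fin_cases i <;> rfl),
    key 2 ![a, b, d] (by ext i; fin_cases i <;> rfl),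
    key 3 ![a, b, c] (by ext i; fin_cases i <;> rfl)] at this

/-- The prism is cut into the tetrahedra `a b c c'`, `a b b' c'` and `a a' b' c'`; what remains of
their boundaries are the two ends and the three divided side walls. -/
theorem triangleCell_prism (H : C(Fin 3 → I, X)) (a b c a' b' c' : Fin 3 → I) :
    triangleCell H a b c - triangleCell H a' b' c' =
      (triangleCell H b c c' - triangleCell H b b' c') -
      (triangleCell H a c c' - triangleCell H a a' c') +
      (triangleCell H a b b' - triangleCell H a a' b') := by
  have h1 := triangleCell_boundary H a b c c'
  have h2 := triangleCell_boundary H a b b' c'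
  have h3 := triangleCell_boundary H a a' b' c'
  have e1 : triangleCell H a b c = triangleCell H b c c' - triangleCell H a c c' +
      triangleCell H a b c' := (sub_eq_zero.1 h1).symm
  have e2 : triangleCell H a b c' = triangleCell H a b b' - triangleCell H b b' c' +
      triangleCell H a b' c' := by
    rw [← sub_eq_zero, ← h2]
    abel
  have e3 : triangleCell H a b' c' = triangleCell H a' b' c' + triangleCell H a a' c' -
      triangleCell H a a' b' := by
    rw [eq_comm, ← sub_eq_zero, ← h3]
    abel
  rw [e1, e2, e3]
  abel

/-- If the boundary of the square moves along a path, the Hurewicz class does not change. -/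
theorem hurewicz_eq_of_homotopy {x₀ x₁ : X} (f₀ : Ω^ (Fin 2) X x₀) (f₁ : Ω^ (Fin 2) X x₁)
    (H : C(I × (Fin 2 → I), X)) (a : I → X)
    (hH : ∀ r, ∀ y ∈ Cube.boundary (Fin 2), H (r, y) = a r)
    (h₀ : ∀ y, H (0, y) = f₀ y) (h₁ : ∀ y, H (1, y) = f₁ y) : hurewicz f₀ = hurewicz f₁ := by
  obtain ⟨K, hK⟩ : ∃ K : C(Fin 3 → I, X), ∀ p, K p = H (p 0, ![p 1, p 2]) :=
    ⟨H.comp ⟨fun p => (p 0, ![p 1, p 2]), by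
      refine Continuous.prodMk (continuous_apply 0) (continuous_pi fun i => ?_)
      fin_cases i
      · exact continuous_apply 1
      · exact continuous_apply 2⟩, fun p => rfl⟩
  -- On the side walls of the cube the map depends on the time coordinate only, so two simplices in
  -- walls with the same time coordinates have the same image.
  have wall (p q : Fin 3 → Fin 3 → I) (hp : ∃ j : Fin 3, j ≠ 0 ∧ ((∀ i, p i j = 0) ∨ ∀ i, p i j = 1))
      (hq : ∃ j : Fin 3, j ≠ 0 ∧ ((∀ i, q i j = 0) ∨ ∀ i, q i j = 1)) (hpq : ∀ i, p i 0 = q i 0) :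
      K.comp (affineSimplex p) = K.comp (affineSimplex q) := by
    have key (p : Fin 3 → Fin 3 → I)
        (hp : ∃ j : Fin 3, j ≠ 0 ∧ ((∀ i, p i j = 0) ∨ ∀ i, p i j = 1)) (y) :
        K (affineSimplex p y) = a (affineSimplex p y 0) := by
      rw [hK]
      refine hH _ _ ?_
      obtain ⟨j, hj, h⟩ := hp
      have h' : affineSimplex p y j = 0 ∨ affineSimplex p y j = 1 := by
        rcases h with h | h
        · left
          refine Subtype.ext ?_
          change ∑ i, y.1 i * (p i j : ℝ) = 0
          simp [h]
        · right
          refine Subtype.ext ?_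
          change ∑ i, y.1 i * (p i j : ℝ) = 1
          simpa [h] using y.2.2
      fin_cases j
      · exact absurd rfl hj
      · exact ⟨0, h'⟩
      · exact ⟨1, h'⟩
    refine ContinuousMap.ext fun y => ?_
    rw [ContinuousMap.comp_apply, ContinuousMap.comp_apply, key p hp, key q hq]
    congr 1
    refine Subtype.ext ?_
    change ∑ i, y.1 i * (p i 0 : ℝ) = ∑ i, y.1 i * (q i 0 : ℝ)
    simp [hpq]
  have base (r : I) {x : X} (f : Ω^ (Fin 2) X x) (hf : ∀ y, H (r, y) = f y) :
      ((SingChain X).homologyι 2).hom (hurewicz f) =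
        triangleCell K ![r, 0, 0] ![r, 1, 0] ![r, 1, 1] -
          triangleCell K ![r, 0, 0] ![r, 0, 1] ![r, 1, 1] := by
    rw [homologyι_hurewicz]
    congr 2
    · refine simplexMap_injective (ContinuousMap.ext fun y => ?_)
      refine Eq.trans ?_ (DFunLike.congr_fun (simplexMap_ofSimplexMap _) y).symm
      have hy := y.2.2
      rw [Fin.sum_univ_three] at hy
      refine ((hf (lowerTriangle y)).symm.trans ?_).trans (hK _).symm
      refine congrArg H (Prod.ext (Subtype.ext ?_) (funext fun i => Subtype.ext ?_))
      · rw [affineSimplex_coe, Fin.sum_univ_three]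
        simp [← add_mul, hy]
      · fin_cases i
        · refine Eq.trans ?_ (affineSimplex_coe _ y 1).symm
          rw [Fin.sum_univ_three]
          simp [lowerTriangle]
        · refine Eq.trans ?_ (affineSimplex_coe _ y 2).symm
          rw [Fin.sum_univ_three]
          simp [lowerTriangle]
    · refine simplexMap_injective (ContinuousMap.ext fun y => ?_)
      refine Eq.trans ?_ (DFunLike.congr_fun (simplexMap_ofSimplexMap _) y).symm
      have hy := y.2.2
      rw [Fin.sum_univ_three] at hy
      refine ((hf (upperTriangle y)).symm.trans ?_).trans (hK _).symm
      refine congrArg H (Prod.ext (Subtype.ext ?_) (funext fun i => Subtype.ext ?_))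
      · rw [affineSimplex_coe, Fin.sum_univ_three]
        simp [← add_mul, hy]
      · fin_cases i
        · refine Eq.trans ?_ (affineSimplex_coe _ y 1).symm
          rw [Fin.sum_univ_three]
          simp [upperTriangle]
        · refine Eq.trans ?_ (affineSimplex_coe _ y 2).symm
          rw [Fin.sum_univ_three]
          simp [upperTriangle]
  have wallCell (b c b₁ c₁ : Fin 2 → I)
      (h : ∃ j : Fin 2, (b j = 0 ∧ c j = 0) ∨ (b j = 1 ∧ c j = 1))
      (h' : ∃ j : Fin 2, (b₁ j = 0 ∧ c₁ j = 0) ∨ (b₁ j = 1 ∧ c₁ j = 1)) :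
      triangleCell K ![0, b 0, b 1] ![0, c 0, c 1] ![1, c 0, c 1] -
        triangleCell K ![0, b 0, b 1] ![1, b 0, b 1] ![1, c 0, c 1] =
      triangleCell K ![0, b₁ 0, b₁ 1] ![0, c₁ 0, c₁ 1] ![1, c₁ 0, c₁ 1] -
        triangleCell K ![0, b₁ 0, b₁ 1] ![1, b₁ 0, b₁ 1] ![1, c₁ 0, c₁ 1] := by
    have aux (b c : Fin 2 → I) (h : ∃ j : Fin 2, (b j = 0 ∧ c j = 0) ∨ (b j = 1 ∧ c j = 1))
        (r s t : I) (u v w : Fin 2 → I) (hu : u = b ∨ u = c) (hv : v = b ∨ v = c)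
        (hw : w = b ∨ w = c) : ∃ j : Fin 3, j ≠ 0 ∧
          ((∀ i, ![![r, u 0, u 1], ![s, v 0, v 1], ![t, w 0, w 1]] i j = 0) ∨
            ∀ i, ![![r, u 0, u 1], ![s, v 0, v 1], ![t, w 0, w 1]] i j = 1) := by
      obtain ⟨j, h⟩ := h
      refine ⟨j.succ, Fin.succ_ne_zero j, h.imp ?_ ?_⟩
      all_goals
        rintro ⟨h1, h2⟩ i
        have hu' := hu.elim (fun e => (congrFun e j).trans h1) fun e => (congrFun e j).trans h2
        have hv' := hv.elim (fun e => (congrFun e j).trans h1) fun e => (congrFun e j).trans h2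
        have hw' := hw.elim (fun e => (congrFun e j).trans h1) fun e => (congrFun e j).trans h2
        fin_cases j <;> fin_cases i <;> assumption
    unfold triangleCell
    rw [wall _ _ (aux b c h 0 0 1 b c c (.inl rfl) (.inr rfl) (.inr rfl))
        (aux b₁ c₁ h' 0 0 1 b₁ c₁ c₁ (.inl rfl) (.inr rfl) (.inr rfl))
        (fun i => by fin_cases i <;> rfl),
      wall _ _ (aux b c h 0 1 1 b b c (.inl rfl) (.inl rfl) (.inr rfl))
        (aux b₁ c₁ h' 0 1 1 b₁ b₁ c₁ (.inl rfl) (.inl rfl) (.inr rfl))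
        (fun i => by fin_cases i <;> rfl)]
  apply homologyι_injective
  rw [base 0 f₀ h₀, base 1 f₁ h₁]
  -- The prisms over the lower and the upper triangle share the diagonal wall. Of the others, right
  -- agrees with left and bottom with top, so everything cancels.
  have p1 := triangleCell_prism K ![0, 0, 0] ![0, 1, 0] ![0, 1, 1] ![1, 0, 0] ![1, 1, 0] ![1, 1, 1]
  have p2 := triangleCell_prism K ![0, 0, 0] ![0, 0, 1] ![0, 1, 1] ![1, 0, 0] ![1, 0, 1] ![1, 1, 1]
  have w1 := wallCell ![1, 0] ![1, 1] ![0, 0] ![0, 1] ⟨0, .inr ⟨rfl, rfl⟩⟩ ⟨0, .inl ⟨rfl, rfl⟩⟩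
  have w2 := wallCell ![0, 0] ![1, 0] ![0, 1] ![1, 1] ⟨1, .inl ⟨rfl, rfl⟩⟩ ⟨1, .inr ⟨rfl, rfl⟩⟩
  simp only [Matrix.cons_val_zero, Matrix.cons_val_one] at w1 w2
  rw [w1, w2] at p1
  rw [← sub_eq_zero, sub_sub_sub_comm, p1, p2]
  abel

end HurewiczInvariance

/-! ### Lifting maps through local transport -/

section Lifting

/-- Locally on the base, points of the total space can be transported continuously from one fibre
to another. -/
def HasLocalTransport {E B : Type*} [TopologicalSpace E] [TopologicalSpace B] (p : E → B) : Prop :=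
  ∀ b, ∃ V : Set B, IsOpen V ∧ b ∈ V ∧ ∃ τ : E × B → E,
    ContinuousOn τ {q | p q.1 ∈ V ∧ q.2 ∈ V} ∧
      ∀ u x, p u ∈ V → x ∈ V → p (τ (u, x)) = x ∧ (x = p u → τ (u, x) = u)

variable {E B Y : Type*} [TopologicalSpace E] [TopologicalSpace B] {p : E → B}

/-- The lift is corrected by transport on `W` and left alone off `C`. On `W \ C` both prescriptions
agree, since transport to the point one already lies over is the identity. -/
theorem exists_lift_of_eqOn_compl [TopologicalSpace Y] {V : Set B} {τ : E × B → E}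
    (hτ : ContinuousOn τ {q | p q.1 ∈ V ∧ q.2 ∈ V})
    (hτ' : ∀ u x, p u ∈ V → x ∈ V → p (τ (u, x)) = x ∧ (x = p u → τ (u, x) = u))
    (G : C(Y, E)) (k : C(Y, B)) {W C : Set Y} (hW : IsOpen W) (hC : IsClosed C) (hCW : C ⊆ W)
    (h : ∀ y, y ∉ C → p (G y) = k y) (hV : ∀ y ∈ W, p (G y) ∈ V ∧ k y ∈ V) :
    ∃ G' : C(Y, E), ∀ y, p (G' y) = k y := by
  classical
  let F : Y → E := fun y => if y ∈ W then τ (G y, k y) else G y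
  have hF : ∀ y, y ∉ C → F y = G y := by
    intro y hy
    by_cases hyW : y ∈ W
    · simp only [F, if_pos hyW]
      exact (hτ' _ _ (hV y hyW).1 (hV y hyW).2).2 (h y hy).symm
    · simp only [F, if_neg hyW]
  refine ⟨⟨F, continuous_iff_continuousAt.2 fun y => ?_⟩, fun y => ?_⟩
  · by_cases hy : y ∈ C
    · have hc : ContinuousAt (fun y => τ (G y, k y)) y := by
        have h1 : ContinuousOn (fun y => τ (G y, k y)) W :=
          hτ.comp (G.continuous.prodMk k.continuous).continuousOn fun y hy => hV y hy
        exact h1.continuousAt (hW.mem_nhds (hCW hy))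
      refine hc.congr ?_
      filter_upwards [hW.mem_nhds (hCW hy)] with z hz
      simp only [F, if_pos hz]
    · refine G.continuous.continuousAt.congr ?_
      filter_upwards [hC.isOpen_compl.mem_nhds hy] with z hz
      exact (hF z hz).symm
  · by_cases hy : y ∈ W
    · simp only [ContinuousMap.coe_mk, F, if_pos hy]
      exact (hτ' _ _ (hV y hy).1 (hV y hy).2).1
    · have : y ∉ C := fun h => hy (hCW h)
      simp only [ContinuousMap.coe_mk, hF y this, h y this]

/-- The homotopy is carried out on one ball of a finite cover after another. The function `h`
records how far each point has moved, and each step changes the lift only over a ball where `f`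
stays in a single transport neighbourhood. -/
theorem exists_lift_of_small_homotopy [PseudoMetricSpace Y] [CompactSpace Y]
    (htr : HasLocalTransport p) (f : C(Y × I, B)) {δ : ℝ} (hδ : 0 < δ)
    (hsmall : ∀ y, ∃ b, ∀ y' ∈ Metric.ball y δ, ∀ t, f (y', t) ∈ (htr b).choose)
    (G : C(Y, E)) (hG : ∀ y, p (G y) = f (y, 0)) : ∃ G' : C(Y, E), ∀ y, p (G' y) = f (y, 1) := by
  classical
  have key : ∀ s : Finset Y, ∃ (h : C(Y, I)) (G' : C(Y, E)),
      (∀ c ∈ s, ∀ y ∈ Metric.ball c (δ / 2), h y = 1) ∧ ∀ y, p (G' y) = f (y, h y) := by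
    intro s
    induction s using Finset.induction_on with
    | empty => exact ⟨ContinuousMap.const _ 0, G, by simp, hG⟩
    | insert c s _ ih =>
      obtain ⟨h, G', hs, hG'⟩ := ih
      obtain ⟨b, hb⟩ := hsmall c
      obtain ⟨-, -, τ, hτ, hτ'⟩ := (htr b).choose_spec
      -- A bump function: `1` on the ball of radius `δ / 2`, `0` outside radius `3δ / 4`.
      let φ : C(Y, I) := ⟨fun y => Set.projIcc 0 1 zero_le_one (3 - 4 * dist y c / δ), by fun_prop⟩
      have hφ1 (y) (hy : y ∈ Metric.ball c (δ / 2)) : φ y = 1 := by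
        refine Set.projIcc_of_right_le zero_le_one ?_
        have : 4 * dist y c / δ ≤ 2 := by
          rw [div_le_iff₀ hδ]
          linarith [Metric.mem_ball.1 hy]
        linarith
      have hφ0 (y) (hy : y ∉ Metric.closedBall c (3 / 4 * δ)) : φ y = 0 := by
        refine Set.projIcc_of_le_left zero_le_one ?_
        have : 3 ≤ 4 * dist y c / δ := by
          rw [le_div_iff₀ hδ]
          rw [Metric.mem_closedBall, not_le] at hy
          linarith
        linarith
      let h' : C(Y, I) := ⟨fun y => max (h y) (φ y), h.continuous.max φ.continuous⟩
      obtain ⟨G'', hG''⟩ := exists_lift_of_eqOn_compl hτ hτ' G'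
        (f.comp ((ContinuousMap.id Y).prodMk h')) (W := Metric.ball c δ)
        (C := Metric.closedBall c (3 / 4 * δ)) Metric.isOpen_ball Metric.isClosed_closedBall
        (Metric.closedBall_subset_ball (by linarith))
        (fun y hy => by
          have : h' y = h y := by
            change max (h y) (φ y) = h y
            rw [hφ0 y hy]
            exact max_eq_left (h y).2.1
          rw [hG']
          exact congrArg (fun t => f (y, t)) this.symm)
        (fun y hy => ⟨by rw [hG']; exact hb y hy _, hb y hy _⟩)
      refine ⟨h', G'', fun d hd y hy => ?_, hG''⟩
      change max (h y) (φ y) = 1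
      rcases Finset.mem_insert.1 hd with rfl | hd
      · rw [hφ1 y hy]
        exact max_eq_right (h y).2.2
      · rw [hs d hd y hy]
        exact max_eq_left (φ y).2.2
  obtain ⟨s, hs⟩ := isCompact_univ.elim_finite_subcover (fun c : Y => Metric.ball c (δ / 2))
    (fun _ => Metric.isOpen_ball)
    (fun y _ => Set.mem_iUnion.2 ⟨y, Metric.mem_ball_self (half_pos hδ)⟩)
  obtain ⟨h, G', h1, hG'⟩ := key s
  refine ⟨G', fun y => ?_⟩
  obtain ⟨c, hc, hy⟩ := Set.mem_iUnion₂.1 (hs (Set.mem_univ y))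
  rw [hG', h1 c hc y hy]

/-- A Lebesgue number cuts the homotopy into time steps that are small enough for
`exists_lift_of_small_homotopy`. -/
theorem exists_lift_of_homotopy [PseudoMetricSpace Y] [CompactSpace Y]
    (htr : HasLocalTransport p) (f : C(Y × I, B)) (G : C(Y, E)) (hG : ∀ y, p (G y) = f (y, 0)) :
    ∃ G' : C(Y, E), ∀ y, p (G' y) = f (y, 1) := by
  obtain ⟨δ, hδ, hleb⟩ := lebesgue_number_lemma_of_metric (s := (Set.univ : Set (Y × I)))
    (c := fun b => f ⁻¹' (htr b).choose) isCompact_univ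
    (fun b => (htr b).choose_spec.1.preimage f.continuous)
    (fun q _ => Set.mem_iUnion.2 ⟨f q, (htr (f q)).choose_spec.2.1⟩)
  obtain ⟨k, hk⟩ := exists_nat_gt (1 / δ)
  have hk0 : (0 : ℝ) < k := lt_trans (by positivity) hk
  have hkδ : 1 / (k : ℝ) < δ := by
    rw [div_lt_iff₀ hk0]
    rw [div_lt_iff₀ hδ] at hk
    linarith
  have key : ∀ i : ℕ, ∃ G' : C(Y, E), ∀ y, p (G' y) =
      f (y, Set.projIcc 0 1 zero_le_one ((i : ℝ) / k)) := by
    intro i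
    induction i with
    | zero =>
      refine ⟨G, fun y => ?_⟩
      rw [hG]
      simp
    | succ i ih =>
      obtain ⟨G', hG'⟩ := ih
      let f' : C(Y × I, B) := f.comp ⟨fun q =>
        (q.1, Set.projIcc 0 1 zero_le_one (((i : ℝ) + q.2) / k)), by fun_prop⟩
      have := exists_lift_of_small_homotopy htr f' hδ (fun y => ?_) G' (fun y => ?_)
      · obtain ⟨G'', h⟩ := this
        refine ⟨G'', fun y => ?_⟩
        rw [h]
        simp [f']
      · obtain ⟨b, hb⟩ := hleb (y, Set.projIcc 0 1 zero_le_one ((i : ℝ) / k)) (Set.mem_univ _)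
        refine ⟨b, fun y' hy' t => ?_⟩
        refine hb (Metric.mem_ball.2 ?_)
        rw [Prod.dist_eq]
        refine max_lt hy' (lt_of_le_of_lt ?_ hkδ)
        rw [Subtype.dist_eq]
        refine (Set.abs_projIcc_sub_projIcc zero_le_one).trans ?_
        rw [← sub_div, add_sub_cancel_left, abs_of_nonneg (div_nonneg t.2.1 hk0.le)]
        exact div_le_div_of_nonneg_right t.2.2 hk0.le
      · rw [hG']
        simp [f']
  obtain ⟨G', hG'⟩ := key k
  refine ⟨G', fun y => ?_⟩
  rw [hG', div_self hk0.ne', Set.projIcc_right]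
  rfl

/-- Maps from a compact contractible metric space lift along a surjection with local transport. -/
theorem HasLocalTransport.exists_lift [PseudoMetricSpace Y] [CompactSpace Y] [ContractibleSpace Y]
    (htr : HasLocalTransport p) (hsurj : Function.Surjective p) (f : C(Y, B)) :
    ∃ F : C(Y, E), ∀ y, p (F y) = f y := by
  obtain ⟨y₀, ⟨H⟩⟩ := (contractible_iff_id_nullhomotopic Y).1 inferInstance
  obtain ⟨u, hu⟩ := hsurj (f y₀)
  let H' := H.symm
  obtain ⟨F, hF⟩ := exists_lift_of_homotopy htr
    (f.comp (H'.toContinuousMap.comp ⟨Prod.swap, continuous_swap⟩)) (ContinuousMap.const Y u)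
    (fun y => by
      have : H' (0, y) = y₀ := by simp [H']
      exact hu.trans (congrArg f this.symm))
  refine ⟨F, fun y => (hF y).trans ?_⟩
  have : H' (1, y) = y := by simp [H']
  exact congrArg f this

/-- Near `b` the quotient of two values lies in the slit plane, so its principal logarithm is the
correction to be added. The radius `1 / 3` gives `|s - t| < 2 / 3 < |t|` for the normalised values,
whence `|s / t - 1| < 1`. -/
theorem hasLocalTransport_exp :
    HasLocalTransport fun z : ℂ => (⟨Complex.exp z, z.exp_ne_zero⟩ : {z : ℂ // z ≠ 0}) := by
  rintro ⟨b, hb⟩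
  refine ⟨{z | ‖z.1 / b - 1‖ < 1 / 3}, ?_, by simp [hb],
    fun q => q.1 + Complex.log (q.2.1 / Complex.exp q.1), ?_, ?_⟩
  · exact isOpen_lt (by fun_prop) continuous_const
  · refine continuous_fst.continuousOn.add (ContinuousOn.clog ?_ ?_)
    · exact ContinuousOn.div (by fun_prop) (by fun_prop) fun q _ => Complex.exp_ne_zero _
    · rintro ⟨u, x⟩ ⟨h1, h2⟩
      left
      simp only [Set.mem_ofPred_eq] at h1 h2
      have e : x.1 / Complex.exp u = (x.1 / b) / (Complex.exp u / b) := by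
        field_simp
      rw [e]
      generalize x.1 / b = s at *
      generalize Complex.exp u / b = t at *
      have hs : ‖s - t‖ < 2 / 3 := by
        calc ‖s - t‖ = ‖(s - 1) - (t - 1)‖ := by ring_nf
          _ ≤ ‖s - 1‖ + ‖t - 1‖ := norm_sub_le _ _
          _ < 2 / 3 := by linarith
      have ht : 2 / 3 < ‖t‖ := by
        have : (1 : ℝ) ≤ ‖t‖ + ‖t - 1‖ := by
          calc (1 : ℝ) = ‖t - (t - 1)‖ := by simp
            _ ≤ _ := norm_sub_le _ _
        linarith
      have ht0 : t ≠ 0 := by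
        rintro rfl
        norm_num at ht
      have h3 : ‖s / t - 1‖ < 1 := by
        rw [div_sub_one ht0, norm_div, div_lt_one (norm_pos_iff.2 ht0)]
        linarith
      have h4 : |(s / t - 1).re| < 1 := (Complex.abs_re_le_norm _).trans_lt h3
      rw [Complex.sub_re, Complex.one_re, abs_lt] at h4
      linarith [h4.1]
  · rintro u ⟨x, hx⟩ - -
    constructor
    · refine Subtype.ext ?_
      simp only
      rw [Complex.exp_add, Complex.exp_log (div_ne_zero hx (Complex.exp_ne_zero u))]
      exact mul_div_cancel₀ _ (Complex.exp_ne_zero u)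
    · intro h
      have : x = Complex.exp u := congrArg Subtype.val h
      simp [this]

/-- Nowhere vanishing functions on compact contractible spaces have logarithms. -/
theorem exists_log [PseudoMetricSpace Y] [CompactSpace Y] [ContractibleSpace Y] (f : C(Y, ℂ))
    (hf : ∀ y, f y ≠ 0) : ∃ g : C(Y, ℂ), ∀ y, Complex.exp (g y) = f y := by
  obtain ⟨g, hg⟩ := hasLocalTransport_exp.exists_lift (Y := Y)
    (fun z => ⟨_, Subtype.ext (Complex.exp_log z.2)⟩)
    ⟨fun y => ⟨f y, hf y⟩, f.continuous.subtype_mk _⟩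
  exact ⟨g, fun y => congrArg Subtype.val (hg y)⟩

end Lifting

/-! ### Local triviality of the quotient and the Hausdorff property -/

section LocalStructure

variable {N : Type*} [AddCommGroup N] {m : ℕ}
variable {S : Set (PointedCone ℝ (ℝ ⊗[ℤ] N))} {v : Fin m → N}

theorem isOpen_homogeneousPoints (hS : IsCalabiYauFan S v) :
    IsOpen {z : Fin m → ℂ | latticeCone (v '' {i | z i = 0}) ∈ S} := by
  refine isOpen_iff_mem_nhds.2 fun z hz => ?_
  have : {w : Fin m → ℂ | ∀ i, z i ≠ 0 → w i ≠ 0} ∈ nhds z := by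
    have h (i : Fin m) : {w : Fin m → ℂ | z i ≠ 0 → w i ≠ 0} ∈ nhds z := by
      by_cases hi : z i = 0
      · simp [hi]
      · filter_upwards [(isOpen_ne.preimage (continuous_apply i)).mem_nhds hi] with w hw _ using hw
    filter_upwards [Filter.eventually_all.2 h] with w hw using hw
  filter_upwards [this] with w hw
  exact hS.latticeCone_mem_of_subset hz fun i hi => by
    by_contra h
    exact hw i h hi

theorem toricMk_surjective :
    Function.Surjective (toricMk : HomogeneousPoints S v → ToricManifold S v) :=
  Quotient.mk_surjective

theorem isQuotientMap_toricMk :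
    Topology.IsQuotientMap (toricMk : HomogeneousPoints S v → ToricManifold S v) :=
  isQuotientMap_quotient_mk'

theorem toricMk_eq_iff {z w : HomogeneousPoints S v} :
    toricMk z = toricMk w ↔ ∃ g ∈ quotientGroup v, ∀ i, w.1 i = g i * z.1 i :=
  Quotient.eq (r := toricSetoid S v)

theorem latticeCone_mem_units_mul (z : HomogeneousPoints S v) {t : Fin m → ℂ}
    (ht : ∀ i, t i ≠ 0) : latticeCone (v '' {i | t i * z.1 i = 0}) ∈ S := by
  have : {i | t i * z.1 i = 0} = {i | z.1 i = 0} := by ext i; simp [ht i]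
  exact this ▸ z.2

/-- Coordinatewise multiplication of a point by nonzero complex numbers. -/
def unitsMul (t : Fin m → ℂ) (ht : ∀ i, t i ≠ 0) (z : HomogeneousPoints S v) :
    HomogeneousPoints S v := ⟨fun i => t i * z.1 i, latticeCone_mem_units_mul z ht⟩

theorem isOpenQuotientMap_toricMk :
    IsOpenQuotientMap (toricMk : HomogeneousPoints S v → ToricManifold S v) := by
  refine ⟨toricMk_surjective, continuous_toricMk, fun O hO => ?_⟩
  rw [← isQuotientMap_toricMk.isOpen_preimage]
  have : toricMk ⁻¹' (toricMk '' O) = ⋃ g : quotientGroup v,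
      unitsMul (fun i => (g.1 i : ℂ)) (fun i => (g.1 i).ne_zero) ⁻¹' O := by
    ext z
    simp only [Set.mem_preimage, Set.mem_image, Set.mem_iUnion]
    constructor
    · rintro ⟨w, hw, h⟩
      obtain ⟨g, hg, e⟩ := toricMk_eq_iff.1 h.symm
      refine ⟨⟨g, hg⟩, ?_⟩
      convert hw using 1
      exact Subtype.ext (funext fun i => (e i).symm)
    · rintro ⟨g, hg⟩
      exact ⟨_, hg, (toricMk_eq_iff.2 ⟨g, g.2, fun i => rfl⟩).symm⟩
  rw [this]
  refine isOpen_iUnion fun g => hO.preimage ?_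
  refine Continuous.subtype_mk (continuous_pi fun i => ?_) _
  exact continuous_const.mul ((continuous_apply i).comp continuous_subtype_val)

/-- The exponents of the projection of `ℤ^m` onto the kernel of `ℤ^m → N` given by a section. -/
def kernelExponent (v : Fin m → N) (τ : N →ₗ[ℤ] (Fin m → ℤ)) (k i : Fin m) : ℤ :=
  (Pi.single i 1 : Fin m → ℤ) k - τ (v i) k

/-- The monomials with exponents `kernelExponent`. -/
def kernelMonomial (v : Fin m → N) (τ : N →ₗ[ℤ] (Fin m → ℤ)) (z : Fin m → ℂ) (k : Fin m) : ℂ :=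
  ∏ i, z i ^ kernelExponent v τ k i

/-- The exponents `τ (v i) k` come from an element of the dual lattice, so this part of the monomial
is `1` on `G` and the other part is the `k`-th coordinate. The monomials thus form a map to `G` that
is equivariant for multiplication by `G`. -/
theorem kernelMonomial_mul (τ : N →ₗ[ℤ] (Fin m → ℤ)) {g : Fin m → ℂˣ} (hg : g ∈ quotientGroup v)
    (z : Fin m → ℂ) (k : Fin m) :
    kernelMonomial v τ (fun i => g i * z i) k = g k * kernelMonomial v τ z k := by
  simp only [kernelMonomial, mul_zpow, Finset.prod_mul_distrib]
  congr 1
  have h1 := hg (LinearMap.proj k ∘ₗ τ)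
  have h2 : ∏ i, g i ^ kernelExponent v τ k i = g k := by
    simp only [kernelExponent, zpow_sub, Finset.prod_mul_distrib, Finset.prod_inv_distrib]
    rw [show ∏ i, g i ^ (τ (v i) k) = 1 from h1, inv_one, mul_one, Finset.prod_eq_single k]
    · simp
    · intro i _ hi
      rw [Pi.single_eq_of_ne (Ne.symm hi), zpow_zero]
    · simp
  have := congrArg (fun u : ℂˣ => (u : ℂ)) h2
  simpa using this

/-- The coordinates in `A`, which may vanish, have exponent `0` because `τ` sends their generators
to unit vectors. -/
theorem kernelMonomial_ne_zero {τ : N →ₗ[ℤ] (Fin m → ℤ)} {A : Set (Fin m)}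
    (hτ : ∀ i ∈ A, τ (v i) = Pi.single i 1) {z : Fin m → ℂ} (hz : ∀ i, i ∉ A → z i ≠ 0)
    (k : Fin m) : kernelMonomial v τ z k ≠ 0 := by
  refine Finset.prod_ne_zero_iff.2 fun i _ => ?_
  by_cases hi : i ∈ A
  · simp [kernelExponent, hτ i hi]
  · exact zpow_ne_zero _ (hz i hi)

theorem continuousOn_kernelMonomial {τ : N →ₗ[ℤ] (Fin m → ℤ)} {A : Set (Fin m)}
    (hτ : ∀ i ∈ A, τ (v i) = Pi.single i 1) (k : Fin m) :
    ContinuousOn (fun z => kernelMonomial v τ z k) {z | ∀ i, i ∉ A → z i ≠ 0} := by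
  refine continuousOn_finsetProd _ fun i _ => ?_
  by_cases hi : i ∈ A
  · simp only [kernelExponent, hτ i hi, sub_self, zpow_zero]
    exact continuousOn_const
  · exact (continuous_apply i).continuousOn.zpow₀ _ fun z hz => Or.inl (hz i hi)

theorem prod_zpow_eq_zpow_sum {ι : Type*} {a : ℂ} (ha : a ≠ 0) (s : Finset ι) (f : ι → ℤ) :
    ∏ k ∈ s, a ^ f k = a ^ ∑ k ∈ s, f k := by
  classical
  induction s using Finset.induction_on with
  | empty => simp
  | insert k s hk ih => rw [Finset.prod_insert hk, Finset.sum_insert hk, zpow_add₀ ha, ih]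

/-- The exponent of `z i` in the `μ`-relation is `μ (v i) - μ (∑ k, τ (v i) k • v k)`, which is `0`
as `τ` is a section. -/
theorem kernelMonomial_mem {τ : N →ₗ[ℤ] (Fin m → ℤ)} (hτ : ∀ u, ∑ i, τ u i • v i = u)
    {A : Set (Fin m)} (hτA : ∀ i ∈ A, τ (v i) = Pi.single i 1) {z : Fin m → ℂ}
    (hz : ∀ i, i ∉ A → z i ≠ 0) :
    (fun k => Units.mk0 _ (kernelMonomial_ne_zero hτA hz k)) ∈ quotientGroup v := by
  intro μ
  refine Units.ext ?_
  simp only [Units.coe_prod, Units.val_zpow_eq_zpow_val, Units.val_mk0, Units.val_one,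
    kernelMonomial, ← Finset.prod_zpow, ← zpow_mul]
  rw [Finset.prod_comm]
  refine Finset.prod_eq_one fun i _ => ?_
  by_cases hi : i ∈ A
  · simp [kernelExponent, hτA i hi]
  · have hsum : ∑ k, kernelExponent v τ k i * μ (v k) = 0 := by
      have h1 := congrArg μ (hτ (v i))
      simp only [map_sum, map_smul, smul_eq_mul] at h1
      simp only [kernelExponent, sub_mul, Finset.sum_sub_distrib, h1]
      simp [Pi.single_apply]
    rw [prod_zpow_eq_zpow_sum (hz i hi), hsum, zpow_zero]

/-- The slice function `z_k / ρ_k(z)`. -/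
def sliceFun (v : Fin m → N) (τ : N →ₗ[ℤ] (Fin m → ℤ)) (z : Fin m → ℂ) (k : Fin m) : ℂ :=
  z k / kernelMonomial v τ z k

theorem sliceFun_mul (τ : N →ₗ[ℤ] (Fin m → ℤ)) {g : Fin m → ℂˣ} (hg : g ∈ quotientGroup v)
    (z : Fin m → ℂ) : sliceFun v τ (fun i => g i * z i) = sliceFun v τ z := by
  funext k
  rw [sliceFun, kernelMonomial_mul τ hg, mul_div_mul_left _ _ (g k).ne_zero, sliceFun]

theorem continuousOn_sliceFun {τ : N →ₗ[ℤ] (Fin m → ℤ)} {A : Set (Fin m)}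
    (hτ : ∀ i ∈ A, τ (v i) = Pi.single i 1) :
    ContinuousOn (sliceFun v τ) {z | ∀ i, i ∉ A → z i ≠ 0} :=
  continuousOn_pi.2 fun k => (continuous_apply k).continuousOn.div
    (continuousOn_kernelMonomial hτ k) fun _ hz => kernelMonomial_ne_zero hτ hz k

/-- Points with the same slice function are equivalent. -/
theorem exists_mem_quotientGroup_of_sliceFun_eq {τ : N →ₗ[ℤ] (Fin m → ℤ)}
    (hτ : ∀ u, ∑ i, τ u i • v i = u) {A : Set (Fin m)} (hτA : ∀ i ∈ A, τ (v i) = Pi.single i 1)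
    {z w : Fin m → ℂ} (hz : ∀ i, i ∉ A → z i ≠ 0) (hw : ∀ i, i ∉ A → w i ≠ 0)
    (h : sliceFun v τ z = sliceFun v τ w) : ∃ g ∈ quotientGroup v, ∀ i, w i = g i * z i := by
  refine ⟨_, mul_mem (kernelMonomial_mem hτ hτA hw) (inv_mem (kernelMonomial_mem hτ hτA hz)),
    fun i => ?_⟩
  have h1 := congrFun h i
  simp only [sliceFun] at h1
  have hz' := kernelMonomial_ne_zero hτA hz i
  have hw' := kernelMonomial_ne_zero hτA hw i
  rw [div_eq_div_iff hz' hw'] at h1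
  simp only [Pi.mul_apply, Pi.inv_apply, Units.val_mul, Units.val_mk0, Units.val_inv_eq_inv_val]
  field_simp
  linear_combination -h1

variable (S v) in
/-- The points all of whose coordinates outside `A` are nonzero. -/
def affinePatch (A : Set (Fin m)) : Set (HomogeneousPoints S v) := {z | ∀ i, i ∉ A → z.1 i ≠ 0}

theorem isOpen_affinePatch (A : Set (Fin m)) : IsOpen (affinePatch S v A) := by
  have : affinePatch S v A = ⋂ i : Fin m, {z | i ∉ A → z.1 i ≠ 0} := by
    ext z; simp [affinePatch]
  rw [this]
  refine isOpen_iInter_of_finite fun i => ?_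
  by_cases hi : i ∈ A
  · simp [hi]
  · simp only [hi, not_false_eq_true, forall_true_left]
    exact isOpen_ne.preimage ((continuous_apply i).comp continuous_subtype_val)

theorem toricMk_mem_image_affinePatch {A : Set (Fin m)} {z : HomogeneousPoints S v} :
    toricMk z ∈ toricMk '' affinePatch S v A ↔ z ∈ affinePatch S v A := by
  refine ⟨?_, fun h => ⟨z, h, rfl⟩⟩
  rintro ⟨w, hw, h⟩ i hi
  obtain ⟨g, -, hg⟩ := toricMk_eq_iff.1 h
  rw [hg]
  exact mul_ne_zero (g i).ne_zero (hw i hi)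

/-- The slice function on the toric manifold. -/
def sliceMap (τ : N →ₗ[ℤ] (Fin m → ℤ)) : ToricManifold S v → Fin m → ℂ :=
  Quotient.lift (fun z : HomogeneousPoints S v => sliceFun v τ z.1) (by
    rintro z w ⟨g, hg, h⟩
    have : w.1 = fun i => g i * z.1 i := funext h
    simp only [this, sliceFun_mul τ hg])

theorem sliceMap_toricMk (τ : N →ₗ[ℤ] (Fin m → ℤ)) (z : HomogeneousPoints S v) :
    sliceMap τ (toricMk z) = sliceFun v τ z.1 := rfl

theorem continuousOn_sliceMap {τ : N →ₗ[ℤ] (Fin m → ℤ)} {A : Set (Fin m)}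
    (hτ : ∀ i ∈ A, τ (v i) = Pi.single i 1) :
    ContinuousOn (sliceMap τ) (toricMk '' affinePatch S v A) := by
  rw [isQuotientMap_toricMk.continuousOn_isOpen_iff
    (isOpenQuotientMap_toricMk.isOpenMap _ (isOpen_affinePatch A))]
  have h : ContinuousOn (fun z : HomogeneousPoints S v => sliceFun v τ z.1)
      (affinePatch S v A) :=
    (continuousOn_sliceFun hτ).comp continuous_subtype_val.continuousOn fun z hz => hz
  exact h.mono fun z hz => toricMk_mem_image_affinePatch.1 hz

/-- With a section adapted to the zero set of `z`, kernel monomials and slice function split a point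
of the affine patch into a part in `G` and a part determined by its image. Transport keeps the first
part of `u` and takes the second from `x`. -/
theorem hasLocalTransport_toricMk (hS : IsCalabiYauFan S v)
    (hspan : ∀ u : N, ∃ a : Fin m → ℤ, ∑ i, a i • v i = u) :
    HasLocalTransport (toricMk : HomogeneousPoints S v → ToricManifold S v) := by
  classical
  intro x
  obtain ⟨z, rfl⟩ := toricMk_surjective x
  set A : Set (Fin m) := {i | z.1 i = 0}
  obtain ⟨τ, hτ, hτA⟩ := hS.exists_section hspan z.2
  let t (q : HomogeneousPoints S v × ToricManifold S v) (k : Fin m) : ℂ :=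
    kernelMonomial v τ q.1.1 k * sliceMap τ q.2 k
  -- The second branch only makes `T` total; over the patch the first one applies.
  let T (q : HomogeneousPoints S v × ToricManifold S v) : HomogeneousPoints S v :=
    if h : latticeCone (v '' {k | t q k = 0}) ∈ S then ⟨t q, h⟩ else q.1
  have ht (u w : HomogeneousPoints S v) (hu : u ∈ affinePatch S v A)
      (hw : w ∈ affinePatch S v A) : ∃ g ∈ quotientGroup v, ∀ k, t (u, toricMk w) k = g k * w.1 k := by
    refine ⟨_, mul_mem (kernelMonomial_mem hτ hτA hu) (inv_mem (kernelMonomial_mem hτ hτA hw)),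
      fun k => ?_⟩
    simp only [t, sliceMap_toricMk, sliceFun, Pi.mul_apply, Pi.inv_apply, Units.val_mul,
      Units.val_mk0, Units.val_inv_eq_inv_val]
    ring
  have hT (q : HomogeneousPoints S v × ToricManifold S v) (h1 : toricMk q.1 ∈ toricMk '' affinePatch S v A)
      (h2 : q.2 ∈ toricMk '' affinePatch S v A) : (T q).1 = t q := by
    obtain ⟨u, x⟩ := q
    obtain ⟨w, hw, rfl⟩ := h2
    obtain ⟨g, hg, e⟩ := ht u w (toricMk_mem_image_affinePatch.1 h1) hw
    have : latticeCone (v '' {k | t (u, toricMk w) k = 0}) ∈ S := by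
      rw [funext e]
      exact latticeCone_mem_units_mul w fun i => (g i).ne_zero
    exact congrArg Subtype.val (dif_pos this)
  refine ⟨toricMk '' affinePatch S v A,
    isOpenQuotientMap_toricMk.isOpenMap _ (isOpen_affinePatch A), ⟨z, fun i hi => hi, rfl⟩, T, ?_, ?_⟩
  · have hi : Topology.IsInducing (fun z : HomogeneousPoints S v => z.1) :=
      Topology.IsInducing.subtypeVal
    rw [hi.continuousOn_iff]
    have : ContinuousOn t {q | toricMk q.1 ∈ toricMk '' affinePatch S v A ∧
        q.2 ∈ toricMk '' affinePatch S v A} := by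
      refine continuousOn_pi.2 fun k => ContinuousOn.mul ?_ ?_
      · exact (continuousOn_kernelMonomial hτA k).comp
          (continuous_subtype_val.comp continuous_fst).continuousOn
          fun q hq => toricMk_mem_image_affinePatch.1 hq.1
      · exact (continuous_apply k).comp_continuousOn
          ((continuousOn_sliceMap hτA).comp continuous_snd.continuousOn fun q hq => hq.2)
    exact this.congr fun q hq => hT q hq.1 hq.2
  · rintro u x hu ⟨w, hw, rfl⟩
    obtain ⟨g, hg, e⟩ := ht u w (toricMk_mem_image_affinePatch.1 hu) hw
    have hT' := hT (u, toricMk w) hu ⟨w, hw, rfl⟩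
    refine ⟨?_, fun h => Subtype.ext (funext fun k => ?_)⟩
    · refine (toricMk_eq_iff.2 ⟨g, hg, fun i => ?_⟩).symm
      rw [hT', e]
    · rw [hT']
      simp only [t, h, sliceMap_toricMk, sliceFun]
      exact mul_div_cancel₀ _ (kernelMonomial_ne_zero hτA (toricMk_mem_image_affinePatch.1 hu) k)

theorem tendsto_log_norm_atBot {a b h : ℕ → ℂ} {b₀ : ℂ} (ha : Filter.Tendsto a Filter.atTop (nhds 0))
    (hb : Filter.Tendsto b Filter.atTop (nhds b₀)) (hb₀ : b₀ ≠ 0) (hh : ∀ k, h k ≠ 0)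
    (e : ∀ k, a k = h k * b k) :
    Filter.Tendsto (fun k => Real.log ‖h k‖) Filter.atTop Filter.atBot := by
  have h1 : Filter.Tendsto h Filter.atTop (nhds 0) := by
    have := ha.div hb hb₀
    rw [zero_div] at this
    refine this.congr' ?_
    filter_upwards [hb.eventually_ne hb₀] with k hk
    simp [e, hk]
  refine Real.tendsto_log_nhdsGT_zero.comp ?_
  refine tendsto_nhdsWithin_iff.2 ⟨by simpa using h1.norm, Filter.Eventually.of_forall fun k => ?_⟩
  exact norm_pos_iff.2 (hh k)

/-- Logarithms of absolute values in the defining equations of `G`, for the coordinate functionals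
of `b`, extended to `f` by linearity. -/
theorem sum_mul_log_norm_eq_zero {n : ℕ} (b : Module.Basis (Fin n) ℤ N)
    (f : (Fin n → ℝ) →ₗ[ℝ] ℝ) {g : Fin m → ℂˣ} (hg : g ∈ quotientGroup v) :
    ∑ i, f (fun j => (b.coord j (v i) : ℝ)) * Real.log ‖(g i : ℂ)‖ = 0 := by
  have h1 (j : Fin n) : ∑ i, (b.coord j (v i) : ℝ) * Real.log ‖(g i : ℂ)‖ = 0 := by
    have h2 := congrArg (fun u : ℂˣ => Real.log ‖(u : ℂ)‖) (hg (b.coord j))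
    simp only [Units.coe_prod, Units.val_zpow_eq_zpow_val, norm_prod, norm_zpow, Units.val_one,
      norm_one, Real.log_one] at h2
    rw [Real.log_prod fun i _ => zpow_ne_zero _ (norm_ne_zero_iff.2 (g i).ne_zero)] at h2
    simpa only [Real.log_zpow] using h2
  have h3 : ∑ i, f (fun j => (b.coord j (v i) : ℝ)) * Real.log ‖(g i : ℂ)‖ =
      f (∑ i, Real.log ‖(g i : ℂ)‖ • fun j => (b.coord j (v i) : ℝ)) := by
    simp only [map_sum, map_smul, smul_eq_mul, mul_comm]
  rw [h3]
  convert map_zero f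
  ext j
  simp only [Finset.sum_apply, Pi.smul_apply, smul_eq_mul, Pi.zero_apply]
  rw [← h1 j]
  simp only [mul_comm]

/-- Write `w = g z` along the sequence and let `F` separate the two limit cones. The terms `F i *
log |g i|` sum to `0`. Where only `z₀` vanishes, `|g i| → ∞` and `F i > 0`; where only `w₀`
vanishes, `|g i| → 0` and `F i < 0`. Such terms tend to `+∞`, while the others are `0` or converge,
so none can occur. -/
theorem zeros_subset_of_tendsto {n : ℕ} (hS : IsCalabiYauFan S v) (b : Module.Basis (Fin n) ℤ N)
    {z w : ℕ → HomogeneousPoints S v} {z₀ w₀ : HomogeneousPoints S v}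
    (hz : Filter.Tendsto z Filter.atTop (nhds z₀)) (hw : Filter.Tendsto w Filter.atTop (nhds w₀))
    (h : ∀ k, toricMk (z k) = toricMk (w k)) (i : Fin m) : z₀.1 i = 0 ↔ w₀.1 i = 0 := by
  have hz' (i) : Filter.Tendsto (fun k => (z k).1 i) Filter.atTop (nhds (z₀.1 i)) :=
    (((continuous_apply i).comp continuous_subtype_val).tendsto z₀).comp hz
  have hw' (i) : Filter.Tendsto (fun k => (w k).1 i) Filter.atTop (nhds (w₀.1 i)) :=
    (((continuous_apply i).comp continuous_subtype_val).tendsto w₀).comp hw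
  choose g hg e using fun k => toricMk_eq_iff.1 (h k)
  obtain ⟨f, hf0, hfp, hfn⟩ := hS.exists_separating b z₀.2 w₀.2
  set F : Fin m → ℝ := fun i => f (fun j => (b.coord j (v i) : ℝ))
  set t : Fin m → ℕ → ℝ := fun i k => F i * Real.log ‖(g k i : ℂ)‖
  have htop1 (i) (h1 : z₀.1 i = 0) (h2 : w₀.1 i ≠ 0) :
      Filter.Tendsto (t i) Filter.atTop Filter.atTop := by
    refine Filter.Tendsto.const_mul_atTop (hfp i ⟨h1, h2⟩) ?_
    have := tendsto_log_norm_atBot (h := fun k => ((g k i)⁻¹ : ℂˣ)) (by simpa only [h1] using hz' i) (hw' i) h2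
      (fun k => Units.ne_zero _) (fun k => by rw [e]; simp)
    simp only [Units.val_inv_eq_inv_val, norm_inv, Real.log_inv] at this
    simpa using Filter.tendsto_neg_atBot_iff.1 this
  have htop2 (i) (h1 : z₀.1 i ≠ 0) (h2 : w₀.1 i = 0) :
      Filter.Tendsto (t i) Filter.atTop Filter.atTop := by
    refine Filter.Tendsto.const_mul_atBot_of_neg (hfn i ⟨h2, h1⟩) ?_
    exact tendsto_log_norm_atBot (by simpa only [h2] using hw' i) (hz' i) h1 (fun k => Units.ne_zero _) (fun k => e k i)
  have hbdd (i) : ∃ C, ∀ᶠ k in Filter.atTop, C ≤ t i k := by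
    by_cases h1 : z₀.1 i = 0 <;> by_cases h2 : w₀.1 i = 0
    · refine ⟨0, Filter.Eventually.of_forall fun k => ?_⟩
      have : F i = 0 := hf0 i ⟨h1, h2⟩
      simp [t, this]
    · exact ⟨0, (htop1 i h1 h2).eventually_ge_atTop 0⟩
    · exact ⟨0, (htop2 i h1 h2).eventually_ge_atTop 0⟩
    · have : Filter.Tendsto (fun k => F i * Real.log (‖(w k).1 i‖ / ‖(z k).1 i‖)) Filter.atTop
          (nhds (F i * Real.log (‖w₀.1 i‖ / ‖z₀.1 i‖))) := by
        refine Filter.Tendsto.const_mul _ (Filter.Tendsto.log ?_ ?_)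
        · exact (hw' i).norm.div (hz' i).norm (norm_ne_zero_iff.2 h1)
        · exact div_ne_zero (norm_ne_zero_iff.2 h2) (norm_ne_zero_iff.2 h1)
      refine ⟨F i * Real.log (‖w₀.1 i‖ / ‖z₀.1 i‖) - 1, ((this.eventually (Ici_mem_nhds (sub_one_lt _))).and
        ((hz' i).eventually_ne h1)).mono fun k hk => ?_⟩
      refine hk.1.trans (le_of_eq ?_)
      simp only [t, e, norm_mul]
      rw [mul_div_cancel_right₀ _ (norm_ne_zero_iff.2 hk.2)]
  choose C hC using hbdd
  by_contra hne
  have htop : Filter.Tendsto (t i) Filter.atTop Filter.atTop := by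
    by_cases h1 : z₀.1 i = 0
    · exact htop1 i h1 fun h2 => hne (by simp [h1, h2])
    · by_cases h2 : w₀.1 i = 0
      · exact htop2 i h1 h2
      · exact absurd (by simp [h1, h2]) hne
  obtain ⟨k, hk1, hk2⟩ := ((Filter.eventually_all.2 hC).and
    (htop.eventually_gt_atTop (-∑ j ∈ Finset.univ.erase i, C j))).exists
  have h0 := sum_mul_log_norm_eq_zero b f (hg k)
  rw [← Finset.add_sum_erase _ _ (Finset.mem_univ i)] at h0
  have := Finset.sum_le_sum fun j (_ : j ∈ Finset.univ.erase i) => hk1 j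
  simp only [t] at this hk2
  linarith

/-- The equivalence relation is sequentially closed: by `zeros_subset_of_tendsto` the limits lie in
a common affine patch, where the continuous slice function decides equivalence. -/
theorem t2Space_toricManifold {n : ℕ} (hS : IsCalabiYauFan S v) (b : Module.Basis (Fin n) ℤ N)
    (hspan : ∀ u : N, ∃ a : Fin m → ℤ, ∑ i, a i • v i = u) : T2Space (ToricManifold S v) := by
  have : FirstCountableTopology (HomogeneousPoints S v) :=
    inferInstanceAs (FirstCountableTopology {z : Fin m → ℂ // latticeCone (v '' {i | z i = 0}) ∈ S})
  rw [t2Space_iff_of_isOpenQuotientMap isOpenQuotientMap_toricMk]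
  refine IsSeqClosed.isClosed fun q q₀ hq hlim => ?_
  have hz := (continuous_fst.tendsto q₀).comp hlim
  have hw := (continuous_snd.tendsto q₀).comp hlim
  have hA := zeros_subset_of_tendsto hS b hz hw hq
  obtain ⟨τ, hτ, hτA⟩ := hS.exists_section hspan q₀.1.2
  set A : Set (Fin m) := {i | q₀.1.1 i = 0}
  have hz₀ : q₀.1 ∈ affinePatch S v A := fun i hi => hi
  have hw₀ : q₀.2 ∈ affinePatch S v A := fun i hi h => hi ((hA i).2 h)
  have hs (u : HomogeneousPoints S v) (hu : u ∈ affinePatch S v A) :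
      ContinuousAt (fun u : HomogeneousPoints S v => sliceFun v τ u.1) u :=
    ((continuousOn_sliceFun hτA).comp continuous_subtype_val.continuousOn
      fun u hu => hu).continuousAt ((isOpen_affinePatch A).mem_nhds hu)
  have h1 := (hs _ hz₀).tendsto.comp hz
  have h2 := (hs _ hw₀).tendsto.comp hw
  refine toricMk_eq_iff.2 (exists_mem_quotientGroup_of_sliceFun_eq hτ hτA hz₀ hw₀
    (tendsto_nhds_unique h1 (h2.congr fun k => ?_)))
  exact (congrArg (sliceMap τ) (hq k)).symm

end LocalStructure

/-! ### Increments of logarithms -/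

section LogDiff

/-- The two logarithms differ by a continuous integer multiple of `2πi`, which is constant on a
preconnected space. -/
theorem sub_eq_sub_of_exp_eq {Y : Type*} [TopologicalSpace Y] [PreconnectedSpace Y] {g g' : C(Y, ℂ)}
    (h : ∀ y, Complex.exp (g y) = Complex.exp (g' y)) (a b : Y) : g b - g a = g' b - g' a := by
  have h1 : ∀ y, ∃ k : ℤ, g y = g' y + k * (2 * Real.pi * Complex.I) :=
    fun y => Complex.exp_eq_exp_iff_exists_int.1 (h y)
  choose k hk using h1
  have hc : Continuous fun y => (k y : ℝ) := by
    have : (fun y => (k y : ℝ)) = fun y => ((g y - g' y) / (2 * Real.pi * Complex.I)).re := by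
      funext y
      rw [hk y, add_sub_cancel_left, mul_div_cancel_right₀ _ Complex.two_pi_I_ne_zero]
      simp
    rw [this]
    fun_prop
  have hk' : Continuous k := Int.isClosedEmbedding_coe_real.isInducing.continuous_iff.2 hc
  have := PreconnectedSpace.constant inferInstance hk' (x := a) (y := b)
  rw [hk a, hk b, this]
  ring

variable {Y Z : Type*} [PseudoMetricSpace Y] [CompactSpace Y] [ContractibleSpace Y]
  [PseudoMetricSpace Z] [CompactSpace Z] [ContractibleSpace Z]

open Classical in
/-- The increment of the logarithm of a nowhere vanishing function along a path from `a` to `b`. -/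
def logDiff (u : C(Y, ℂ)) (a b : Y) : ℂ :=
  if h : ∀ y, u y ≠ 0 then (exists_log u h).choose b - (exists_log u h).choose a else 0

theorem logDiff_eq {u : C(Y, ℂ)} (g : C(Y, ℂ)) (hg : ∀ y, Complex.exp (g y) = u y) (a b : Y) :
    logDiff u a b = g b - g a := by
  have h : ∀ y, u y ≠ 0 := fun y => hg y ▸ Complex.exp_ne_zero _
  rw [logDiff, dif_pos h]
  exact sub_eq_sub_of_exp_eq (fun y => ((exists_log u h).choose_spec y).trans (hg y).symm) a b

theorem logDiff_add {u : C(Y, ℂ)} (hu : ∀ y, u y ≠ 0) (a b c : Y) :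
    logDiff u a b + logDiff u b c = logDiff u a c := by
  obtain ⟨g, hg⟩ := exists_log u hu
  simp only [logDiff_eq g hg]
  ring

theorem logDiff_comp {u : C(Y, ℂ)} (hu : ∀ y, u y ≠ 0) (f : C(Z, Y)) (a b : Z) :
    logDiff (u.comp f) a b = logDiff u (f a) (f b) := by
  obtain ⟨g, hg⟩ := exists_log u hu
  rw [logDiff_eq g hg, logDiff_eq (u := u.comp f) (g.comp f) fun y => hg (f y)]
  rfl

theorem logDiff_mul {u w : C(Y, ℂ)} (hu : ∀ y, u y ≠ 0) (hw : ∀ y, w y ≠ 0) (a b : Y) :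
    logDiff (u * w) a b = logDiff u a b + logDiff w a b := by
  obtain ⟨g, hg⟩ := exists_log u hu
  obtain ⟨k, hk⟩ := exists_log w hw
  rw [logDiff_eq g hg, logDiff_eq k hk, logDiff_eq (g + k) fun y => by
    simp [Complex.exp_add, hg, hk]]
  simp only [ContinuousMap.add_apply]
  ring

theorem logDiff_const {z : ℂ} (hz : z ≠ 0) (a b : Y) : logDiff (ContinuousMap.const Y z) a b = 0 := by
  rw [logDiff_eq (u := ContinuousMap.const Y z) (ContinuousMap.const Y (Complex.log z))
    fun _ => Complex.exp_log hz]
  simp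

theorem exp_logDiff {u : C(Y, ℂ)} (hu : ∀ y, u y ≠ 0) (a b : Y) :
    Complex.exp (logDiff u a b) * u a = u b := by
  obtain ⟨g, hg⟩ := exists_log u hu
  rw [logDiff_eq g hg, ← hg a, ← hg b, ← Complex.exp_add, sub_add_cancel]

/-- Logarithms of a family of functions satisfying a multiplicative relation satisfy the
corresponding additive relation up to a constant. -/
theorem sum_mul_logDiff_eq_zero {m : ℕ} {u : Fin m → C(Y, ℂ)} (hu : ∀ i y, u i y ≠ 0)
    (e : Fin m → ℤ) (z : ℂ) (hz : ∀ y, ∏ i, u i y ^ e i = z) (a b : Y) :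
    ∑ i, (e i : ℂ) * logDiff (u i) a b = 0 := by
  choose g hg using fun i => exists_log (u i) (hu i)
  have hz0 : z ≠ 0 := by
    rw [← hz a]
    exact Finset.prod_ne_zero_iff.2 fun i _ => zpow_ne_zero _ (hu i a)
  have h1 := logDiff_eq (u := ContinuousMap.const Y z) (∑ i, (e i : ℂ) • g i) (fun y => by
    simp only [ContinuousMap.sum_apply, ContinuousMap.smul_apply, smul_eq_mul, Complex.exp_sum,
      Complex.exp_int_mul, hg, hz, ContinuousMap.const_apply]) a b
  rw [logDiff_const hz0] at h1
  simp only [ContinuousMap.sum_apply, ContinuousMap.smul_apply, smul_eq_mul,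
    ← Finset.sum_sub_distrib, ← mul_sub] at h1
  rw [h1]
  exact Finset.sum_congr rfl fun i _ => by rw [logDiff_eq (g i) (hg i)]

end LogDiff

instance contractibleSpace_unitInterval : ContractibleSpace I :=
  (convex_Icc (0 : ℝ) 1).contractibleSpace ⟨0, by simp⟩

instance contractibleSpace_stdSimplex (k : ℕ) : ContractibleSpace (stdSimplex ℝ (Fin (k + 1))) :=
  (convex_stdSimplex ℝ (Fin (k + 1))).contractibleSpace ⟨_, single_mem_stdSimplex ℝ 0⟩

/-! ### General position in complex codimension two -/

section GeneralPosition

theorem card_ne_and_ne {m : ℕ} {i j : Fin m} (hij : i ≠ j) :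
    Fintype.card {a : Fin m // a ≠ i ∧ a ≠ j} = m - 2 := by
  rw [Fintype.card_subtype]
  have : (Finset.univ.filter fun a : Fin m => a ≠ i ∧ a ≠ j) = ({i, j} : Finset (Fin m))ᶜ := by
    ext a; simp
  rw [this, Finset.card_compl, Finset.card_pair hij, Fintype.card_fin]

theorem two_le_of_ne {m : ℕ} {i j : Fin m} (hij : i ≠ j) : 2 ≤ m := by
  have h1 := i.2
  have h2 := j.2
  have h3 : (i : ℕ) ≠ j := fun h => hij (Fin.ext h)
  omega

/-- A generic perturbation of a smooth map of a cube of dimension at most two avoids the lines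
through the coordinate subspaces of codimension two. -/
theorem dense_generic_perturbation {m k : ℕ} (hk : k ≤ 2) (c : Fin m → ℂ)
    {g : (Fin k → ℝ) → Fin m → ℂ} (hg : ContDiff ℝ 1 g) {β : (Fin k → ℝ) → ℝ}
    (hβ : ContDiff ℝ 1 β) (hβ0 : ∀ x, (∀ a, x a ∈ Set.Ioo (0 : ℝ) 1) → β x ≠ 0) :
    Dense {e : Fin m → ℂ | ∀ (x : Fin k → ℝ) (s : ℝ), (∀ a, x a ∈ Set.Ioo (0 : ℝ) 1) →
      ∀ i j, i ≠ j → s * c i + g x i + β x * e i = 0 → s * c j + g x j + β x * e j ≠ 0} := by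
  -- Parametrises the bad `e` for the pair `p`: two coordinates are solved for from the vanishing
  -- conditions, the others are free.
  let Ψ (p : Fin m × Fin m) (q : (Fin k → ℝ) × ℝ × ({a : Fin m // a ≠ p.1 ∧ a ≠ p.2} → ℂ)) :
      Fin m → ℂ := fun a => if h : a ≠ p.1 ∧ a ≠ p.2 then q.2.2 ⟨a, h⟩ else
        (-(q.2.1 * c a) - g q.1 a) / β q.1
  let D (p : Fin m × Fin m) : Set ((Fin k → ℝ) × ℝ × ({a : Fin m // a ≠ p.1 ∧ a ≠ p.2} → ℂ)) :=
    {q | ∀ a, q.1 a ∈ Set.Ioo (0 : ℝ) 1}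
  have hD (p) : Convex ℝ (D p) := by
    have : D p = (Set.univ.pi fun _ => Set.Ioo (0 : ℝ) 1) ×ˢ Set.univ := by
      ext q; simp [D]
    rw [this]
    exact (convex_pi fun _ _ => convex_Ioo 0 1).prod convex_univ
  have hΨ (p) : ContDiffOn ℝ 1 (Ψ p) (D p) := by
    refine contDiffOn_pi.2 fun a => ?_
    by_cases h : a ≠ p.1 ∧ a ≠ p.2
    · simp only [Ψ, dif_pos h]
      have : ContDiff ℝ 1 (fun e : {a : Fin m // a ≠ p.1 ∧ a ≠ p.2} → ℂ => e ⟨a, h⟩) :=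
        contDiff_apply ℝ ℂ _
      exact (this.comp (contDiff_snd.comp contDiff_snd)).contDiffOn
    · simp only [Ψ, dif_neg h]
      have h1 : ContDiff ℝ 1 (fun x => g x a) := contDiff_pi.1 hg a
      have h2 : ContDiff ℝ 1 (fun x => (β x : ℂ)) := Complex.ofRealCLM.contDiff.comp hβ
      have h3 : ContDiff ℝ 1 (fun s : ℝ => (s : ℂ)) := Complex.ofRealCLM.contDiff
      simp only [div_eq_mul_inv]
      refine ContDiffOn.mul (ContDiff.contDiffOn ?_) (ContDiffOn.inv (ContDiff.contDiffOn ?_)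
        fun q hq => ?_)
      · exact (((h3.comp (contDiff_snd.fst :
          ContDiff ℝ 1 fun q : (Fin k → ℝ) × ℝ × ({a : Fin m // a ≠ p.1 ∧ a ≠ p.2} → ℂ) =>
            q.2.1)).mul contDiff_const).neg).sub (h1.comp contDiff_fst)
      · exact h2.comp contDiff_fst
      · exact Complex.ofReal_ne_zero.2 (hβ0 _ hq)
  -- The parameters have real dimension `k + 1 + 2 (m - 2) ≤ 2 m - 1`, one less than that of `ℂ^m`.
  have hdim (p : Fin m × Fin m) (hp : p.1 ≠ p.2) : dimH (Ψ p '' D p) ≤ ((2 * m - 1 : ℕ) : ENNReal) := by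
    refine ((hΨ p).dimH_image_le (hD p) subset_rfl).trans (((dimH_mono (Set.subset_univ _)).trans_eq (Real.dimH_univ_eq_finrank _)).trans ?_)
    have h2 := two_le_of_ne hp
    simp only [Module.finrank_prod, Module.finrank_pi, Fintype.card_fin, Module.finrank_self,
      Module.finrank_pi_fintype, Complex.finrank_real_complex, Finset.sum_const, smul_eq_mul,
      Finset.card_univ, card_ne_and_ne hp]
    exact_mod_cast (by omega)
  let s : Set (Fin m → ℂ) :=
    ⋃ p : {p : Fin m × Fin m // p.1 ≠ p.2}, Ψ p.1 '' D p.1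
  have hs : Dense sᶜ := by
    by_cases hne : Nonempty {p : Fin m × Fin m // p.1 ≠ p.2}
    · obtain ⟨p⟩ := hne
      have h2 := two_le_of_ne p.2
      refine dense_compl_of_dimH_lt_finrank ?_
      refine ((dimH_iUnion fun p : {p : Fin m × Fin m // p.1 ≠ p.2} => Ψ p.1 '' D p.1).trans_le
        (iSup_le fun p => hdim p.1 p.2)).trans_lt ?_
      simp only [Module.finrank_pi_fintype, Complex.finrank_real_complex, Finset.sum_const,
        smul_eq_mul, Finset.card_univ, Fintype.card_fin]
      exact_mod_cast (by omega)
    · have := not_nonempty_iff.1 hne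
      simp [s]
  refine hs.mono fun e (he : e ∉ s) x r hx i j hij hi hj => he ?_
  refine Set.mem_iUnion.2 ⟨⟨(i, j), hij⟩, (x, r, fun a => e a), hx, funext fun a => ?_⟩
  by_cases h : a ≠ i ∧ a ≠ j
  · simp only [Ψ, dif_pos h]
  · simp only [Ψ, dif_neg h]
    have hb : (β x : ℂ) ≠ 0 := Complex.ofReal_ne_zero.2 (hβ0 _ hx)
    rw [div_eq_iff hb]
    rcases not_and_or.1 h with h | h <;> rw [not_not.1 h]
    · linear_combination -hi
    · linear_combination -hj

/-- A map from a cube of dimension at most two into the complement of a set of complex codimension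
two in `ℂ^m`, which is constant on the boundary, is null-homotopic relative to the boundary. -/
theorem homotopicRel_const_of_codimension_two {m k : ℕ} (hk : k ≤ 2) {O : Set (Fin m → ℂ)}
    (hO : IsOpen O) (hO' : ∀ z : Fin m → ℂ, (∀ i j, i ≠ j → z i = 0 → z j ≠ 0) → z ∈ O)
    (f : C(Fin k → I, O)) (c : O) (hc : ∀ i, c.1 i ≠ 0)
    (hf : ∀ y ∈ Cube.boundary (Fin k), f y = c) :
    f.HomotopicRel (ContinuousMap.const _ c) (Cube.boundary (Fin k)) := by
  let pr (x : Fin k → ℝ) : Fin k → I := fun j => Set.projIcc 0 1 zero_le_one (x j)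
  have hpr : Continuous pr := continuous_pi fun j => continuous_projIcc.comp (continuous_apply j)
  have hpr' (y : Fin k → I) : pr (fun j => y j) = y := funext fun j => Set.projIcc_val _ _
  -- The displacement from `c`, extended to `ℝ^k` by clamping. It vanishes off the open cube, and
  -- the smooth approximation is taken with support inside that of `F`.
  let F (x : Fin k → ℝ) : Fin m → ℂ := (f (pr x)).1 - c.1
  have hF : Continuous F := (continuous_subtype_val.comp (f.continuous.comp hpr)).sub continuous_const
  have hFs (x) (hx : F x ≠ 0) (j : Fin k) : x j ∈ Set.Ioo (0 : ℝ) 1 := by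
    refine ⟨lt_of_not_ge fun h => hx ?_, lt_of_not_ge fun h => hx ?_⟩
    · simp only [F]
      rw [hf (pr x) ⟨j, Or.inl (Set.projIcc_of_le_left _ h)⟩, sub_self]
    · simp only [F]
      rw [hf (pr x) ⟨j, Or.inr (Set.projIcc_of_right_le _ h)⟩, sub_self]
  obtain ⟨δ, hδ, hδO⟩ := (isCompact_range (f := fun y => (f y).1)
    (continuous_subtype_val.comp f.continuous)).exists_thickening_subset_open hO
    (by rintro _ ⟨y, rfl⟩; exact (f y).2)
  obtain ⟨g, hg, hgF, hgs⟩ := hF.exists_contDiff_approx (ε := fun _ => δ / 2) 1 continuous_const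
    (fun _ => half_pos hδ)
  have hg0 (x) (j : Fin k) (hx : x j ∉ Set.Ioo (0 : ℝ) 1) : g x = 0 := by
    by_contra h
    exact hx (hFs x (hgs h) j)
  let β (x : Fin k → ℝ) : ℝ := ∏ j, x j * (1 - x j)
  have hβ : ContDiff ℝ 1 β := by
    refine contDiff_prod fun j _ => ?_
    have : ContDiff ℝ 1 (fun x : Fin k → ℝ => x j) := contDiff_apply ℝ ℝ j
    exact this.mul (contDiff_const.sub this)
  have hβ0 (x : Fin k → ℝ) (hx : ∀ a, x a ∈ Set.Ioo (0 : ℝ) 1) : β x ≠ 0 :=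
    Finset.prod_ne_zero_iff.2 fun j _ => (mul_pos (hx j).1 (sub_pos.2 (hx j).2)).ne'
  have hβ1 (y : Fin k → I) : |β (fun j => y j)| ≤ 1 := by
    simp only [β, Finset.abs_prod]
    refine Finset.prod_le_one (fun _ _ => abs_nonneg _) fun j _ => ?_
    rw [abs_of_nonneg (mul_nonneg (y j).2.1 (sub_nonneg.2 (y j).2.2))]
    exact mul_le_one₀ (y j).2.2 (sub_nonneg.2 (y j).2.2) (by linarith [(y j).2.1])
  have hβb (y : Fin k → I) (hy : y ∈ Cube.boundary (Fin k)) : β (fun j => y j) = 0 := by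
    obtain ⟨j, hj | hj⟩ := hy <;> exact Finset.prod_eq_zero (Finset.mem_univ j) (by simp [hj])
  have hgb (y : Fin k → I) (hy : y ∈ Cube.boundary (Fin k)) : g (fun j => y j) = 0 := by
    obtain ⟨j, hj | hj⟩ := hy <;> exact hg0 _ j (by simp [hj])
  have hint (y : Fin k → I) (hy : y ∉ Cube.boundary (Fin k)) (a : Fin k) :
      (y a : ℝ) ∈ Set.Ioo (0 : ℝ) 1 := by
    refine ⟨lt_of_le_of_ne (y a).2.1 fun h => hy ⟨a, Or.inl (Subtype.ext h.symm)⟩,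
      lt_of_le_of_ne (y a).2.2 fun h => hy ⟨a, Or.inr (Subtype.ext h)⟩⟩
  obtain ⟨e, hed, heg⟩ := (dense_generic_perturbation hk c.1 (g := fun x => g x) hg hβ hβ0).exists_dist_lt
    0 (half_pos hδ)
  rw [dist_zero_left] at heg
  -- `G` is the perturbation of `f`
  let P : C(Fin k → I, Fin m → ℂ) := ⟨fun y => g (fun j => y j) + (β (fun j => y j) : ℂ) • e, by
    have h1 : Continuous fun y : Fin k → I => fun j => (y j : ℝ) :=
      continuous_pi fun j => continuous_subtype_val.comp (continuous_apply j)
    exact (hg.continuous.comp h1).add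
      ((Complex.continuous_ofReal.comp (hβ.continuous.comp h1)).smul continuous_const)⟩
  have hPb (y) (hy : y ∈ Cube.boundary (Fin k)) : P y = 0 := by
    simp [P, hgb y hy, hβb y hy]
  have hP (y) : ‖P y - ((f y).1 - c.1)‖ < δ := by
    have h1 := hgF (fun j => y j)
    rw [dist_eq_norm] at h1
    simp only [F, hpr'] at h1
    have h2 : ‖(β (fun j => y j) : ℂ) • e‖ < δ / 2 := by
      rw [norm_smul, Complex.norm_real, Real.norm_eq_abs]
      exact (mul_le_of_le_one_left (norm_nonneg _) (hβ1 y)).trans_lt heg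
    calc ‖P y - ((f y).1 - c.1)‖ = ‖(g (fun j => y j) - ((f y).1 - c.1)) +
          (β (fun j => y j) : ℂ) • e‖ := by simp only [P, ContinuousMap.coe_mk]; congr 1; abel
      _ ≤ _ := norm_add_le _ _
      _ < δ := by linarith
  -- First homotopy: the segment from `f` to its perturbation stays within distance `δ` of the image
  -- of `f`, hence in `O`.
  have hmem1 (q : I × (Fin k → I)) :
      (f q.2).1 + (q.1 : ℝ) • (c.1 + P q.2 - (f q.2).1) ∈ O := by
    refine hδO (Metric.mem_thickening_iff.2 ⟨_, ⟨q.2, rfl⟩, ?_⟩)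
    rw [dist_eq_norm, add_sub_cancel_left, norm_smul, Real.norm_eq_abs, abs_of_nonneg q.1.2.1]
    refine (mul_le_of_le_one_left (norm_nonneg _) q.1.2.2).trans_lt ?_
    refine lt_of_eq_of_lt (congrArg _ ?_) (hP q.2)
    abel
  -- Second homotopy: the straight contraction to `c`. Dividing by `1 - q.1` puts the point on one
  -- of the lines excluded by the choice of `e`, with line parameter `(1 - q.1)⁻¹`.
  have hmem2 (q : I × (Fin k → I)) : c.1 + (1 - (q.1 : ℝ) : ℝ) • P q.2 ∈ O := by
    by_cases hb : q.2 ∈ Cube.boundary (Fin k)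
    · rw [hPb _ hb, smul_zero, add_zero]
      exact c.2
    · refine hO' _ fun i j hij => ?_
      by_cases hq : (1 - (q.1 : ℝ)) = 0
      · simp [hq, hc]
      · have hq' : ((1 - (q.1 : ℝ) : ℝ) : ℂ) ≠ 0 := Complex.ofReal_ne_zero.2 hq
        have h3 := hed (fun j => q.2 j) (1 - (q.1 : ℝ))⁻¹ (hint _ hb) i j hij
        simp only [P, ContinuousMap.coe_mk, Pi.add_apply, Pi.smul_apply, smul_eq_mul,
          Complex.real_smul]
        have h4 (i : Fin m) : c.1 i + ((1 - (q.1 : ℝ) : ℝ) : ℂ) * (g (fun j => q.2 j) i +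
            (β (fun j => q.2 j) : ℂ) * e i) = ((1 - (q.1 : ℝ) : ℝ) : ℂ) *
            ((((1 - (q.1 : ℝ))⁻¹ : ℝ) : ℂ) * c.1 i + g (fun j => q.2 j) i +
              (β (fun j => q.2 j) : ℂ) * e i) := by
          rw [Complex.ofReal_inv]
          field_simp
          ring
        rw [h4, h4]
        intro h5
        exact mul_ne_zero hq' (h3 ((mul_eq_zero.1 h5).resolve_left hq'))
  have hmem3 (y : Fin k → I) : c.1 + P y ∈ O := by simpa using hmem2 (0, y)
  let f₁ : C(Fin k → I, O) := ⟨fun y => ⟨c.1 + P y, hmem3 y⟩,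
    Continuous.subtype_mk (f := fun y => c.1 + P y) (continuous_const.add P.continuous) hmem3⟩
  have hs1 : Continuous fun q : I × (Fin k → I) => (f q.2).1 :=
    continuous_subtype_val.comp (f.continuous.comp continuous_snd)
  have hs2 : Continuous fun q : I × (Fin k → I) => P q.2 := P.continuous.comp continuous_snd
  have hs3 : Continuous fun q : I × (Fin k → I) => (q.1 : ℝ) :=
    continuous_subtype_val.comp continuous_fst
  have H1 : f.HomotopyRel f₁ (Cube.boundary (Fin k)) :=
    { toFun := fun q => ⟨_, hmem1 q⟩
      continuous_toFun := Continuous.subtype_mk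
        (hs1.add (hs3.smul ((continuous_const.add hs2).sub hs1))) _
      map_zero_left := fun y => Subtype.ext (by simp)
      map_one_left := fun y => Subtype.ext (by simp [f₁])
      prop' := fun t y hy => Subtype.ext (by simp [hPb y hy, hf y hy]) }
  have H2 : f₁.HomotopyRel (ContinuousMap.const _ c) (Cube.boundary (Fin k)) :=
    { toFun := fun q => ⟨_, hmem2 q⟩
      continuous_toFun := Continuous.subtype_mk
        (continuous_const.add ((continuous_const.sub hs3).smul hs2)) _
      map_zero_left := fun y => Subtype.ext (by simp [f₁])
      map_one_left := fun y => Subtype.ext (by simp)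
      prop' := fun t y hy => Subtype.ext (by simp [hPb y hy, f₁]) }
  exact ⟨H1.trans H2⟩

end GeneralPosition

/-! ### Lifts to homogeneous coordinates and their ratios -/

section Lifts

variable {N : Type*} [AddCommGroup N] {m : ℕ}
variable {S : Set (PointedCone ℝ (ℝ ⊗[ℤ] N))} {v : Fin m → N}
variable {Y : Type*} [TopologicalSpace Y]

/-- The `i`-th homogeneous coordinate of a map. -/
def coordMap (F : C(Y, HomogeneousPoints S v)) (i : Fin m) : C(Y, ℂ) :=
  ⟨fun y => (F y).1 i, (continuous_apply i).comp (continuous_subtype_val.comp F.continuous)⟩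

@[simp]
theorem coordMap_apply (F : C(Y, HomogeneousPoints S v)) (i : Fin m) (y : Y) :
    coordMap F i y = (F y).1 i := rfl

variable (v) in
/-- The complex Lie algebra of `quotientGroup v`. -/
def kernelSubmodule : Submodule ℝ (Fin m → ℂ) where
  carrier := {x | ∀ μ : Module.Dual ℤ N, ∑ i, (μ (v i) : ℂ) * x i = 0}
  zero_mem' := by simp
  add_mem' := by
    intro x y hx hy μ
    simp only [Pi.add_apply, mul_add, Finset.sum_add_distrib, hx μ, hy μ, add_zero]
  smul_mem' := by
    intro r x hx μ
    simp only [Pi.smul_apply, mul_smul_comm, ← Finset.smul_sum, hx μ, smul_zero]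

theorem mem_kernelSubmodule {x : Fin m → ℂ} :
    x ∈ kernelSubmodule v ↔ ∀ μ : Module.Dual ℤ N, ∑ i, (μ (v i) : ℂ) * x i = 0 := Iff.rfl

theorem exp_mem_quotientGroup {x : Fin m → ℂ} (hx : x ∈ kernelSubmodule v) :
    (fun i => Units.mk0 _ (Complex.exp_ne_zero (x i))) ∈ quotientGroup v := by
  intro μ
  refine Units.ext ?_
  simp only [Units.coe_prod, Units.val_zpow_eq_zpow_val, Units.val_mk0, Units.val_one,
    ← Complex.exp_int_mul, ← Complex.exp_sum, mem_kernelSubmodule.1 hx μ, Complex.exp_zero]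

/-- The group `G` is the image of its Lie algebra. -/
theorem exists_exp_eq (hS : IsCalabiYauFan S v) (hspan : ∀ u : N, ∃ a : Fin m → ℤ, ∑ i, a i • v i = u)
    {g : Fin m → ℂˣ} (hg : g ∈ quotientGroup v) :
    ∃ x ∈ kernelSubmodule v, ∀ i, Complex.exp (x i) = g i := by
  obtain ⟨τ, hτ, -⟩ := hS.exists_section hspan (J := ∅) (by
    rw [Set.image_empty]; exact hS.isSmoothFan.zero_mem)
  -- Principal logarithms of the `g i` satisfy the linear relations only up to multiples of `2πi`.
  -- Projecting them by the kernel exponents restores the relations and does not change the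
  -- exponentials.
  refine ⟨fun k => ∑ i, (kernelExponent v τ k i : ℂ) * Complex.log (g i), ?_, fun k => ?_⟩
  · intro μ
    simp only [Finset.mul_sum]
    rw [Finset.sum_comm]
    refine Finset.sum_eq_zero fun i _ => ?_
    have hsum : ∑ k, kernelExponent v τ k i * μ (v k) = 0 := by
      have h1 := congrArg μ (hτ (v i))
      simp only [map_sum, map_smul, smul_eq_mul] at h1
      simp only [kernelExponent, sub_mul, Finset.sum_sub_distrib, h1]
      simp [Pi.single_apply]
    have h2 : ∑ k, (kernelExponent v τ k i : ℂ) * (μ (v k) : ℂ) = 0 := by exact_mod_cast hsum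
    calc _ = (∑ k, (kernelExponent v τ k i : ℂ) * (μ (v k) : ℂ)) * Complex.log (g i) := by
          rw [Finset.sum_mul]
          exact Finset.sum_congr rfl fun k _ => by ring
      _ = 0 := by rw [h2, zero_mul]
  · have h1 := kernelMonomial_mul τ hg (fun _ => 1) k
    simp only [mul_one, kernelMonomial, one_zpow, Finset.prod_const_one] at h1
    rw [Complex.exp_sum, ← h1]
    exact Finset.prod_congr rfl fun i _ => by
      rw [Complex.exp_int_mul, Complex.exp_log (g i).ne_zero]

/-- The map `F'` is the product of `F` with the `G`-valued function `g`. -/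
def IsRatio (g : Fin m → C(Y, ℂ)) (F F' : C(Y, HomogeneousPoints S v)) : Prop :=
  ∀ y, ∃ γ ∈ quotientGroup v, ∀ i, g i y = γ i ∧ (F' y).1 i = γ i * (F y).1 i

theorem IsRatio.ne_zero {g : Fin m → C(Y, ℂ)} {F F' : C(Y, HomogeneousPoints S v)}
    (h : IsRatio g F F') (i : Fin m) (y : Y) : g i y ≠ 0 := by
  obtain ⟨γ, -, e⟩ := h y
  rw [(e i).1]
  exact (γ i).ne_zero

theorem IsRatio.coordMap_eq {g : Fin m → C(Y, ℂ)} {F F' : C(Y, HomogeneousPoints S v)}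
    (h : IsRatio g F F') (i : Fin m) : coordMap F' i = g i * coordMap F i := by
  ext y
  obtain ⟨γ, -, e⟩ := h y
  simp [(e i).1, (e i).2]

theorem IsRatio.mul {g h : Fin m → C(Y, ℂ)} {F F' F'' : C(Y, HomogeneousPoints S v)}
    (hg : IsRatio g F F') (hh : IsRatio h F' F'') : IsRatio (fun i => h i * g i) F F'' := by
  intro y
  obtain ⟨γ, hγ, e⟩ := hg y
  obtain ⟨δ, hδ, e'⟩ := hh y
  refine ⟨δ * γ, mul_mem hδ hγ, fun i => ?_⟩
  simp [(e i).1, (e' i).1, (e' i).2, (e i).2, mul_assoc]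

theorem IsRatio.comp {Z : Type*} [TopologicalSpace Z] {g : Fin m → C(Y, ℂ)}
    {F F' : C(Y, HomogeneousPoints S v)} (h : IsRatio g F F') (f : C(Z, Y)) :
    IsRatio (fun i => (g i).comp f) (F.comp f) (F'.comp f) := fun z => h (f z)

/-- Where a coordinate vanishes, the quotient of coordinates says nothing about `g`. The kernel
monomials adapted to that point do not vanish and are multiplied by the same factors. -/
theorem IsRatio.unique (hS : IsCalabiYauFan S v)
    (hspan : ∀ u : N, ∃ a : Fin m → ℤ, ∑ i, a i • v i = u) {g h : Fin m → C(Y, ℂ)}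
    {F F' : C(Y, HomogeneousPoints S v)} (hg : IsRatio g F F') (hh : IsRatio h F F') : g = h := by
  funext k
  ext y
  obtain ⟨τ, hτ, hτA⟩ := hS.exists_section hspan (F y).2
  have key {g : Fin m → C(Y, ℂ)} (hg : IsRatio g F F') :
      kernelMonomial v τ (F' y).1 k = g k y * kernelMonomial v τ (F y).1 k := by
    obtain ⟨γ, hγ, e⟩ := hg y
    have : (F' y).1 = fun i => γ i * (F y).1 i := funext fun i => (e i).2
    rw [this, kernelMonomial_mul τ hγ, (e k).1]
  exact mul_right_cancel₀ (kernelMonomial_ne_zero (z := (F y).1) hτA (fun i hi => hi) k)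
    ((key hg).symm.trans (key hh))

/-- Two lifts of the same map differ by a continuous function with values in `G`. -/
theorem exists_ratio (hS : IsCalabiYauFan S v)
    (hspan : ∀ u : N, ∃ a : Fin m → ℤ, ∑ i, a i • v i = u)
    (F F' : C(Y, HomogeneousPoints S v)) (h : ∀ y, toricMk (F y) = toricMk (F' y)) :
    ∃ g : Fin m → C(Y, ℂ), IsRatio g F F' := by
  choose γ hγ e using fun y => toricMk_eq_iff.1 (h y)
  have hc (k : Fin m) : Continuous fun y => (γ y k : ℂ) := by
    refine continuous_iff_continuousAt.2 fun y₀ => ?_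
    set A : Set (Fin m) := {i | (F y₀).1 i = 0}
    obtain ⟨τ, hτ, hτA⟩ := hS.exists_section hspan (F y₀).2
    have hF (y) (hy : F y ∈ affinePatch S v A) : F' y ∈ affinePatch S v A := fun i hi => by
      rw [e]
      exact mul_ne_zero (γ y i).ne_zero (hy i hi)
    have h0 : F y₀ ∈ affinePatch S v A := fun i hi => hi
    have hn : ∀ᶠ y in nhds y₀, F y ∈ affinePatch S v A :=
      F.continuous.continuousAt.eventually ((isOpen_affinePatch A).mem_nhds h0)
    -- Near `y₀` the ratio is the quotient of the kernel monomials of the two lifts, which gives its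
    -- continuity.
    have hρ (F : C(Y, HomogeneousPoints S v)) (h0 : F y₀ ∈ affinePatch S v A) :
        ContinuousAt (fun y => kernelMonomial v τ (F y).1 k) y₀ := by
      have h1 : ContinuousOn (fun z : HomogeneousPoints S v => kernelMonomial v τ z.1 k)
          (affinePatch S v A) :=
        (continuousOn_kernelMonomial hτA k).comp continuous_subtype_val.continuousOn fun z hz => hz
      exact ContinuousAt.comp (f := F) (h1.continuousAt ((isOpen_affinePatch A).mem_nhds h0))
        F.continuous.continuousAt
    refine ((hρ F' (hF _ h0)).div (hρ F h0) (kernelMonomial_ne_zero hτA h0 k)).congr ?_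
    filter_upwards [hn] with y hy
    have : (F' y).1 = fun i => γ y i * (F y).1 i := funext (e y)
    rw [Pi.div_apply, this, kernelMonomial_mul τ (hγ y),
      mul_div_cancel_right₀ _ (kernelMonomial_ne_zero hτA hy k)]
  exact ⟨fun k => ⟨fun y => γ y k, hc k⟩, fun y => ⟨γ y, hγ y, fun k => ⟨rfl, e y k⟩⟩⟩

/-- Multiplication of a map by exponentials. -/
def expMul (Λ : Fin m → C(Y, ℂ)) (F : C(Y, HomogeneousPoints S v)) :
    C(Y, HomogeneousPoints S v) where
  toFun y := unitsMul (fun i => Complex.exp (Λ i y)) (fun i => Complex.exp_ne_zero _) (F y)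
  continuous_toFun := by
    refine Continuous.subtype_mk (continuous_pi fun i => ?_) _
    exact (Complex.continuous_exp.comp (Λ i).continuous).mul (coordMap F i).continuous

@[simp]
theorem expMul_apply (Λ : Fin m → C(Y, ℂ)) (F : C(Y, HomogeneousPoints S v)) (y : Y) (i : Fin m) :
    (expMul Λ F y).1 i = Complex.exp (Λ i y) * (F y).1 i := rfl

theorem toricMk_expMul {Λ : Fin m → C(Y, ℂ)} {F : C(Y, HomogeneousPoints S v)} {y : Y}
    (h : (fun i => Λ i y) ∈ kernelSubmodule v) : toricMk (expMul Λ F y) = toricMk (F y) :=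
  (toricMk_eq_iff.2 ⟨_, exp_mem_quotientGroup h, fun _ => rfl⟩).symm

theorem exists_lift_of_value {Y : Type*} [PseudoMetricSpace Y] [CompactSpace Y] [ContractibleSpace Y]
    (hS : IsCalabiYauFan S v) (hspan : ∀ u : N, ∃ a : Fin m → ℤ, ∑ i, a i • v i = u)
    (f : C(Y, ToricManifold S v)) (y₀ : Y) (z : HomogeneousPoints S v) (hz : toricMk z = f y₀) :
    ∃ F : C(Y, HomogeneousPoints S v), (∀ y, toricMk (F y) = f y) ∧ F y₀ = z := by
  obtain ⟨F, hF⟩ := (hasLocalTransport_toricMk hS hspan).exists_lift toricMk_surjective f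
  obtain ⟨g, hg, e⟩ := toricMk_eq_iff.1 ((hF y₀).trans hz.symm)
  obtain ⟨x, hx, hxg⟩ := exists_exp_eq hS hspan hg
  refine ⟨expMul (fun i => ContinuousMap.const Y (x i)) F, fun y => ?_, ?_⟩
  · rw [toricMk_expMul (by exact hx), hF]
  · refine Subtype.ext (funext fun i => ?_)
    rw [expMul_apply, ContinuousMap.const_apply, hxg, e]

end Lifts

/-! ### The toric manifold is simply connected -/

section SimplyConnected

variable {N : Type*} [AddCommGroup N] {m : ℕ}
variable {S : Set (PointedCone ℝ (ℝ ⊗[ℤ] N))} {v : Fin m → N}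

/-- The zero cone and the rays through the `v i` are in the fan, so only points with two vanishing
coordinates can be missing from the homogeneous points. This is the codimension two condition. -/
theorem latticeCone_mem_of_subsingleton (hS : IsCalabiYauFan S v) {A : Set (Fin m)}
    (hA : A.Subsingleton) : latticeCone (v '' A) ∈ S := by
  rcases hA.eq_empty_or_singleton with rfl | ⟨i, rfl⟩
  · rw [Set.image_empty]; exact hS.isSmoothFan.zero_mem
  · rw [Set.image_singleton]
    have : v i ∈ Set.range v := ⟨i, rfl⟩
    rw [hS.range_eq] at this
    exact this.2

/-- A map of a cube of dimension at most two to the homogeneous points, with a constant boundary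
value all of whose coordinates are nonzero, is null-homotopic relative to the boundary. -/
theorem homotopicRel_const_homogeneousPoints (hS : IsCalabiYauFan S v) {k : ℕ} (hk : k ≤ 2)
    (f : C(Fin k → I, HomogeneousPoints S v)) (c : HomogeneousPoints S v) (hc : ∀ i, c.1 i ≠ 0)
    (hf : ∀ y ∈ Cube.boundary (Fin k), f y = c) :
    f.HomotopicRel (ContinuousMap.const _ c) (Cube.boundary (Fin k)) :=
  homotopicRel_const_of_codimension_two hk (isOpen_homogeneousPoints hS)
    (fun z hz => latticeCone_mem_of_subsingleton hS fun i hi j hj => by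
      by_contra hij
      exact hz i j hij hi hj) f c hc hf

/-- The vanishing coordinates are first moved off `0`, which only passes to faces of the cone of
`z`; then the logarithms are interpolated. -/
theorem joined_homogeneousPoints (hS : IsCalabiYauFan S v) (z w : HomogeneousPoints S v)
    (hw : ∀ i, w.1 i ≠ 0) : Joined z w := by
  classical
  let c (i : Fin m) : ℂ := if z.1 i = 0 then w.1 i else z.1 i
  have hc (i) : c i ≠ 0 := by
    by_cases h : z.1 i = 0 <;> simp [c, h, hw i]
  let c' : HomogeneousPoints S v := ⟨c, mem_of_forall_ne_zero hS hc⟩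
  have h1 : Joined z c' := by
    refine ⟨⟨⟨fun t => ⟨fun i => if z.1 i = 0 then (t : ℝ) * w.1 i else z.1 i, ?_⟩, ?_⟩, ?_, ?_⟩⟩
    · refine hS.latticeCone_mem_of_subset z.2 fun i hi => ?_
      by_contra h
      have hi' : (if z.1 i = 0 then ((t : ℝ) : ℂ) * w.1 i else z.1 i) = 0 := hi
      rw [if_neg (show ¬ z.1 i = 0 from h)] at hi'
      exact h hi'
    · refine Continuous.subtype_mk (continuous_pi fun i => ?_) _
      by_cases h : z.1 i = 0
      · simp only [h, if_true]; fun_prop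
      · simp only [h, if_false]; fun_prop
    · refine Subtype.ext (funext fun i => ?_)
      by_cases h : z.1 i = 0 <;> simp [h]
    · refine Subtype.ext (funext fun i => ?_)
      by_cases h : z.1 i = 0 <;> simp [h, c', c]
  refine h1.trans ⟨⟨⟨fun t => ⟨fun i => Complex.exp ((1 - (t : ℝ)) * Complex.log (c i) +
    (t : ℝ) * Complex.log (w.1 i)), mem_of_forall_ne_zero hS fun i => Complex.exp_ne_zero _⟩, ?_⟩,
    ?_, ?_⟩⟩
  · refine Continuous.subtype_mk (continuous_pi fun i => ?_) _
    fun_prop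
  · refine Subtype.ext (funext fun i => ?_)
    simp [Complex.exp_log (hc i), c']
  · refine Subtype.ext (funext fun i => ?_)
    simp [Complex.exp_log (hw i)]

theorem pathConnectedSpace_toricManifold (hS : IsCalabiYauFan S v) :
    PathConnectedSpace (ToricManifold S v) := by
  have h1 (x : ToricManifold S v) : Joined x (torusPoint hS fun _ => 1) := by
    obtain ⟨z, rfl⟩ := toricMk_surjective x
    obtain ⟨γ⟩ := joined_homogeneousPoints hS z ⟨fun i => ((1 : ℂˣ) : ℂ),
      mem_of_forall_ne_zero hS fun i => Units.ne_zero _⟩ (fun i => (1 : ℂˣ).ne_zero)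
    exact ⟨γ.map continuous_toricMk⟩
  exact ⟨⟨torusPoint hS fun _ => 1⟩, fun x y => (h1 x).trans (h1 y).symm⟩

/-- Loops at a point of the open dense orbit are null-homotopic. -/
theorem loop_homotopic_refl (hS : IsCalabiYauFan S v)
    (hspan : ∀ u : N, ∃ a : Fin m → ℤ, ∑ i, a i • v i = u)
    {x : ToricManifold S v} {z : HomogeneousPoints S v} (hz : ∀ i, z.1 i ≠ 0) (hx : toricMk z = x)
    (γ : Path x x) : γ.Homotopic (Path.refl x) := by
  obtain ⟨F, hF, hF0⟩ := exists_lift_of_value hS hspan γ.toContinuousMap 0 z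
    (hx.trans γ.source.symm)
  -- The lift of the loop need not close up. Multiplying by the path `exp (t u)` in `G` closes it
  -- without changing its projection.
  obtain ⟨g, hg, e⟩ := toricMk_eq_iff.1 (((hF 1).trans γ.target).trans hx.symm)
  obtain ⟨u, hu, hug⟩ := exists_exp_eq hS hspan hg
  let F' := expMul (fun i => ⟨fun t : I => (t : ℝ) * u i, by fun_prop⟩) F
  have hF' (t) : toricMk (F' t) = γ t := by
    rw [toricMk_expMul, hF]
    · rfl
    · exact (kernelSubmodule v).smul_mem (t : ℝ) hu
  have h0 : F' 0 = z := by
    refine Subtype.ext (funext fun i => ?_)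
    simp only [F', expMul_apply, hF0]
    simp
  have h1 : F' 1 = z := by
    refine Subtype.ext (funext fun i => ?_)
    simp only [F', expMul_apply, e, ← hug]
    simp
  obtain ⟨H⟩ := homotopicRel_const_homogeneousPoints hS (k := 1) (by norm_num)
    (F'.comp ⟨fun y => y 0, continuous_apply 0⟩) z hz (by
      rintro y ⟨j, hj⟩
      have : j = 0 := Subsingleton.elim _ _
      subst this
      rcases hj with hj | hj <;> simp [hj, h0, h1])
  have hb (s t : I) (ht : t = 0 ∨ t = 1) : H (s, fun _ => t) = z := by
    have hm : (fun _ => t : Fin 1 → I) ∈ Cube.boundary (Fin 1) := ⟨0, ht⟩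
    have := H.eq_fst s hm
    rw [this]
    rcases ht with ht | ht <;> simp [ht, h0, h1]
  have hcont : Continuous fun q : I × I => toricMk (H (q.1, fun _ => q.2)) :=
    continuous_toricMk.comp (H.continuous.comp (by fun_prop))
  refine ⟨{ toFun := fun q => toricMk (H (q.1, fun _ => q.2)), continuous_toFun := hcont,
            map_zero_left := fun t => ?_, map_one_left := fun t => ?_, prop' := fun s t ht => ?_ }⟩
  · simpa using hF' t
  · simpa using hx
  · have ht' : t = 0 ∨ t = 1 := by simpa using ht
    change toricMk (H (s, fun _ => t)) = γ t
    rw [hb s t ht', hx]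
    rcases ht' with rfl | rfl
    · exact γ.source.symm
    · exact γ.target.symm

theorem simplyConnectedSpace_toricManifold (hS : IsCalabiYauFan S v)
    (hspan : ∀ u : N, ∃ a : Fin m → ℤ, ∑ i, a i • v i = u) :
    SimplyConnectedSpace (ToricManifold S v) := by
  have := pathConnectedSpace_toricManifold hS
  refine simply_connected_iff_loops_nullhomotopic.2 ⟨this, fun x γ => ?_⟩
  let a := torusPoint hS fun _ => 1
  have : Subsingleton (FundamentalGroup (ToricManifold S v) a) := by
    refine ⟨fun p q => ?_⟩
    have h (p : FundamentalGroup (ToricManifold S v) a) :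
        p = FundamentalGroup.fromPath (Path.Homotopic.Quotient.mk (Path.refl a)) := by
      obtain ⟨γ, hγ⟩ := Quotient.exists_rep (FundamentalGroup.toPath p)
      rw [show p = FundamentalGroup.fromPath (FundamentalGroup.toPath p) from rfl, ← hγ]
      exact Quotient.sound (loop_homotopic_refl hS hspan (fun i => (1 : ℂˣ).ne_zero) rfl γ)
    rw [h p, h q]
  have hx : Subsingleton (FundamentalGroup (ToricManifold S v) x) :=
    (FundamentalGroup.fundamentalGroupMulEquivOfPathConnected a x).symm.toEquiv.subsingleton
  exact Path.Homotopic.Quotient.exact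
    (hx.elim (FundamentalGroup.fromPath (.mk γ)) (FundamentalGroup.fromPath (.mk (Path.refl x))))

end SimplyConnected

/-! ### Relative homotopy classes as classes of squares -/

section Squares

variable {X : Type*} [TopologicalSpace X]

/-- The maps of the square which represent elements of the relative homotopy group. -/
structure IsRelSquare (A : Set X) (a : A) (F : C(I × I, X)) : Prop where
  left : ∀ t, F (0, t) = a
  right : ∀ t, F (1, t) = a
  bottom : ∀ s, F (s, 0) = a
  top : ∀ s, F (s, 1) ∈ A

variable {A : Set X} {a : A}

/-- The class of a map of the square. -/
def IsRelSquare.toClass {F : C(I × I, X)} (h : IsRelSquare A a F) : RelPi2 A a :=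
  squareClass F h.left h.right h.bottom h.top

/-- The loop of paths given by a map of the square. -/
def IsRelSquare.toPath {F : C(I × I, X)} (h : IsRelSquare A a F) :
    Path (RelPathSpace.base A a) (RelPathSpace.base A a) where
  toFun s := ⟨F.curry s, h.bottom s, h.top s⟩
  continuous_toFun := F.curry.continuous.subtype_mk _
  source' := Subtype.ext (ContinuousMap.ext h.left)
  target' := Subtype.ext (ContinuousMap.ext h.right)

theorem IsRelSquare.toClass_eq_mk {F : C(I × I, X)} (h : IsRelSquare A a F) :
    h.toClass = Additive.ofMul (FundamentalGroup.fromPath (Path.Homotopic.Quotient.mk h.toPath)) :=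
  rfl

theorem continuous_relPathSpace_eval :
    Continuous fun q : RelPathSpace A a × I => q.1.1 q.2 := by
  have h : Continuous fun γ : RelPathSpace A a => γ.1 := continuous_subtype_val
  exact (h.comp continuous_fst).eval continuous_snd

theorem exists_isRelSquare (x : RelPi2 A a) :
    ∃ (F : C(I × I, X)) (h : IsRelSquare A a F), h.toClass = x := by
  obtain ⟨γ, hγ⟩ := Quotient.exists_rep (FundamentalGroup.toPath x.toMul)
  let F : C(I × I, X) := ⟨fun p => (γ p.1).1 p.2,
    continuous_relPathSpace_eval.comp ((γ.continuous.comp continuous_fst).prodMk continuous_snd)⟩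
  have hF : IsRelSquare A a F :=
    ⟨fun t => congrArg (fun g : RelPathSpace A a => g.1 t) γ.source,
      fun t => congrArg (fun g : RelPathSpace A a => g.1 t) γ.target, fun s => (γ s).2.1, fun s => (γ s).2.2⟩
  refine ⟨F, hF, ?_⟩
  have h1 : hF.toPath = γ := Path.ext (funext fun s => Subtype.ext (ContinuousMap.ext fun t => rfl))
  rw [hF.toClass_eq_mk, h1]
  exact congrArg Additive.ofMul hγ

theorem toClass_eq_of_homotopy (H : C(I × (I × I), X)) (h : ∀ r, IsRelSquare A a (H.curry r)) :
    (h 0).toClass = (h 1).toClass := by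
  refine congrArg Additive.ofMul (Quotient.sound ⟨?_⟩)
  let K : C(I × I, C(I, X)) :=
    (H.comp ⟨fun q : (I × I) × I => (q.1.1, (q.1.2, q.2)), by fun_prop⟩).curry
  exact
    { toFun := fun q => ⟨K q, (h q.1).bottom q.2, (h q.1).top q.2⟩
      continuous_toFun := K.continuous.subtype_mk _
      map_zero_left := fun s => rfl
      map_one_left := fun s => rfl
      prop' := by
        rintro r s (rfl | rfl)
        · exact Subtype.ext (ContinuousMap.ext fun t => ((h r).left t).trans ((h 0).left t).symm)
        · exact Subtype.ext (ContinuousMap.ext fun t => ((h r).right t).trans ((h 0).right t).symm) }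

theorem exists_homotopy_of_toClass_eq {F F' : C(I × I, X)} (h : IsRelSquare A a F)
    (h' : IsRelSquare A a F') (e : h.toClass = h'.toClass) :
    ∃ H : C(I × (I × I), X), (∀ r, IsRelSquare A a (H.curry r)) ∧ H.curry 0 = F ∧
      H.curry 1 = F' := by
  obtain ⟨K⟩ : h.toPath.Homotopic h'.toPath :=
    Path.Homotopic.Quotient.exact (congrArg (fun x : RelPi2 A a => x.toMul) e)
  refine ⟨⟨fun q => (K (q.1, q.2.1)).1 q.2.2, continuous_relPathSpace_eval.comp
    ((K.continuous.comp (by fun_prop)).prodMk (by fun_prop))⟩, fun r => ⟨fun t => ?_, fun t => ?_,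
      fun s => (K (r, s)).2.1, fun s => (K (r, s)).2.2⟩, ?_, ?_⟩
  · change (K (r, 0)).1 t = a
    rw [K.source]
    rfl
  · change (K (r, 1)).1 t = a
    rw [K.target]
    rfl
  · ext ⟨s, t⟩
    change (K (0, s)).1 t = F (s, t)
    rw [K.apply_zero]
    rfl
  · ext ⟨s, t⟩
    change (K (1, s)).1 t = F' (s, t)
    rw [K.apply_one]
    rfl

/-- The left half of the square. -/
def leftHalf : C(I × I, I × I) :=
  ⟨fun p => (⟨(p.1 : ℝ) / 2, by constructor <;> linarith [p.1.2.1, p.1.2.2]⟩, p.2), by fun_prop⟩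

/-- The right half of the square. -/
def rightHalf : C(I × I, I × I) :=
  ⟨fun p => (⟨(1 + (p.1 : ℝ)) / 2, by constructor <;> linarith [p.1.2.1, p.1.2.2]⟩, p.2),
    by fun_prop⟩

theorem eq_leftHalf_or_rightHalf (p : I × I) :
    ((p.1 : ℝ) ≤ 1 / 2 ∧ ∃ q, p = leftHalf q) ∨ (1 / 2 < (p.1 : ℝ) ∧ ∃ q, p = rightHalf q) := by
  rcases le_or_gt (p.1 : ℝ) (1 / 2) with h | h
  · refine Or.inl ⟨h, (⟨2 * p.1, by constructor <;> linarith [p.1.2.1]⟩, p.2), ?_⟩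
    ext <;> simp [leftHalf]
  · refine Or.inr ⟨h, (⟨2 * p.1 - 1, by constructor <;> linarith [p.1.2.2]⟩, p.2), ?_⟩
    ext <;> simp [rightHalf]

theorem isRelSquare_of_halves {G : C(I × I, X)} (hl : IsRelSquare A a (G.comp leftHalf))
    (hr : IsRelSquare A a (G.comp rightHalf)) : IsRelSquare A a G := by
  refine ⟨fun t => ?_, fun t => ?_, fun s => ?_, fun s => ?_⟩
  · rw [← hl.left t]
    exact congrArg G (by ext <;> simp [leftHalf])
  · rw [← hr.right t]
    exact congrArg G (by ext <;> simp [rightHalf])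
  · rcases eq_leftHalf_or_rightHalf (s, 0) with ⟨-, q, hq⟩ | ⟨-, q, hq⟩
    · rw [hq, ← hl.bottom q.1]
      exact congrArg (G.comp leftHalf) (Prod.ext rfl (congrArg Prod.snd hq).symm)
    · rw [hq, ← hr.bottom q.1]
      exact congrArg (G.comp rightHalf) (Prod.ext rfl (congrArg Prod.snd hq).symm)
  · rcases eq_leftHalf_or_rightHalf (s, 1) with ⟨-, q, hq⟩ | ⟨-, q, hq⟩
    · rw [hq]
      have h1 : q = (q.1, 1) := Prod.ext rfl (congrArg Prod.snd hq).symm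
      rw [h1]
      exact hl.top q.1
    · rw [hq]
      have h1 : q = (q.1, 1) := Prod.ext rfl (congrArg Prod.snd hq).symm
      rw [h1]
      exact hr.top q.1

/-- The multiplication of `FundamentalGroup` puts the loop traversed first on the right. -/
theorem toClass_eq_add {G : C(I × I, X)} (hG : IsRelSquare A a G)
    (hl : IsRelSquare A a (G.comp leftHalf)) (hr : IsRelSquare A a (G.comp rightHalf)) :
    hG.toClass = hr.toClass + hl.toClass := by
  have h1 : hG.toPath = hl.toPath.trans hr.toPath := by
    refine Path.ext (funext fun s => ?_)
    rw [Path.trans_apply]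
    split_ifs with h
    · refine Subtype.ext (ContinuousMap.ext fun t => ?_)
      exact congrArg G (by ext <;> simp [leftHalf])
    · refine Subtype.ext (ContinuousMap.ext fun t => ?_)
      exact congrArg G (by ext <;> simp [rightHalf])
  rw [hG.toClass_eq_mk, h1, Path.Homotopic.Quotient.mk_trans]
  rfl

/-- Horizontal concatenation of families of maps of the square. -/
theorem exists_concat {P : Type*} [TopologicalSpace P] (H H' : C(P × (I × I), X))
    (h : ∀ p t, H (p, (1, t)) = H' (p, (0, t))) :
    ∃ G : C(P × (I × I), X), ∀ p, (G.curry p).comp leftHalf = H.curry p ∧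
      (G.curry p).comp rightHalf = H'.curry p := by
  let φ : C(I, I) := ⟨fun s => Set.projIcc 0 1 zero_le_one (2 * (s : ℝ)), by fun_prop⟩
  let ψ : C(I, I) := ⟨fun s => Set.projIcc 0 1 zero_le_one (2 * (s : ℝ) - 1), by fun_prop⟩
  let G (q : P × (I × I)) : X :=
    if (q.2.1 : ℝ) ≤ 1 / 2 then H (q.1, (φ q.2.1, q.2.2)) else H' (q.1, (ψ q.2.1, q.2.2))
  have hG : Continuous G := by
    refine Continuous.if_le (by fun_prop) (by fun_prop) (by fun_prop) continuous_const ?_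
    rintro ⟨p, s, t⟩ hs
    have h1 : φ s = 1 := Set.projIcc_of_right_le zero_le_one (by simp at hs; linarith)
    have h0 : ψ s = 0 := Set.projIcc_of_le_left zero_le_one (by simp at hs; linarith)
    simp only [h1, h0, h]
  refine ⟨⟨G, hG⟩, fun p => ⟨?_, ?_⟩⟩
  · ext ⟨s, t⟩
    have hs : (s : ℝ) / 2 ≤ 1 / 2 := by linarith [s.2.2]
    change (if (s : ℝ) / 2 ≤ 1 / 2 then _ else _) = _
    rw [if_pos hs]
    have h1 : φ (leftHalf (s, t)).1 = s := by
      simp only [φ, leftHalf, ContinuousMap.coe_mk]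
      rw [mul_div_cancel₀ _ two_ne_zero]
      exact Set.projIcc_val _ _
    exact congrArg (fun s => H (p, (s, t))) h1
  · ext ⟨s, t⟩
    change (if (1 + (s : ℝ)) / 2 ≤ 1 / 2 then _ else _) = _
    have h1 : ψ (rightHalf (s, t)).1 = s := by
      simp only [ψ, rightHalf, ContinuousMap.coe_mk]
      rw [mul_div_cancel₀ _ two_ne_zero, add_sub_cancel_left]
      exact Set.projIcc_val _ _
    split_ifs with hs
    · have h0 : s = 0 := Subtype.ext (le_antisymm (by simpa using (by linarith : (s : ℝ) ≤ 0)) s.2.1)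
      have h2 : φ (rightHalf (s, t)).1 = 1 := by
        refine Set.projIcc_of_right_le zero_le_one ?_
        simp [rightHalf, h0]
      change H (p, (φ (rightHalf (s, t)).1, t)) = H' (p, (s, t))
      rw [h2, h, h0]
    · exact congrArg (fun s => H' (p, (s, t))) h1

theorem toClass_congr {F F' : C(I × I, X)} (h : IsRelSquare A a F) (e : F = F') :
    h.toClass = (e ▸ h : IsRelSquare A a F').toClass := by
  subst e
  rfl

/-- The identification of the square with the cube of dimension two. -/
def squareToCube : C(I × I, Fin 2 → I) :=
  ⟨fun p => ![p.1, p.2], by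
    refine continuous_pi fun i => ?_
    fin_cases i
    · exact continuous_fst
    · exact continuous_snd⟩

theorem isRelSquare_sphere (f : Ω^ (Fin 2) X (a : X)) :
    IsRelSquare A a ((f : C(Fin 2 → I, X)).comp squareToCube) :=
  ⟨fun _ => GenLoop.boundary f _ ⟨0, Or.inl rfl⟩, fun _ => GenLoop.boundary f _ ⟨0, Or.inr rfl⟩,
    fun _ => GenLoop.boundary f _ ⟨1, Or.inl rfl⟩, fun s => by
      have h : f ![s, 1] = a := GenLoop.boundary f _ ⟨1, Or.inr rfl⟩
      exact (congrArg (· ∈ A) h).mpr a.2⟩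

theorem sphereClass_eq_toClass (f : Ω^ (Fin 2) X (a : X)) :
    sphereClass A a f = (isRelSquare_sphere f).toClass := rfl

theorem BasedDisk.isRelSquare (u : BasedDisk A a) : IsRelSquare A a (u.toMap.comp chordMap) :=
  ⟨fun t => by simp [chordMap_eq_one (p := (0, t)) (Or.inl rfl), u.map_one],
    fun t => by simp [chordMap_eq_one (p := (1, t)) (Or.inr (Or.inl rfl)), u.map_one],
    fun s => by simp [chordMap_eq_one (p := (s, 0)) (Or.inr (Or.inr rfl)), u.map_one],
    fun s => u.map_boundary _ (norm_chordMap s)⟩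

theorem BasedDisk.toClass_eq_toClass (u : BasedDisk A a) : u.toClass = u.isRelSquare.toClass := rfl

end Squares

/-! ### The winding cocycle on singular simplices -/

section Cocycle

open Simplicial

/-- The `k`-th edge of the 2-simplex. -/
def triangleEdge (k : Fin 3) : C(I, stdSimplex ℝ (Fin 3)) :=
  (⟨stdSimplex.map k.succAbove, stdSimplex.continuous_map _⟩ :
    C(stdSimplex ℝ (Fin 2), stdSimplex ℝ (Fin 3))).comp edgePoint

theorem triangleEdge_coe (k : Fin 3) (t : I) :
    (triangleEdge k t).1 = k.insertNth 0 ![1 - (t : ℝ), (t : ℝ)] := face_edgePoint k t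

theorem triangleEdge_zero_zero : triangleEdge 0 0 = triangleEdge 2 1 := by
  refine Subtype.ext (funext fun i => ?_)
  rw [triangleEdge_coe, triangleEdge_coe]
  fin_cases i <;> simp [Fin.insertNth, Fin.succAboveCases]

theorem triangleEdge_zero_one : triangleEdge 0 1 = triangleEdge 1 1 := by
  refine Subtype.ext (funext fun i => ?_)
  rw [triangleEdge_coe, triangleEdge_coe]
  fin_cases i <;> simp [Fin.insertNth, Fin.succAboveCases]

theorem triangleEdge_one_zero : triangleEdge 1 0 = triangleEdge 2 0 := by
  refine Subtype.ext (funext fun i => ?_)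
  rw [triangleEdge_coe, triangleEdge_coe]
  fin_cases i <;> simp [Fin.insertNth, Fin.succAboveCases]

/-- The `j`-th face of the 3-simplex. -/
def tetrahedronFace (j : Fin 4) : C(stdSimplex ℝ (Fin 3), stdSimplex ℝ (Fin 4)) :=
  ⟨stdSimplex.map j.succAbove, stdSimplex.continuous_map _⟩

theorem tetrahedronFace_comp_triangleEdge {j j' : Fin 4} {k k' : Fin 3}
    (h : j.succAbove ∘ k.succAbove = j'.succAbove ∘ k'.succAbove) :
    (tetrahedronFace j).comp (triangleEdge k) = (tetrahedronFace j').comp (triangleEdge k') := by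
  ext1 t
  have e (j : Fin 4) (k : Fin 3) : (tetrahedronFace j).comp (triangleEdge k) t =
      stdSimplex.map (j.succAbove ∘ k.succAbove) (edgePoint t) := stdSimplex.map_comp_apply _ _ _
  rw [e, e, h]

variable {N : Type*} [AddCommGroup N] {m : ℕ}
variable {S : Set (PointedCone ℝ (ℝ ⊗[ℤ] N))} {v : Fin m → N}
variable (hS : IsCalabiYauFan S v) (hspan : ∀ u : N, ∃ a : Fin m → ℤ, ∑ i, a i • v i = u)

/-- The projection to the toric manifold as a continuous map. -/
def toricProj : C(HomogeneousPoints S v, ToricManifold S v) := ⟨toricMk, continuous_toricMk⟩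

theorem exists_lift_toric (hS : IsCalabiYauFan S v)
    (hspan : ∀ u : N, ∃ a : Fin m → ℤ, ∑ i, a i • v i = u)
    {Y : Type*} [PseudoMetricSpace Y] [CompactSpace Y] [ContractibleSpace Y]
    (f : C(Y, ToricManifold S v)) : ∃ F : C(Y, HomogeneousPoints S v), toricProj.comp F = f := by
  obtain ⟨F, hF⟩ := (hasLocalTransport_toricMk hS hspan).exists_lift toricMk_surjective f
  exact ⟨F, ContinuousMap.ext hF⟩

/-- A chosen lift. -/
def toricLift {Y : Type*} [PseudoMetricSpace Y] [CompactSpace Y] [ContractibleSpace Y]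
    (f : C(Y, ToricManifold S v)) : C(Y, HomogeneousPoints S v) :=
  (exists_lift_toric hS hspan f).choose

theorem toricProj_comp_toricLift {Y : Type*} [PseudoMetricSpace Y] [CompactSpace Y]
    [ContractibleSpace Y] (f : C(Y, ToricManifold S v)) :
    toricProj.comp (toricLift hS hspan f) = f := (exists_lift_toric hS hspan f).choose_spec

theorem exists_isRatio (hS : IsCalabiYauFan S v)
    (hspan : ∀ u : N, ∃ a : Fin m → ℤ, ∑ i, a i • v i = u)
    {Y : Type*} [TopologicalSpace Y] {F F' : C(Y, HomogeneousPoints S v)}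
    (h : toricProj.comp F = toricProj.comp F') : ∃ g, IsRatio g F F' :=
  exists_ratio hS hspan F F' fun y => DFunLike.congr_fun h y

/-- The logarithmic discrepancy between a path and the chosen lift of its projection. -/
def discrepancy (e : C(I, HomogeneousPoints S v)) (i : Fin m) : ℂ :=
  logDiff ((exists_isRatio hS hspan
    (toricProj_comp_toricLift hS hspan (toricProj.comp e))).choose i) 0 1

theorem discrepancy_eq (e : C(I, HomogeneousPoints S v)) {g : Fin m → C(I, ℂ)}
    (hg : IsRatio g (toricLift hS hspan (toricProj.comp e)) e) (i : Fin m) :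
    discrepancy hS hspan e i = logDiff (g i) 0 1 := by
  rw [discrepancy, IsRatio.unique hS hspan (exists_isRatio hS hspan
    (toricProj_comp_toricLift hS hspan (toricProj.comp e))).choose_spec hg]

theorem discrepancy_of_isRatio {e e' : C(I, HomogeneousPoints S v)} {g : Fin m → C(I, ℂ)}
    (hg : IsRatio g e e') (he : toricProj.comp e = toricProj.comp e') (i : Fin m) :
    discrepancy hS hspan e' i = discrepancy hS hspan e i + logDiff (g i) 0 1 := by
  obtain ⟨k, hk⟩ := exists_isRatio hS hspan
    (toricProj_comp_toricLift hS hspan (toricProj.comp e))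
  rw [discrepancy_eq hS hspan e hk, discrepancy_eq hS hspan e' (g := fun i => g i * k i)
    (he ▸ hk.mul hg), logDiff_mul (hg.ne_zero i) (hk.ne_zero i), add_comm]

/-- The alternating sum of the discrepancies of the edges of a lifted triangle. -/
def triangleDiscrepancy (L : C(stdSimplex ℝ (Fin 3), HomogeneousPoints S v)) (i : Fin m) : ℂ :=
  discrepancy hS hspan (L.comp (triangleEdge 0)) i - discrepancy hS hspan (L.comp (triangleEdge 1)) i
    + discrepancy hS hspan (L.comp (triangleEdge 2)) i

/-- Changing the lift by a `G`-valued function on the triangle alters each edge term by an increment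
of its logarithm, and the increments around the triangle cancel. -/
theorem triangleDiscrepancy_congr {L L' : C(stdSimplex ℝ (Fin 3), HomogeneousPoints S v)}
    (h : toricProj.comp L = toricProj.comp L') :
    triangleDiscrepancy hS hspan L = triangleDiscrepancy hS hspan L' := by
  obtain ⟨g, hg⟩ := exists_isRatio hS hspan h
  funext i
  have key (k : Fin 3) : discrepancy hS hspan (L'.comp (triangleEdge k)) i =
      discrepancy hS hspan (L.comp (triangleEdge k)) i +
        logDiff (g i) (triangleEdge k 0) (triangleEdge k 1) := by
    rw [discrepancy_of_isRatio hS hspan (hg.comp (triangleEdge k))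
      (congrArg (fun f => f.comp (triangleEdge k)) h), logDiff_comp (hg.ne_zero i)]
  have h1 := logDiff_add (hg.ne_zero i) (triangleEdge 2 0) (triangleEdge 2 1) (triangleEdge 1 1)
  simp only [triangleDiscrepancy, key, triangleEdge_zero_zero, triangleEdge_zero_one,
    triangleEdge_one_zero]
  linear_combination -h1

/-- The value of the cocycle on a singular 2-simplex. -/
def toricCocycle (x : (Sing (ToricManifold S v)) _⦋2⦌) : Fin m → ℂ :=
  triangleDiscrepancy hS hspan (toricLift hS hspan (simplexMap x))

theorem toricCocycle_eq {x : (Sing (ToricManifold S v)) _⦋2⦌}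
    {L : C(stdSimplex ℝ (Fin 3), HomogeneousPoints S v)} (hL : toricProj.comp L = simplexMap x) :
    toricCocycle hS hspan x = triangleDiscrepancy hS hspan L :=
  triangleDiscrepancy_congr hS hspan ((toricProj_comp_toricLift hS hspan _).trans hL.symm)

/-- Faces of a lift of `y` are lifts of its faces, so each edge of the tetrahedron appears twice,
with opposite signs. -/
theorem toricCocycle_boundary (y : (Sing (ToricManifold S v)) _⦋3⦌) :
    toricCocycle hS hspan ((Sing _).δ 0 y) - toricCocycle hS hspan ((Sing _).δ 1 y) +
      toricCocycle hS hspan ((Sing _).δ 2 y) - toricCocycle hS hspan ((Sing _).δ 3 y) = 0 := by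
  have hL := toricProj_comp_toricLift hS hspan (simplexMap y)
  set L := toricLift hS hspan (simplexMap y)
  have key (j : Fin 4) : toricCocycle hS hspan ((Sing _).δ j y) =
      triangleDiscrepancy hS hspan (L.comp (tetrahedronFace j)) := by
    refine toricCocycle_eq hS hspan (ContinuousMap.ext fun z => ?_)
    rw [simplexMap_δ, ← hL]
    rfl
  have e (j j' : Fin 4) (k k' : Fin 3)
      (h : j.succAbove ∘ k.succAbove = j'.succAbove ∘ k'.succAbove) :
      discrepancy hS hspan ((L.comp (tetrahedronFace j)).comp (triangleEdge k)) =
        discrepancy hS hspan ((L.comp (tetrahedronFace j')).comp (triangleEdge k')) := by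
    rw [ContinuousMap.comp_assoc, ContinuousMap.comp_assoc, tetrahedronFace_comp_triangleEdge h]
  rw [key, key, key, key]
  funext i
  simp only [triangleDiscrepancy, Pi.sub_apply, Pi.add_apply, Pi.zero_apply]
  rw [e 1 0 0 0 (by decide), e 2 0 0 1 (by decide), e 3 0 0 2 (by decide), e 2 1 1 1 (by decide),
    e 3 1 1 2 (by decide), e 3 2 2 2 (by decide)]
  ring

/-- The affine paths along the sides of the square. -/
def sideBottom : C(I, I × I) := ⟨fun s => (s, 0), by fun_prop⟩

/-- The affine paths along the sides of the square. -/
def sideTop : C(I, I × I) := ⟨fun s => (s, 1), by fun_prop⟩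

/-- The affine paths along the sides of the square. -/
def sideLeft : C(I, I × I) := ⟨fun t => (0, t), by fun_prop⟩

/-- The affine paths along the sides of the square. -/
def sideRight : C(I, I × I) := ⟨fun t => (1, t), by fun_prop⟩

/-- The logarithmic increment of a map of the square along the boundary, traversed along the left
and the top side first. -/
def boundaryLog (L : C(I × I, HomogeneousPoints S v)) (i : Fin m) : ℂ :=
  logDiff (coordMap (L.comp sideLeft) i) 0 1 + logDiff (coordMap (L.comp sideTop) i) 0 1
    - logDiff (coordMap (L.comp sideBottom) i) 0 1 - logDiff (coordMap (L.comp sideRight) i) 0 1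

/-- The second term on the right depends only on the projected path `f`. All sides of a sphere
project to the same constant path, so these terms drop out of `boundaryLog`. -/
theorem logDiff_coordMap_eq_discrepancy {e : C(I, HomogeneousPoints S v)}
    {f : C(I, ToricManifold S v)} (he : toricProj.comp e = f)
    (hf : ∀ t i, (toricLift hS hspan f t).1 i ≠ 0) (i : Fin m) :
    logDiff (coordMap e i) 0 1 =
      discrepancy hS hspan e i + logDiff (coordMap (toricLift hS hspan f) i) 0 1 := by
  subst he
  obtain ⟨g, hg⟩ := exists_isRatio hS hspan
    (toricProj_comp_toricLift hS hspan (toricProj.comp e))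
  rw [discrepancy_eq hS hspan e hg, hg.coordMap_eq, logDiff_mul (hg.ne_zero i)]
  exact fun t => hf t i

/-- The homomorphism on the second homology which is given on spheres by the logarithmic increment
along the boundary of a lift of the sphere to a square. -/
theorem exists_homology_hom (hS : IsCalabiYauFan S v)
    (hspan : ∀ u : N, ∃ a : Fin m → ℤ, ∑ i, a i • v i = u) :
    ∃ Ψ : H2 (ToricManifold S v) →+ (Fin m → ℂ),
    ∀ (z : HomogeneousPoints S v) (x : ToricManifold S v) (f : Ω^ (Fin 2) (ToricManifold S v) x)
      (L : C(I × I, HomogeneousPoints S v)), (∀ i, z.1 i ≠ 0) → toricMk z = x →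
      toricProj.comp L = (f : C(Fin 2 → I, ToricManifold S v)).comp squareToCube →
      Ψ (hurewicz f) = boundaryLog L := by
  obtain ⟨Φ, hΦ⟩ := exists_cocycle_hom (toricCocycle hS hspan) (toricCocycle_boundary hS hspan)
  -- The sign is a matter of orientation: lower minus upper triangle runs along bottom and right
  -- first, `boundaryLog` along left and top.
  refine ⟨-(Φ.comp ((SingChain (ToricManifold S v)).homologyι 2).hom.toAddMonoidHom),
    fun z x f L hz hx hL => ?_⟩
  have h1 : Φ (((SingChain (ToricManifold S v)).homologyι 2).hom (hurewicz f)) =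
      toricCocycle hS hspan (ofSimplexMap ((f : C(Fin 2 → I, _)).comp lowerTriangle)) -
        toricCocycle hS hspan (ofSimplexMap ((f : C(Fin 2 → I, _)).comp upperTriangle)) := by
    rw [homologyι_hurewicz, map_sub, hΦ, hΦ]
    rfl
  change -(Φ (((SingChain (ToricManifold S v)).homologyι 2).hom (hurewicz f))) = _
  let cubeToSquare : C(Fin 2 → I, I × I) := ⟨fun y => (y 0, y 1), by fun_prop⟩
  have hL' (T : C(stdSimplex ℝ (Fin 3), Fin 2 → I)) :
      toricProj.comp (L.comp (cubeToSquare.comp T)) =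
        simplexMap (ofSimplexMap ((f : C(Fin 2 → I, ToricManifold S v)).comp T)) := by
    rw [simplexMap_ofSimplexMap, ← ContinuousMap.comp_assoc, hL]
    ext1 y
    change f _ = f _
    congr 1
    ext j
    fin_cases j <;> rfl
  rw [h1, toricCocycle_eq hS hspan (hL' lowerTriangle), toricCocycle_eq hS hspan (hL' upperTriangle)]
  have hl0 : (cubeToSquare.comp lowerTriangle).comp (triangleEdge 0) = sideRight := by
    ext t <;> simp [cubeToSquare, lowerTriangle, sideRight, triangleEdge_coe, Fin.insertNth,
      Fin.succAboveCases]
  have hl2 : (cubeToSquare.comp lowerTriangle).comp (triangleEdge 2) = sideBottom := by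
    ext t <;> simp [cubeToSquare, lowerTriangle, sideBottom, triangleEdge_coe, Fin.insertNth,
      Fin.succAboveCases]
  have hu0 : (cubeToSquare.comp upperTriangle).comp (triangleEdge 0) = sideTop := by
    ext t <;> simp [cubeToSquare, upperTriangle, sideTop, triangleEdge_coe, Fin.insertNth,
      Fin.succAboveCases]
  have hu2 : (cubeToSquare.comp upperTriangle).comp (triangleEdge 2) = sideLeft := by
    ext t <;> simp [cubeToSquare, upperTriangle, sideLeft, triangleEdge_coe, Fin.insertNth,
      Fin.succAboveCases]
  have h01 : (cubeToSquare.comp lowerTriangle).comp (triangleEdge 1) =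
      (cubeToSquare.comp upperTriangle).comp (triangleEdge 1) := by
    ext t <;> simp [cubeToSquare, upperTriangle, lowerTriangle, triangleEdge_coe, Fin.insertNth,
      Fin.succAboveCases]
  have hnz (t : I) (i : Fin m) : (toricLift hS hspan (ContinuousMap.const I x) t).1 i ≠ 0 := by
    have h2 : toricMk (toricLift hS hspan (ContinuousMap.const I x) t) = x :=
      DFunLike.congr_fun (toricProj_comp_toricLift hS hspan (ContinuousMap.const I x)) t
    obtain ⟨γ, -, e⟩ := toricMk_eq_iff.1 (hx.trans h2.symm)
    rw [e]
    exact mul_ne_zero (γ i).ne_zero (hz i)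
  have hside (s : C(I, I × I)) (hs : ∀ t, squareToCube (s t) ∈ Cube.boundary (Fin 2)) (i : Fin m) :=
    logDiff_coordMap_eq_discrepancy hS hspan (e := L.comp s) (f := ContinuousMap.const I x)
      (ContinuousMap.ext fun t => (DFunLike.congr_fun hL (s t)).trans
        (GenLoop.boundary f _ (hs t))) hnz i
  funext i
  simp only [triangleDiscrepancy, boundaryLog, Pi.neg_apply, Pi.sub_apply, ContinuousMap.comp_assoc]
  simp only [← ContinuousMap.comp_assoc cubeToSquare, hl0, hl2, hu0, hu2, h01]
  rw [hside sideLeft (fun t => ⟨0, Or.inl rfl⟩), hside sideTop (fun t => ⟨1, Or.inr rfl⟩),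
    hside sideBottom (fun t => ⟨1, Or.inl rfl⟩), hside sideRight (fun t => ⟨0, Or.inr rfl⟩)]
  ring

end Cocycle

/-! ### Transport of relative classes by collars -/

section Transport

variable {X : Type*} [TopologicalSpace X]

/-- Continuous transport between the members of a family of pointed subspaces. -/
structure FamilyTransport (A : I → Set X) (a : ∀ r, A r) where
  /-- the transport map -/
  toFun : I × I × X → X
  continuousOn : ContinuousOn toFun {p | p.2.2 ∈ A p.1}
  mem : ∀ {r q x}, x ∈ A r → toFun (r, q, x) ∈ A q
  self : ∀ {r x}, x ∈ A r → toFun (r, r, x) = x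
  base : ∀ r q, toFun (r, q, a r) = a q

variable {A : I → Set X} {a : ∀ r, A r} (T : FamilyTransport A a)

-- Pasting along two closed sets. On `D` the target parameter equals the source parameter, so the
-- transport used on `C` is the identity on the overlap.
open Classical in
theorem FamilyTransport.continuous_glue {Z : Type*} [TopologicalSpace Z] {f : Z → X}
    (hf : Continuous f) {ρ q : Z → I} (hρ : Continuous ρ) (hq : Continuous q) {C D : Set Z}
    (hC : IsClosed C) (hD : IsClosed D) (hCD : ∀ z, z ∈ C ∨ z ∈ D) (hfC : ∀ z ∈ C, f z ∈ A (ρ z))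
    (hρD : ∀ z ∈ D, q z = ρ z) :
    Continuous fun z => if z ∈ C then T.toFun (ρ z, q z, f z) else f z := by
  have h1 : ContinuousOn (fun z => if z ∈ C then T.toFun (ρ z, q z, f z) else f z) C := by
    have : ContinuousOn (fun z => T.toFun (ρ z, q z, f z)) C :=
      T.continuousOn.comp (hρ.prodMk (hq.prodMk hf)).continuousOn hfC
    exact this.congr fun z hz => if_pos hz
  have h2 : ContinuousOn (fun z => if z ∈ C then T.toFun (ρ z, q z, f z) else f z) D := by
    refine hf.continuousOn.congr fun z hz => ?_
    by_cases hzC : z ∈ C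
    · simp only [if_pos hzC, hρD z hz]
      exact T.self (hfC z hzC)
    · simp only [if_neg hzC]
  have h3 := h1.union_of_isClosed h2 hC hD
  have hu : C ∪ D = Set.univ := Set.eq_univ_of_forall hCD
  rwa [hu, continuousOn_univ] at h3

/-- Rescaling of the interval with a collar of relative width `w`, clamped to the interval. -/
def collarClamp (w x : ℝ) : I := Set.projIcc 0 1 zero_le_one ((1 + 2 * w) * x - w)

/-- The depth inside the collar. -/
def collarDepth (w x : ℝ) : ℝ := |(1 + 2 * w) * x - w - collarClamp w x|

/-- The point at distance `d` from `r` in the direction of `q`. -/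
def moveTowards (r q : I) (d : ℝ) : I :=
  Set.projIcc 0 1 zero_le_one (max ((r : ℝ) - d) (min (q : ℝ) (r + d)))

theorem moveTowards_zero (r q : I) : moveTowards r q 0 = r := by
  have : max ((r : ℝ) - 0) (min (q : ℝ) (r + 0)) = r := by
    rw [sub_zero, add_zero]
    exact max_eq_left (min_le_right _ _)
  rw [moveTowards, this, Set.projIcc_val]

theorem moveTowards_of_le {r q : I} {d : ℝ} (h : |(q : ℝ) - r| ≤ d) : moveTowards r q d = q := by
  rw [abs_le] at h
  have : max ((r : ℝ) - d) (min (q : ℝ) (r + d)) = q := by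
    rw [min_eq_left (by linarith), max_eq_right (by linarith)]
  rw [moveTowards, this, Set.projIcc_val]

theorem collarClamp_zero_left (x : I) : collarClamp 0 x = x := by
  simp [collarClamp]

theorem collarDepth_nonneg (w x : ℝ) : 0 ≤ collarDepth w x := abs_nonneg _

theorem collarClamp_zero {w : ℝ} (hw : 0 ≤ w) : collarClamp w 0 = 0 :=
  Set.projIcc_of_le_left zero_le_one (by linarith)

theorem collarClamp_one {w : ℝ} (hw : 0 ≤ w) : collarClamp w 1 = 1 :=
  Set.projIcc_of_right_le zero_le_one (by linarith)

theorem collarDepth_zero {w : ℝ} (hw : 0 ≤ w) : collarDepth w 0 = w := by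
  rw [collarDepth, collarClamp_zero hw]
  simp [abs_of_nonneg hw]

theorem collarDepth_one {w : ℝ} (hw : 0 ≤ w) : collarDepth w 1 = w := by
  rw [collarDepth, collarClamp_one hw]
  have : (1 + 2 * w) * 1 - w - ((1 : I) : ℝ) = w := by
    rw [Set.Icc.coe_one]; ring
  rw [this, abs_of_nonneg hw]

theorem collarDepth_eq_zero {w x : ℝ} (h0 : collarClamp w x ≠ 0) (h1 : collarClamp w x ≠ 1) :
    collarDepth w x = 0 := by
  have hm : (1 + 2 * w) * x - w ∈ Set.Icc (0 : ℝ) 1 := by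
    constructor
    · by_contra h
      exact h0 (Set.projIcc_of_le_left zero_le_one (not_le.1 h).le)
    · by_contra h
      exact h1 (Set.projIcc_of_right_le zero_le_one (not_le.1 h).le)
  rw [collarDepth, collarClamp, Set.projIcc_of_mem _ hm]
  simp

/-- The boundary of the square. -/
def squareBoundary : Set (I × I) := {p | p.1 = 0 ∨ p.1 = 1 ∨ p.2 = 0 ∨ p.2 = 1}

theorem isClosed_squareBoundary : IsClosed squareBoundary :=
  (isClosed_eq continuous_fst continuous_const).union
    ((isClosed_eq continuous_fst continuous_const).union
      ((isClosed_eq continuous_snd continuous_const).union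
        (isClosed_eq continuous_snd continuous_const)))

/-- The rescaling of the square, clamped to the square. -/
def squareClamp (w : ℝ) (p : I × I) : I × I := (collarClamp w p.1, collarClamp w p.2)

/-- The depth inside the collar of the square. -/
def squareDepth (w : ℝ) (p : I × I) : ℝ := max (collarDepth w p.1) (collarDepth w p.2)

theorem squareDepth_eq_zero {w : ℝ} {p : I × I} (h : squareClamp w p ∉ squareBoundary) :
    squareDepth w p = 0 := by
  simp only [squareBoundary, squareClamp, Set.mem_ofPred_eq, not_or] at h
  rw [squareDepth, collarDepth_eq_zero h.1 h.2.1, collarDepth_eq_zero h.2.2.1 h.2.2.2, max_self]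

open Classical in
/-- The map of the square obtained from `F` by adding a collar in which the boundary values are
transported from `A r` to `A q`. -/
def squareCollar (F : I × I → X) (r q : I) (p : I × I) : X :=
  if squareClamp |(q : ℝ) - r| p ∈ squareBoundary then
    T.toFun (r, moveTowards r q (squareDepth |(q : ℝ) - r| p), F (squareClamp |(q : ℝ) - r| p))
  else F (squareClamp |(q : ℝ) - r| p)

theorem mem_of_mem_squareBoundary {r : I} {F : C(I × I, X)} (hF : IsRelSquare (A r) (a r) F)
    {p : I × I} (hp : p ∈ squareBoundary) : F p ∈ A r := by
  obtain ⟨s, t⟩ := p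
  rcases hp with h | h | h | h <;> simp only at h <;> subst h
  · rw [hF.left]; exact (a r).2
  · rw [hF.right]; exact (a r).2
  · rw [hF.bottom]; exact (a r).2
  · exact hF.top s

/-- In rescaled coordinates the collar has width `|q - r|` and the parameter moves through it at
unit speed, so on the outer boundary it has just reached `q`. For `q = r` there is no collar. -/
theorem squareCollar_of_depth {F : I × I → X} {r q : I} {p : I × I}
    (h : squareClamp |(q : ℝ) - r| p ∈ squareBoundary)
    (hd : |(q : ℝ) - r| ≤ squareDepth |(q : ℝ) - r| p) :
    squareCollar T F r q p = T.toFun (r, q, F (squareClamp |(q : ℝ) - r| p)) := by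
  rw [squareCollar, if_pos h, moveTowards_of_le hd]

theorem squareCollar_left {F : I × I → X} {r q : I} (t : I) :
    ∃ t', squareCollar T F r q (0, t) = T.toFun (r, q, F (0, t')) := by
  have hw := abs_nonneg ((q : ℝ) - r)
  have e : squareClamp |(q : ℝ) - r| (0, t) = (0, collarClamp |(q : ℝ) - r| t) := Prod.ext (collarClamp_zero hw) rfl
  have hd : |(q : ℝ) - r| ≤ squareDepth |(q : ℝ) - r| (0, t) :=
    (collarDepth_zero hw).symm.le.trans (le_max_left _ _)
  refine ⟨collarClamp |(q : ℝ) - r| t, ?_⟩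
  rw [squareCollar_of_depth T (by rw [e]; exact Or.inl rfl) hd, e]

theorem squareCollar_right {F : I × I → X} {r q : I} (t : I) :
    ∃ t', squareCollar T F r q (1, t) = T.toFun (r, q, F (1, t')) := by
  have hw := abs_nonneg ((q : ℝ) - r)
  have e : squareClamp |(q : ℝ) - r| (1, t) = (1, collarClamp |(q : ℝ) - r| t) := Prod.ext (collarClamp_one hw) rfl
  have hd : |(q : ℝ) - r| ≤ squareDepth |(q : ℝ) - r| (1, t) :=
    (collarDepth_one hw).symm.le.trans (le_max_left _ _)
  refine ⟨collarClamp |(q : ℝ) - r| t, ?_⟩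
  rw [squareCollar_of_depth T (by rw [e]; exact Or.inr (Or.inl rfl)) hd, e]

theorem squareCollar_bottom {F : I × I → X} {r q : I} (s : I) :
    ∃ s', squareCollar T F r q (s, 0) = T.toFun (r, q, F (s', 0)) := by
  have hw := abs_nonneg ((q : ℝ) - r)
  have e : squareClamp |(q : ℝ) - r| (s, 0) = (collarClamp |(q : ℝ) - r| s, 0) := Prod.ext rfl (collarClamp_zero hw)
  have hd : |(q : ℝ) - r| ≤ squareDepth |(q : ℝ) - r| (s, 0) :=
    (collarDepth_zero hw).symm.le.trans (le_max_right _ _)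
  refine ⟨collarClamp |(q : ℝ) - r| s, ?_⟩
  rw [squareCollar_of_depth T (by rw [e]; exact Or.inr (Or.inr (Or.inl rfl))) hd, e]

theorem squareCollar_top {F : I × I → X} {r q : I} (s : I) :
    ∃ s', squareCollar T F r q (s, 1) = T.toFun (r, q, F (s', 1)) := by
  have hw := abs_nonneg ((q : ℝ) - r)
  have e : squareClamp |(q : ℝ) - r| (s, 1) = (collarClamp |(q : ℝ) - r| s, 1) := Prod.ext rfl (collarClamp_one hw)
  have hd : |(q : ℝ) - r| ≤ squareDepth |(q : ℝ) - r| (s, 1) :=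
    (collarDepth_one hw).symm.le.trans (le_max_right _ _)
  refine ⟨collarClamp |(q : ℝ) - r| s, ?_⟩
  rw [squareCollar_of_depth T (by rw [e]; exact Or.inr (Or.inr (Or.inr rfl))) hd, e]

theorem squareCollar_self {r : I} {F : C(I × I, X)} (hF : IsRelSquare (A r) (a r) F) (p : I × I) :
    squareCollar T F r r p = F p := by
  have h0 : |(r : ℝ) - r| = 0 := by simp
  have h1 : squareClamp 0 p = p := Prod.ext (collarClamp_zero_left _) (collarClamp_zero_left _)
  have h2 : moveTowards r r (squareDepth 0 p) = r := moveTowards_of_le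
    (by rw [h0]; exact (collarDepth_nonneg _ _).trans (le_max_left _ _))
  rw [squareCollar, h0, h1, h2]
  split_ifs with h
  · exact T.self (mem_of_mem_squareBoundary hF h)
  · rfl

theorem continuous_squareCollar {P : Type*} [TopologicalSpace P] (H : C(P × (I × I), X))
    (ρ κ : C(P, I)) (h : ∀ r, IsRelSquare (A (ρ r)) (a (ρ r)) (H.curry r)) :
    Continuous fun z : P × (I × I) => squareCollar T (H.curry z.1) (ρ z.1) (κ z.1) z.2 := by
  have hw : Continuous fun z : P × (I × I) => |(κ z.1 : ℝ) - ρ z.1| := by fun_prop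
  have hcl {g : P × (I × I) → I} (hg : Continuous g) : Continuous fun z : P × (I × I) =>
      collarClamp |(κ z.1 : ℝ) - ρ z.1| (g z) := by
    unfold collarClamp
    fun_prop
  have hcd {g : P × (I × I) → I} (hg : Continuous g) : Continuous fun z : P × (I × I) =>
      collarDepth |(κ z.1 : ℝ) - ρ z.1| (g z) := by
    have := hcl hg
    unfold collarDepth
    fun_prop
  have hsc : Continuous fun z : P × (I × I) => squareClamp |(κ z.1 : ℝ) - ρ z.1| z.2 :=
    (hcl (by fun_prop)).prodMk (hcl (by fun_prop))
  have hsd : Continuous fun z : P × (I × I) => squareDepth |(κ z.1 : ℝ) - ρ z.1| z.2 :=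
    (hcd (by fun_prop)).max (hcd (by fun_prop))
  have hq : Continuous fun z : P × (I × I) =>
      moveTowards (ρ z.1) (κ z.1) (squareDepth |(κ z.1 : ℝ) - ρ z.1| z.2) := by
    unfold moveTowards
    fun_prop
  have hρ : Continuous fun z : P × (I × I) => ρ z.1 := by fun_prop
  have hf : Continuous fun z : P × (I × I) =>
      H.curry z.1 (squareClamp |(κ z.1 : ℝ) - ρ z.1| z.2) :=
    H.continuous.comp (continuous_fst.prodMk hsc)
  refine T.continuous_glue hf hρ hq (isClosed_squareBoundary.preimage hsc)
    (D := {z | squareDepth |(κ z.1 : ℝ) - ρ z.1| z.2 = 0}) (isClosed_eq hsd continuous_const)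
    (fun z => ?_) (fun z hz => mem_of_mem_squareBoundary (h z.1) hz) fun z hz => ?_
  · by_cases hz : squareClamp |(κ z.1 : ℝ) - ρ z.1| z.2 ∈ squareBoundary
    · exact Or.inl hz
    · exact Or.inr (squareDepth_eq_zero hz)
  · rw [Set.mem_ofPred_eq] at hz
    rw [hz, moveTowards_zero]

theorem isRelSquare_of_eq_squareCollar {r q : I} {F F' : C(I × I, X)}
    (hF : IsRelSquare (A r) (a r) F) (h : ∀ p, F' p = squareCollar T F r q p) :
    IsRelSquare (A q) (a q) F' := by
  refine ⟨fun t => ?_, fun t => ?_, fun s => ?_, fun s => ?_⟩ <;> rw [h]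
  · obtain ⟨t', e⟩ := squareCollar_left T (F := F) (r := r) (q := q) t
    rw [e, hF.left, T.base]
  · obtain ⟨t', e⟩ := squareCollar_right T (F := F) (r := r) (q := q) t
    rw [e, hF.right, T.base]
  · obtain ⟨s', e⟩ := squareCollar_bottom T (F := F) (r := r) (q := q) s
    rw [e, hF.bottom, T.base]
  · obtain ⟨s', e⟩ := squareCollar_top T (F := F) (r := r) (q := q) s
    rw [e]
    exact T.mem (hF.top s')

theorem exists_squareCollar_family {P : Type*} [TopologicalSpace P] (H : C(P × (I × I), X))
    (ρ κ : C(P, I)) (h : ∀ r, IsRelSquare (A (ρ r)) (a (ρ r)) (H.curry r)) :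
    ∃ K : C(P × (I × I), X), (∀ r p, K.curry r p = squareCollar T (H.curry r) (ρ r) (κ r) p) ∧
      ∀ r, IsRelSquare (A (κ r)) (a (κ r)) (K.curry r) :=
  ⟨⟨_, continuous_squareCollar T H ρ κ h⟩, fun _ _ => rfl,
    fun r => isRelSquare_of_eq_squareCollar T (h r) fun _ => rfl⟩

theorem exists_squareCollar {r : I} (q : I) {F : C(I × I, X)} (hF : IsRelSquare (A r) (a r) F) :
    ∃ F' : C(I × I, X), ∀ p, F' p = squareCollar T F r q p := by
  obtain ⟨K, hK, -⟩ := exists_squareCollar_family T (P := Unit)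
    (F.comp ⟨Prod.snd, continuous_snd⟩) (ContinuousMap.const _ r) (ContinuousMap.const _ q)
    (fun _ => hF)
  exact ⟨K.curry (), hK ()⟩

/-- The transport of classes. -/
def transportClass (r q : I) (x : RelPi2 (A r) (a r)) : RelPi2 (A q) (a q) :=
  (isRelSquare_of_eq_squareCollar T (exists_isRelSquare x).choose_spec.choose
    (exists_squareCollar T q (exists_isRelSquare x).choose_spec.choose).choose_spec).toClass

/-- Adding to each member of the family a collar that ends in the fixed `A q` gives a homotopy of
relative squares for `A q`. A constant `ρ` yields independence of representatives, `ρ = id`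
compatibility with moving families. -/
theorem toClass_squareCollar_eq (H : C(I × (I × I), X)) (ρ : C(I, I)) (q : I)
    (h : ∀ r, IsRelSquare (A (ρ r)) (a (ρ r)) (H.curry r)) {F₀ F₁ : C(I × I, X)}
    (h₀ : ∀ p, F₀ p = squareCollar T (H.curry 0) (ρ 0) q p)
    (h₁ : ∀ p, F₁ p = squareCollar T (H.curry 1) (ρ 1) q p) :
    (isRelSquare_of_eq_squareCollar T (h 0) h₀).toClass =
      (isRelSquare_of_eq_squareCollar T (h 1) h₁).toClass := by
  obtain ⟨K, hK, hK'⟩ := exists_squareCollar_family T H ρ (ContinuousMap.const _ q) h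
  have e₀ : F₀ = K.curry 0 := ContinuousMap.ext fun p => (h₀ p).trans (hK 0 p).symm
  have e₁ : F₁ = K.curry 1 := ContinuousMap.ext fun p => (h₁ p).trans (hK 1 p).symm
  subst e₀ e₁
  exact toClass_eq_of_homotopy K hK'

theorem transportClass_toClass {r : I} (q : I) {F F' : C(I × I, X)}
    (hF : IsRelSquare (A r) (a r) F) (h : ∀ p, F' p = squareCollar T F r q p) :
    transportClass T r q hF.toClass = (isRelSquare_of_eq_squareCollar T hF h).toClass := by
  have hG := (exists_isRelSquare hF.toClass).choose_spec.choose
  obtain ⟨H, hH, h0, h1⟩ := exists_homotopy_of_toClass_eq hG hF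
    (exists_isRelSquare hF.toClass).choose_spec.choose_spec
  exact toClass_squareCollar_eq T H (ContinuousMap.const _ r) q hH
    (fun p => by
      rw [h0]; exact (exists_squareCollar T q hG).choose_spec p)
    (fun p => by rw [h1]; exact h p)

theorem transportClass_family (H : C(I × (I × I), X))
    (h : ∀ r, IsRelSquare (A r) (a r) (H.curry r)) (q : I) :
    transportClass T 0 q (h 0).toClass = transportClass T 1 q (h 1).toClass := by
  obtain ⟨F₀, h₀⟩ := exists_squareCollar T q (h 0)
  obtain ⟨F₁, h₁⟩ := exists_squareCollar T q (h 1)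
  rw [transportClass_toClass T q (h 0) h₀, transportClass_toClass T q (h 1) h₁]
  exact toClass_squareCollar_eq T H (ContinuousMap.id I) q h h₀ h₁

theorem transportClass_self (r : I) (x : RelPi2 (A r) (a r)) : transportClass T r r x = x := by
  obtain ⟨F, hF, rfl⟩ := exists_isRelSquare x
  exact transportClass_toClass T r hF fun p => (squareCollar_self T hF p).symm

theorem exists_family (r₀ : I) (x : RelPi2 (A r₀) (a r₀)) : ∃ (H : C(I × (I × I), X))
    (h : ∀ r, IsRelSquare (A r) (a r) (H.curry r)), ∀ r, (h r).toClass = transportClass T r₀ r x := by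
  obtain ⟨F, hF, rfl⟩ := exists_isRelSquare x
  obtain ⟨K, hK, hK'⟩ := exists_squareCollar_family T (P := I)
    (F.comp ⟨Prod.snd, continuous_snd⟩) (ContinuousMap.const _ r₀) (ContinuousMap.id I)
    (fun _ => hF)
  exact ⟨K, hK', fun r => (transportClass_toClass T r hF (hK r)).symm⟩

/-- The isomorphism between the relative homotopy groups of the ends of a family. -/
theorem exists_transport_equiv (T : FamilyTransport A a) :
    ∃ τ : RelPi2 (A 0) (a 0) ≃+ RelPi2 (A 1) (a 1),
    ∀ (H : C(I × (I × I), X)) (h : ∀ r, IsRelSquare (A r) (a r) (H.curry r)),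
      τ (h 0).toClass = (h 1).toClass := by
  have key (H : C(I × (I × I), X)) (h : ∀ r, IsRelSquare (A r) (a r) (H.curry r)) :
      transportClass T 0 1 (h 0).toClass = (h 1).toClass := by
    rw [transportClass_family T H h 1, transportClass_self]
  refine ⟨{ toFun := transportClass T 0 1, invFun := transportClass T 1 0, left_inv := fun x => ?_,
            right_inv := fun y => ?_, map_add' := fun x y => ?_ }, key⟩
  -- Every class extends to a family over the whole parameter interval. Inverses are read off from
  -- one family, additivity from the concatenation of two.
  · obtain ⟨H, h, e⟩ := exists_family T 0 x
    rw [← e 1, ← transportClass_family T H h 0, e 0, transportClass_self, transportClass_self]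
  · obtain ⟨H, h, e⟩ := exists_family T 1 y
    rw [← e 0, transportClass_family T H h 1, e 1, transportClass_self, transportClass_self]
  · obtain ⟨H, h, e⟩ := exists_family T 0 y
    obtain ⟨H', h', e'⟩ := exists_family T 0 x
    obtain ⟨G, hG⟩ := exists_concat H H' fun r t => ((h r).right t).trans ((h' r).left t).symm
    have hl (r) : IsRelSquare (A r) (a r) ((G.curry r).comp leftHalf) := (hG r).1 ▸ h r
    have hr (r) : IsRelSquare (A r) (a r) ((G.curry r).comp rightHalf) := (hG r).2 ▸ h' r
    have hcl (r) : (hl r).toClass = (h r).toClass := toClass_congr _ (hG r).1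
    have hcr (r) : (hr r).toClass = (h' r).toClass := toClass_congr _ (hG r).2
    have hk := key G fun r => isRelSquare_of_halves (hl r) (hr r)
    rw [toClass_eq_add _ (hl 0) (hr 0), toClass_eq_add _ (hl 1) (hr 1), hcl, hcl, hcr, hcr, e, e, e',
      e', transportClass_self, transportClass_self] at hk
    exact hk

end Transport

/-! ### Transport of disk classes along an isotopy -/

section IsotopyTransport

variable {X : Type*} [TopologicalSpace X] {B : Set X}

theorem Isotopy.image_zero (Φ : Isotopy B) : Φ.image 0 = B := by
  ext x
  simp only [Isotopy.image, Φ.map_zero, Subtype.range_coe]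

open Classical in
/-- A compact isotopy in a Hausdorff space gives a continuous transport. -/
def Isotopy.transport [T2Space X] [CompactSpace B] (Φ : Isotopy B) (a : B) :
    FamilyTransport Φ.image (fun r => Φ.point r a) where
  toFun p := if h : ∃ y, Φ.toMap (p.1, y) = p.2.2 then Φ.toMap (p.2.1, h.choose) else p.2.2
  continuousOn := by
    let E (q : I × B) : I × X := (q.1, Φ.toMap q)
    -- The track of the isotopy is an injective map from a compact to a Hausdorff space. Its
    -- continuous inverse recovers `y` from the time and the position, which is what transport
    -- needs.
    have hE : Topology.IsEmbedding E := by
      refine (Continuous.isClosedEmbedding (by fun_prop) ?_).isEmbedding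
      rintro ⟨r, y⟩ ⟨r', y'⟩ h
      obtain ⟨rfl, h2⟩ := Prod.mk.inj h
      exact Prod.ext rfl (Φ.injective r h2)
    rw [continuousOn_iff_continuous_domRestrict]
    let D : Set (I × I × X) := {p | p.2.2 ∈ Φ.image p.1}
    let k (p : D) : Set.range E := ⟨(p.1.1, p.1.2.2), by
      obtain ⟨y, hy⟩ := p.2
      exact ⟨(p.1.1, y), Prod.ext rfl hy⟩⟩
    have hk : Continuous k := Continuous.subtype_mk (by fun_prop) _
    have hc : Continuous fun p : D => Φ.toMap (p.1.2.1, (hE.toHomeomorph.symm (k p)).2) :=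
      Φ.toMap.continuous.comp ((by fun_prop : Continuous fun p : D => p.1.2.1).prodMk
        (continuous_snd.comp (hE.toHomeomorph.symm.continuous.comp hk)))
    refine hc.congr fun p => ?_
    have h : ∃ y, Φ.toMap (p.1.1, y) = p.1.2.2 := p.2
    have e : hE.toHomeomorph.symm (k p) = (p.1.1, h.choose) := by
      rw [Homeomorph.symm_apply_eq]
      exact Subtype.ext (Prod.ext rfl h.choose_spec.symm)
    rw [e, Set.domRestrict_apply, dif_pos h]
  mem := by
    rintro r q x h
    have h' : ∃ y, Φ.toMap (r, y) = x := h
    simp only [dif_pos h']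
    exact ⟨_, rfl⟩
  self := by
    rintro r x h
    have h' : ∃ y, Φ.toMap (r, y) = x := h
    simp only [dif_pos h']
    exact h'.choose_spec
  base := by
    intro r q
    have h' : ∃ y, Φ.toMap (r, y) = Φ.point r a := ⟨a, rfl⟩
    simp only [dif_pos h']
    exact congrArg (fun y => Φ.toMap (q, y)) (Φ.injective r h'.choose_spec)

/-- Needed because the initial image of an isotopy equals `B` only propositionally. -/
theorem exists_relPi2_equiv_of_eq {A A' : Set X} {a : A} {a' : A'} (h : A = A') (ha : (a : X) = a') :
    ∃ e : RelPi2 A a ≃+ RelPi2 A' a', ∀ (F : C(I × I, X)) (hF : IsRelSquare A a F)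
      (hF' : IsRelSquare A' a' F), e hF.toClass = hF'.toClass := by
  subst h
  obtain rfl : a = a' := Subtype.ext ha
  exact ⟨AddEquiv.refl _, fun _ _ _ => rfl⟩

theorem Isotopy.coe_point_zero (Φ : Isotopy B) (a : B) : (Φ.point 0 a : X) = a := Φ.map_zero a

/-- The isomorphism of relative homotopy groups induced by an isotopy. -/
theorem Isotopy.exists_equiv [T2Space X] [CompactSpace B] (Φ : Isotopy B) (a : B) :
    ∃ τ : RelPi2 B a ≃+ RelPi2 (Φ.image 1) (Φ.point 1 a),
      ∀ (H : C(I × (I × I), X)) (h₀ : IsRelSquare B a (H.curry 0))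
        (h : ∀ r, IsRelSquare (Φ.image r) (Φ.point r a) (H.curry r)),
        τ h₀.toClass = (h 1).toClass := by
  obtain ⟨τ, hτ⟩ := exists_transport_equiv (Φ.transport a)
  obtain ⟨e, he⟩ := exists_relPi2_equiv_of_eq (a := a) (a' := Φ.point 0 a) Φ.image_zero.symm
    (Φ.coe_point_zero a).symm
  refine ⟨e.trans τ, fun H h₀ h => ?_⟩
  rw [AddEquiv.trans_apply, he _ h₀ (h 0), hτ H h]

/-- The rescaled disk, clamped to the disk. -/
def diskClamp (q : I × Disk) : Disk :=
  ⟨((1 + (q.1 : ℝ)) / max 1 ((1 + (q.1 : ℝ)) * ‖(q.2 : ℂ)‖) : ℝ) • (q.2 : ℂ), by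
    have h0 : 0 < 1 + (q.1 : ℝ) := by linarith [q.1.2.1]
    have h1 : 0 < max 1 ((1 + (q.1 : ℝ)) * ‖(q.2 : ℂ)‖) := lt_max_of_lt_left one_pos
    rw [mem_closedBall_zero_iff, norm_smul, Real.norm_eq_abs, abs_of_pos (div_pos h0 h1),
      div_mul_eq_mul_div, div_le_one h1]
    exact le_max_right _ _⟩

theorem continuous_diskClamp : Continuous diskClamp := by
  have h : Continuous fun q : I × Disk =>
      (1 + (q.1 : ℝ)) / max 1 ((1 + (q.1 : ℝ)) * ‖(q.2 : ℂ)‖) :=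
    Continuous.div (by fun_prop) (by fun_prop) fun q => (lt_max_of_lt_left one_pos).ne'
  exact Continuous.subtype_mk (h.smul (by fun_prop)) _

/-- The depth inside the collar of the disk. -/
def diskDepth (q : I × Disk) : I :=
  Set.projIcc 0 1 zero_le_one (max 1 ((1 + (q.1 : ℝ)) * ‖(q.2 : ℂ)‖) - 1)

theorem continuous_diskDepth : Continuous diskDepth :=
  continuous_projIcc.comp (by fun_prop)

theorem norm_diskClamp_or_diskDepth (q : I × Disk) :
    ‖(diskClamp q : ℂ)‖ = 1 ∨ diskDepth q = 0 := by
  have h0 : 0 < 1 + (q.1 : ℝ) := by linarith [q.1.2.1]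
  rcases le_total ((1 + (q.1 : ℝ)) * ‖(q.2 : ℂ)‖) 1 with h | h
  · right
    rw [diskDepth, max_eq_left h, sub_self]
    exact Set.projIcc_left zero_le_one
  · left
    have h1 : 0 < (1 + (q.1 : ℝ)) * ‖(q.2 : ℂ)‖ := one_pos.trans_le h
    simp only [diskClamp]
    rw [max_eq_right h, norm_smul, Real.norm_eq_abs, abs_of_pos (div_pos h0 h1),
      div_mul_eq_mul_div, div_self h1.ne']

theorem diskClamp_boundary {r : I} {z : Disk} (hz : ‖(z : ℂ)‖ = 1) :
    diskClamp (r, z) = z ∧ diskDepth (r, z) = r := by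
  have h0 : 0 < 1 + (r : ℝ) := by linarith [r.2.1]
  have h1 : max 1 ((1 + (r : ℝ)) * ‖(z : ℂ)‖) = 1 + r := by
    rw [hz, mul_one]
    exact max_eq_right (by linarith [r.2.1])
  constructor
  · refine Subtype.ext ?_
    simp only [diskClamp, h1, div_self h0.ne', one_smul]
  · simp only [diskDepth, h1, add_sub_cancel_left]
    exact Set.projIcc_val _ _

theorem diskClamp_zero (z : Disk) : diskClamp (0, z) = z ∧ diskDepth (0, z) = 0 := by
  have h1 : max 1 ((1 + ((0 : I) : ℝ)) * ‖(z : ℂ)‖) = 1 := by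
    refine max_eq_left ?_
    have : ‖(z : ℂ)‖ ≤ 1 := mem_closedBall_zero_iff.1 z.2
    simpa using this
  constructor
  · refine Subtype.ext ?_
    simp only [diskClamp, h1]
    simp
  · simp only [diskDepth, h1, sub_self]
    exact Set.projIcc_left zero_le_one

/-- Every based disk extends to a family of disks along an isotopy. -/
theorem Isotopy.exists_disk_family [T2Space X] [CompactSpace B] (Φ : Isotopy B) (a : B)
    (u : BasedDisk B a) : ∃ H : C(I × Disk, X), (∀ z, H (0, z) = u.toMap z) ∧
      (∀ (t : I) (z : Disk), ‖(z : ℂ)‖ = 1 → H (t, z) ∈ Φ.image t) ∧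
      ∀ t : I, H (t, diskOne) = Φ.point t a := by
  classical
  set T := Φ.transport a
  have hB {x : X} (hx : x ∈ B) : x ∈ Φ.image 0 := Φ.image_zero.symm ▸ hx
  have hnorm : Continuous fun q : I × Disk => ‖(diskClamp q : ℂ)‖ :=
    (continuous_subtype_val.comp continuous_diskClamp).norm
  -- At time `t` the disk `u` is shrunk to radius `1 / (1 + t)`. In the remaining annulus its
  -- boundary values are transported, the parameter growing from `0` at the inner to `t` at the
  -- outer circle.
  have hc := T.continuous_glue (u.toMap.continuous.comp continuous_diskClamp)
    (continuous_const (y := (0 : I))) continuous_diskDepth (C := {q | ‖(diskClamp q : ℂ)‖ = 1})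
    (D := {q | diskDepth q = 0}) (isClosed_eq hnorm continuous_const)
    (isClosed_eq continuous_diskDepth continuous_const) norm_diskClamp_or_diskDepth
    (fun q hq => hB (u.map_boundary _ hq)) (fun q hq => hq)
  have hval (t : I) (z : Disk) (hz : ‖(z : ℂ)‖ = 1) :
      (if (t, z) ∈ {q | ‖(diskClamp q : ℂ)‖ = 1} then
        T.toFun (0, diskDepth (t, z), (u.toMap ∘ diskClamp) (t, z))
        else (u.toMap ∘ diskClamp) (t, z)) = T.toFun (0, t, u.toMap z) := by
    have hm : (t, z) ∈ {q | ‖(diskClamp q : ℂ)‖ = 1} := by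
      change ‖(diskClamp (t, z) : ℂ)‖ = 1
      rw [(diskClamp_boundary hz).1, hz]
    rw [if_pos hm, Function.comp_apply, (diskClamp_boundary hz).1, (diskClamp_boundary hz).2]
  refine ⟨⟨_, hc⟩, fun z => ?_, fun t z hz => ?_, fun t => ?_⟩
  · simp only [ContinuousMap.coe_mk, Function.comp_apply, (diskClamp_zero z).1, (diskClamp_zero z).2]
    split_ifs with h
    · refine T.self (hB (u.map_boundary _ ?_))
      rw [← (diskClamp_zero z).1]
      exact h
    · rfl
  · exact (congrArg (· ∈ Φ.image t) (hval t z hz)).mpr (T.mem (hB (u.map_boundary z hz)))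
  · refine (hval t diskOne (by simp [diskOne])).trans ?_
    rw [u.map_one]
    have := T.base 0 t
    rwa [Φ.coe_point_zero a] at this

/-- Correspondence of disk classes is the graph of the isomorphism induced by the isotopy. -/
theorem Isotopy.corresponds_iff [T2Space X] [CompactSpace B] (Φ : Isotopy B) (a : B)
    {τ : RelPi2 B a ≃+ RelPi2 (Φ.image 1) (Φ.point 1 a)}
    (hτ : ∀ (H : C(I × (I × I), X)) (h₀ : IsRelSquare B a (H.curry 0))
        (h : ∀ r, IsRelSquare (Φ.image r) (Φ.point r a) (H.curry r)),
        τ h₀.toClass = (h 1).toClass) (u : BasedDisk B a)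
    (γ : RelPi2 (Φ.image 1) (Φ.point 1 a)) : Φ.Corresponds a u.toClass γ ↔ γ = τ u.toClass := by
  have key (u : BasedDisk B a) (u' : BasedDisk (Φ.image 1) (Φ.point 1 a)) (H : C(I × Disk, X))
      (h0 : ∀ z, H (0, z) = u.toMap z) (h1 : ∀ z, H (1, z) = u'.toMap z)
      (hb : ∀ (t : I) (z : Disk), ‖(z : ℂ)‖ = 1 → H (t, z) ∈ Φ.image t)
      (hp : ∀ t : I, H (t, diskOne) = Φ.point t a) : τ u.toClass = u'.toClass := by
    let K : C(I × (I × I), X) := H.comp ⟨fun q => (q.1, chordMap q.2), by fun_prop⟩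
    have e0 : u.toMap.comp chordMap = K.curry 0 := ContinuousMap.ext fun p => (h0 _).symm
    have e1 : u'.toMap.comp chordMap = K.curry 1 := ContinuousMap.ext fun p => (h1 _).symm
    have hK (r : I) : IsRelSquare (Φ.image r) (Φ.point r a) (K.curry r) :=
      BasedDisk.isRelSquare ⟨H.curry r, hb r, hp r⟩
    rw [u.toClass_eq_toClass, u'.toClass_eq_toClass, toClass_congr u.isRelSquare e0,
      toClass_congr u'.isRelSquare e1]
    exact hτ K _ hK
  constructor
  · rintro ⟨u₁, u', H, hu, rfl, h0, h1, hb, hp⟩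
    rw [← hu, key u₁ u' H h0 h1 hb hp]
  · rintro rfl
    obtain ⟨H, h0, hb, hp⟩ := Φ.exists_disk_family a u
    let u' : BasedDisk (Φ.image 1) (Φ.point 1 a) := ⟨H.curry 1, hb 1, hp 1⟩
    exact ⟨u, u', H, rfl, (key u u' H h0 (fun _ => rfl) hb hp).symm, h0, fun _ => rfl, hb, hp⟩

end IsotopyTransport

/-! ### Spheres along an isotopy -/

section SphereTransport

variable {X : Type} [TopologicalSpace X] {B : Set X}

/-- Spheres at the end of an isotopy are transported to spheres at its start, with the same
homology class. -/
theorem Isotopy.exists_sphere [T2Space X] [CompactSpace B] (Φ : Isotopy B) (a : B)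
    {τ : RelPi2 B a ≃+ RelPi2 (Φ.image 1) (Φ.point 1 a)}
    (hτ : ∀ (H : C(I × (I × I), X)) (h₀ : IsRelSquare B a (H.curry 0))
        (h : ∀ r, IsRelSquare (Φ.image r) (Φ.point r a) (H.curry r)),
        τ h₀.toClass = (h 1).toClass) (f' : Ω^ (Fin 2) X (Φ.point 1 a : X)) :
    ∃ f : Ω^ (Fin 2) X (a : X), hurewicz f = hurewicz f' ∧
      τ (sphereClass B a f) = sphereClass (Φ.image 1) (Φ.point 1 a) f' := by
  set T := Φ.transport a
  have hF := isRelSquare_sphere (A := Φ.image 1) (a := Φ.point 1 a) f'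
  set F := (f' : C(Fin 2 → I, X)).comp squareToCube with hFdef
  have hFt (s : I) : F (s, 1) = Φ.point 1 a := GenLoop.boundary f' _ ⟨1, Or.inr rfl⟩
  -- The collar is run backwards from time `1`. Base points are transported to base points, so the
  -- top side stays constant as well and all squares are spheres.
  obtain ⟨K, hK, hK'⟩ := exists_squareCollar_family T (P := I)
    (F.comp ⟨Prod.snd, continuous_snd⟩) (ContinuousMap.const _ 1) (ContinuousMap.id I)
    (fun _ => hF)
  have hKt (r s : I) : K (r, (s, 1)) = Φ.point r a := by
    obtain ⟨s', e⟩ := squareCollar_top T (F := F) (r := 1) (q := r) s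
    refine (hK r (s, 1)).trans (e.trans ?_)
    rw [hFt]
    exact T.base 1 r
  have hK1 : F = K.curry 1 := ContinuousMap.ext fun p => ((hK 1 p).trans
    (squareCollar_self T hF p)).symm
  let H : C(I × (Fin 2 → I), X) := K.comp ⟨fun q => (q.1, (q.2 0, q.2 1)), by fun_prop⟩
  have hH (r : I) (y) (hy : y ∈ Cube.boundary (Fin 2)) : H (r, y) = Φ.point r a := by
    obtain ⟨j, hj⟩ := hy
    change K (r, (y 0, y 1)) = _
    fin_cases j
    · rcases hj with hj | hj
      · exact (congrArg (fun s => K (r, (s, y 1))) hj).trans ((hK' r).left _)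
      · exact (congrArg (fun s => K (r, (s, y 1))) hj).trans ((hK' r).right _)
    · rcases hj with hj | hj
      · exact (congrArg (fun s => K (r, (y 0, s))) hj).trans ((hK' r).bottom _)
      · exact (congrArg (fun s => K (r, (y 0, s))) hj).trans (hKt r _)
  let f : Ω^ (Fin 2) X (a : X) := ⟨H.curry 0, fun y hy => (hH 0 y hy).trans (Φ.coe_point_zero a)⟩
  refine ⟨f, hurewicz_eq_of_homotopy f f' H _ hH (fun y => rfl) fun y => ?_, ?_⟩
  · change K.curry 1 (y 0, y 1) = f' y
    rw [← hK1]
    refine congrArg f' (funext fun j => ?_)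
    fin_cases j <;> rfl
  · have e0 : (f : C(Fin 2 → I, X)).comp squareToCube = K.curry 0 := rfl
    rw [sphereClass_eq_toClass, sphereClass_eq_toClass, toClass_congr (isRelSquare_sphere f) e0,
      toClass_congr hF hK1]
    exact hτ K _ hK'

end SphereTransport

/-! ### Winding of the coordinates around the boundary of a square -/

section BoundaryLog

variable {N : Type*} [AddCommGroup N] {m : ℕ}
variable {S : Set (PointedCone ℝ (ℝ ⊗[ℤ] N))} {v : Fin m → N}

/-- All coordinates of a map of the square are nonzero on the boundary. -/
def BoundaryNeZero (L : C(I × I, HomogeneousPoints S v)) : Prop :=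
  ∀ i t, (L (sideLeft t)).1 i ≠ 0 ∧ (L (sideTop t)).1 i ≠ 0 ∧ (L (sideBottom t)).1 i ≠ 0 ∧
    (L (sideRight t)).1 i ≠ 0

/-- The ratio is nonzero on the whole square, so the increments of its logarithm around the boundary
add up to zero. -/
theorem boundaryLog_eq_of_isRatio {g : Fin m → C(I × I, ℂ)} {L L' : C(I × I, HomogeneousPoints S v)}
    (hg : IsRatio g L L') (hL : BoundaryNeZero L) : boundaryLog L' = boundaryLog L := by
  funext i
  have key (s : C(I, I × I)) (hs : ∀ t, (L (s t)).1 i ≠ 0) :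
      logDiff (coordMap (L'.comp s) i) 0 1 =
        logDiff (g i) (s 0) (s 1) + logDiff (coordMap (L.comp s) i) 0 1 := by
    rw [(hg.comp s).coordMap_eq, logDiff_mul (fun t => (hg.comp s).ne_zero i t) hs,
      logDiff_comp (hg.ne_zero i)]
  simp only [boundaryLog]
  rw [key _ fun t => (hL i t).1, key _ fun t => (hL i t).2.1, key _ fun t => (hL i t).2.2.1,
    key _ fun t => (hL i t).2.2.2]
  have h1 := logDiff_add (hg.ne_zero i) (sideLeft 0) (sideLeft 1) (sideTop 1)
  have h2 := logDiff_add (hg.ne_zero i) (sideBottom 0) (sideBottom 1) (sideRight 1)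
  have e1 : sideTop 0 = sideLeft 1 := rfl
  have e2 : sideRight 0 = sideBottom 1 := rfl
  have e3 : sideBottom 0 = sideLeft 0 := rfl
  have e4 : sideRight 1 = sideTop 1 := rfl
  rw [e3, e4] at h2
  rw [e1, e2, e3, e4]
  linear_combination h1 - h2

/-- The increment along a side changes by the increments along the tracks of its end points, and
each corner track is counted twice with opposite signs. -/
theorem boundaryLog_eq_of_homotopy (H : C(I × (I × I), HomogeneousPoints S v))
    (hH : ∀ r, BoundaryNeZero (H.curry r)) : boundaryLog (H.curry 0) = boundaryLog (H.curry 1) := by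
  funext i
  have key (s : C(I, I × I)) (hs : ∀ r t, (H (r, s t)).1 i ≠ 0) :
      logDiff (coordMap ((H.curry 0).comp s) i) 0 1 - logDiff (coordMap ((H.curry 1).comp s) i) 0 1 =
        logDiff (coordMap (H.comp ⟨fun r => (r, s 0), by fun_prop⟩) i) 0 1 -
          logDiff (coordMap (H.comp ⟨fun r => (r, s 1), by fun_prop⟩) i) 0 1 := by
    let u : C(I × I, ℂ) := (coordMap H i).comp ⟨fun q => (q.1, s q.2), by fun_prop⟩
    have hu (q) : u q ≠ 0 := hs q.1 q.2
    have h1 := logDiff_comp hu sideLeft 0 1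
    have h2 := logDiff_comp hu sideRight 0 1
    have h3 := logDiff_comp hu sideBottom 0 1
    have h4 := logDiff_comp hu sideTop 0 1
    have h5 := logDiff_add hu (sideLeft 0) (sideLeft 1) (sideTop 1)
    have h6 := logDiff_add hu (sideBottom 0) (sideBottom 1) (sideRight 1)
    change logDiff (u.comp sideLeft) 0 1 - logDiff (u.comp sideRight) 0 1 =
      logDiff (u.comp sideBottom) 0 1 - logDiff (u.comp sideTop) 0 1
    rw [h1, h2, h3, h4]
    have e1 : sideTop 0 = sideLeft 1 := rfl
    have e2 : sideRight 0 = sideBottom 1 := rfl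
    have e3 : sideBottom 0 = sideLeft 0 := rfl
    have e4 : sideRight 1 = sideTop 1 := rfl
    rw [e3, e4] at h6
    rw [e1, e2, e3, e4]
    linear_combination h5 - h6
  have k1 := key sideLeft fun r t => (hH r i t).1
  have k2 := key sideTop fun r t => (hH r i t).2.1
  have k3 := key sideBottom fun r t => (hH r i t).2.2.1
  have k4 := key sideRight fun r t => (hH r i t).2.2.2
  have e1 : sideTop 0 = sideLeft 1 := rfl
  have e2 : sideRight 0 = sideBottom 1 := rfl
  have e3 : sideBottom 0 = sideLeft 0 := rfl
  have e4 : sideRight 1 = sideTop 1 := rfl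
  simp only [e1] at k2
  simp only [e3] at k3
  simp only [e2, e4] at k4
  simp only [boundaryLog]
  linear_combination k1 + k2 - k3 - k4

theorem boundaryLog_eq_add {L : C(I × I, HomogeneousPoints S v)} (hL : BoundaryNeZero L) :
    boundaryLog L = boundaryLog (L.comp leftHalf) + boundaryLog (L.comp rightHalf) := by
  funext i
  let h₁ : C(I, I) := ⟨fun s => (leftHalf (s, 0)).1, by fun_prop⟩
  let h₂ : C(I, I) := ⟨fun s => (rightHalf (s, 0)).1, by fun_prop⟩
  have key {u : C(I, ℂ)} (hu : ∀ t, u t ≠ 0) :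
      logDiff u 0 1 = logDiff (u.comp h₁) 0 1 + logDiff (u.comp h₂) 0 1 := by
    have e1 : h₁ 0 = 0 := Subtype.ext (by simp [h₁, leftHalf])
    have e2 : h₂ 0 = h₁ 1 := Subtype.ext (by simp [h₁, h₂, leftHalf, rightHalf])
    have e3 : h₂ 1 = 1 := Subtype.ext (by simp [h₂, rightHalf])
    rw [logDiff_comp hu, logDiff_comp hu, e2, logDiff_add hu, e1, e3]
  have kt := key (u := coordMap (L.comp sideTop) i) fun t => (hL i t).2.1
  have kb := key (u := coordMap (L.comp sideBottom) i) fun t => (hL i t).2.2.1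
  have em : (L.comp leftHalf).comp sideRight = (L.comp rightHalf).comp sideLeft := by
    ext1 t
    refine congrArg L ?_
    ext <;> simp [leftHalf, rightHalf, sideRight, sideLeft]
  have el : (L.comp leftHalf).comp sideLeft = L.comp sideLeft := by
    ext1 t
    refine congrArg L ?_
    ext <;> simp [leftHalf, sideLeft]
  have er : (L.comp rightHalf).comp sideRight = L.comp sideRight := by
    ext1 t
    refine congrArg L ?_
    ext <;> simp [rightHalf, sideRight]
  simp only [boundaryLog, Pi.add_apply, em, el, er]
  change _ = (_ + logDiff ((coordMap (L.comp sideTop) i).comp h₁) 0 1 -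
    logDiff ((coordMap (L.comp sideBottom) i).comp h₁) 0 1 - _) + (_ +
    logDiff ((coordMap (L.comp sideTop) i).comp h₂) 0 1 -
    logDiff ((coordMap (L.comp sideBottom) i).comp h₂) 0 1 - _)
  rw [kt, kb]
  ring

/-- Both ways from `(0, 0)` to `(1, 1)` along the boundary end at the same value, so the exponential
of the difference is `1`. -/
theorem exists_int_boundaryLog {L : C(I × I, HomogeneousPoints S v)} (hL : BoundaryNeZero L) :
    ∃ k : Fin m → ℤ, ∀ i, boundaryLog L i = k i * (2 * Real.pi * Complex.I) := by
  have h (i : Fin m) : ∃ k : ℤ, boundaryLog L i = k * (2 * Real.pi * Complex.I) := by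
    refine Complex.exp_eq_one_iff.1 ?_
    have h1 := exp_logDiff (u := coordMap (L.comp sideLeft) i) (fun t => (hL i t).1) 0 1
    have h2 := exp_logDiff (u := coordMap (L.comp sideTop) i) (fun t => (hL i t).2.1) 0 1
    have h3 := exp_logDiff (u := coordMap (L.comp sideBottom) i) (fun t => (hL i t).2.2.1) 0 1
    have h4 := exp_logDiff (u := coordMap (L.comp sideRight) i) (fun t => (hL i t).2.2.2) 0 1
    have n1 : (L (0, 0)).1 i ≠ 0 := (hL i 0).1
    have n2 : (L (1, 1)).1 i ≠ 0 := (hL i 1).2.1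
    simp only [boundaryLog, Complex.exp_sub, Complex.exp_add]
    simp only [coordMap_apply, ContinuousMap.comp_apply] at h1 h2 h3 h4
    have e1 : sideTop 0 = sideLeft 1 := rfl
    have e2 : sideRight 0 = sideBottom 1 := rfl
    have e3 : sideBottom 0 = sideLeft 0 := rfl
    have e4 : sideRight 1 = sideTop 1 := rfl
    rw [e1, ← h1] at h2
    rw [e2, ← h3, e3, e4] at h4
    have n1' : (L (sideLeft 0)).1 i ≠ 0 := n1
    rw [div_div, div_eq_one_iff_eq (mul_ne_zero (Complex.exp_ne_zero _) (Complex.exp_ne_zero _))]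
    refine mul_right_cancel₀ n1' ?_
    linear_combination h2 - h4
  choose k hk using h
  exact ⟨k, hk⟩

theorem exists_log_of_value {u : C(I, ℂ)} (hu : ∀ t, u t ≠ 0) {z : ℂ} (hz : Complex.exp z = u 0) :
    ∃ g : C(I, ℂ), (∀ t, Complex.exp (g t) = u t) ∧ g 0 = z ∧ g 1 = z + logDiff u 0 1 := by
  obtain ⟨g, hg⟩ := exists_log u hu
  have h1 : Complex.exp (z - g 0) = 1 := by rw [Complex.exp_sub, hz, hg, div_self (hu 0)]
  refine ⟨g + ContinuousMap.const I (z - g 0), fun t => ?_, ?_, ?_⟩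
  · rw [ContinuousMap.add_apply, ContinuousMap.const_apply, Complex.exp_add, h1, mul_one, hg]
  · simp
  · rw [logDiff_eq g hg]
    simp only [ContinuousMap.add_apply, ContinuousMap.const_apply]
    ring

/-- Functions on the sides of the square with common values at the corners extend. -/
theorem exists_extension_square (gl gt gb gr : C(I, ℂ)) (h00 : gb 0 = gl 0) (h10 : gr 0 = gb 1)
    (h01 : gt 0 = gl 1) (h11 : gt 1 = gr 1) : ∃ Λ : C(I × I, ℂ), (∀ t, Λ (sideLeft t) = gl t) ∧
      (∀ s, Λ (sideTop s) = gt s) ∧ (∀ s, Λ (sideBottom s) = gb s) ∧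
      ∀ t, Λ (sideRight t) = gr t := by
  -- Sum of the linear interpolations between opposite sides minus the bilinear interpolation of the
  -- corner values.
  refine ⟨⟨fun p => (1 - (p.1 : ℝ)) * gl p.2 + (p.1 : ℝ) * gr p.2 + (1 - (p.2 : ℝ)) * gb p.1 +
    (p.2 : ℝ) * gt p.1 - ((1 - (p.1 : ℝ)) * (1 - (p.2 : ℝ)) * gl 0 +
      (p.1 : ℝ) * (1 - (p.2 : ℝ)) * gr 0 + (1 - (p.1 : ℝ)) * (p.2 : ℝ) * gl 1 +
      (p.1 : ℝ) * (p.2 : ℝ) * gr 1), by fun_prop⟩, fun t => ?_, fun t => ?_, fun t => ?_, fun t => ?_⟩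
  · simp [sideLeft, h00, h01]
  · simp [sideTop]
  · simp [sideBottom]
  · simp [sideRight, h11, h10]

/-- If the logarithmic increment along the boundary vanishes, then the boundary values have a
logarithm which extends over the square. -/
theorem exists_boundary_log {L : C(I × I, HomogeneousPoints S v)} (hL : BoundaryNeZero L)
    (h0 : boundaryLog L = 0) {c : Fin m → ℂ} (hc : ∀ i, (L (0, 0)).1 i = c i) :
    ∃ Λ : Fin m → C(I × I, ℂ), (∀ i, Λ i (0, 0) = 0) ∧
      ∀ s ∈ ({sideLeft, sideTop, sideBottom, sideRight} : Set C(I, I × I)), ∀ i t,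
        Complex.exp (Λ i (s t)) * c i = (L (s t)).1 i := by
  have hc0 (i) : c i ≠ 0 := by
    rw [← hc]
    exact (hL i 0).1
  have key (i : Fin m) : ∃ Λ : C(I × I, ℂ), Λ (0, 0) = Complex.log (c i) ∧
      ∀ s ∈ ({sideLeft, sideTop, sideBottom, sideRight} : Set C(I, I × I)), ∀ t,
        Complex.exp (Λ (s t)) = (L (s t)).1 i := by
    obtain ⟨gl, hl, hl0, hl1⟩ := exists_log_of_value (u := coordMap (L.comp sideLeft) i)
      (fun t => (hL i t).1) (z := Complex.log (c i))
      ((Complex.exp_log (hc0 i)).trans (hc i).symm)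
    obtain ⟨gb, hb, hb0, hb1⟩ := exists_log_of_value (u := coordMap (L.comp sideBottom) i)
      (fun t => (hL i t).2.2.1) (z := Complex.log (c i))
      ((Complex.exp_log (hc0 i)).trans (hc i).symm)
    obtain ⟨gt, ht, ht0, ht1⟩ := exists_log_of_value (u := coordMap (L.comp sideTop) i)
      (fun t => (hL i t).2.1) (z := gl 1) (hl 1)
    obtain ⟨gr, hr, hr0, hr1⟩ := exists_log_of_value (u := coordMap (L.comp sideRight) i)
      (fun t => (hL i t).2.2.2) (z := gb 1) (hb 1)
    have h := congrFun h0 i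
    simp only [boundaryLog, Pi.zero_apply] at h
    -- Logarithms are continued from `(0, 0)` both ways round; they meet at `(1, 1)` precisely
    -- because `boundaryLog` vanishes.
    obtain ⟨Λ, e1, e2, e3, e4⟩ := exists_extension_square gl gt gb gr (by rw [hl0, hb0]) hr0 ht0
      (by rw [ht1, hr1, hl1, hb1]; linear_combination h)
    refine ⟨Λ, (e1 0).trans hl0, ?_⟩
    rintro s (rfl | rfl | rfl | rfl) t
    · rw [e1, hl]; rfl
    · rw [e2, ht]; rfl
    · rw [e3, hb]; rfl
    · rw [e4, hr]; rfl
  choose Λ hΛ0 hΛ using key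
  refine ⟨fun i => Λ i - ContinuousMap.const _ (Complex.log (c i)), fun i => ?_, fun s hs i t => ?_⟩
  · simp [hΛ0]
  · rw [ContinuousMap.sub_apply, ContinuousMap.const_apply, Complex.exp_sub, hΛ i s hs,
      Complex.exp_log (hc0 i), div_mul_cancel₀ _ (hc0 i)]

/-- Each combination `∑ μ (v i) Λ i` has exponential `1`, so it is constant, and it vanishes at `0`.
-/
theorem mem_kernelSubmodule_of_exp {Λ : Fin m → C(I, ℂ)}
    (h : ∀ t, ∃ g ∈ quotientGroup v, ∀ i, Complex.exp (Λ i t) = g i)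
    (h0 : (fun i => Λ i 0) ∈ kernelSubmodule v) (t : I) : (fun i => Λ i t) ∈ kernelSubmodule v := by
  intro μ
  have h1 := sub_eq_sub_of_exp_eq (g := ∑ i, ((μ (v i) : ℤ) : ℂ) • Λ i) (g' := 0) (fun t => by
    obtain ⟨g, hg, e⟩ := h t
    simp only [ContinuousMap.sum_apply, ContinuousMap.smul_apply, smul_eq_mul, Complex.exp_sum,
      Complex.exp_int_mul, e, ContinuousMap.zero_apply, Complex.exp_zero]
    have := congrArg (fun u : ℂˣ => (u : ℂ)) (hg μ)
    simpa using this) 0 t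
  simp only [ContinuousMap.sum_apply, ContinuousMap.smul_apply, smul_eq_mul,
    ContinuousMap.zero_apply, sub_self] at h1
  rw [h0 μ, sub_zero] at h1
  exact h1

end BoundaryLog

/-! ### The winding homomorphism of the toric fibre -/

section ToricFibre

variable {N : Type*} [AddCommGroup N] {m : ℕ}
variable {S : Set (PointedCone ℝ (ℝ ⊗[ℤ] N))} {v : Fin m → N}

/-- The point with homogeneous coordinates `c`. -/
def torusLift (hS : IsCalabiYauFan S v) (c : Fin m → ℂˣ) : HomogeneousPoints S v :=
  ⟨fun i => c i, mem_of_forall_ne_zero hS fun i => (c i).ne_zero⟩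

theorem ne_zero_of_toricMk_mem {c : Fin m → ℂˣ} {z : HomogeneousPoints S v}
    (hz : toricMk z ∈ toricFibre S v c) (i : Fin m) : z.1 i ≠ 0 := by
  obtain ⟨w, hw, e⟩ := hz
  obtain ⟨g, -, hg⟩ := toricMk_eq_iff.1 e
  rw [hg]
  refine mul_ne_zero (g i).ne_zero fun h => (c i).ne_zero ?_
  rw [← norm_eq_zero, ← hw, h, norm_zero]

/-- The logarithms of the absolute values of an element of `quotientGroup v`. -/
theorem log_norm_mem_kernelSubmodule {g : Fin m → ℂˣ} (hg : g ∈ quotientGroup v) :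
    (fun i => ((Real.log ‖(g i : ℂ)‖ : ℝ) : ℂ)) ∈ kernelSubmodule v := by
  intro μ
  have h1 := congrArg (fun u : ℂˣ => Real.log ‖(u : ℂ)‖) (hg μ)
  simp only [Units.coe_prod, Units.val_zpow_eq_zpow_val, norm_prod, norm_zpow, Units.val_one,
    norm_one, Real.log_one] at h1
  rw [Real.log_prod fun i _ => zpow_ne_zero _ (norm_ne_zero_iff.2 (g i).ne_zero)] at h1
  simp only [Real.log_zpow] at h1
  beta_reduce
  exact_mod_cast h1

/-- Membership in the fibre says that the real part of `x` is `log |g|` for some `g` in `G`, hence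
lies in the Lie algebra. So does its multiple by `r`, and dividing `w` by the corresponding element
of `G` gives coordinates of the right absolute values. -/
theorem toricMk_exp_mem_toricFibre {c : Fin m → ℂˣ} {z w : HomogeneousPoints S v} {x : Fin m → ℂ}
    {r : ℝ} (hz : toricMk z ∈ toricFibre S v c) (hx : ∀ i, z.1 i = Complex.exp (x i) * c i)
    (hw : ∀ i, w.1 i = Complex.exp (r * x i) * c i) : toricMk w ∈ toricFibre S v c := by
  obtain ⟨z', hz', e⟩ := hz
  obtain ⟨g, hg, hgz⟩ := toricMk_eq_iff.1 e
  have hre (i) : (x i).re = Real.log ‖(g i : ℂ)‖ := by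
    have h1 := congrArg norm ((hx i).symm.trans (hgz i))
    rw [norm_mul, norm_mul, hz', Complex.norm_exp] at h1
    rw [← mul_right_cancel₀ (norm_ne_zero_iff.2 (c i).ne_zero) h1, Real.log_exp]
  let y : Fin m → ℂ := fun i => ((Real.log ‖(g i : ℂ)‖ : ℝ) : ℂ)
  have hy : (-r) • y ∈ kernelSubmodule v :=
    (kernelSubmodule v).smul_mem _ (log_norm_mem_kernelSubmodule hg)
  have hw' := toricMk_expMul (F := ContinuousMap.const Unit w) (y := ())
    (Λ := fun i => ContinuousMap.const _ (((-r) • y) i)) (by exact hy)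
  refine ⟨_, fun i => ?_, hw'⟩
  rw [expMul_apply, ContinuousMap.const_apply, ContinuousMap.const_apply, hw, ← mul_assoc,
    ← Complex.exp_add, norm_mul, Complex.norm_exp]
  have h0 : ((((-r) • y) i) + (r : ℂ) * x i).re = 0 := by
    simp only [Pi.smul_apply, Complex.real_smul, Complex.add_re, Complex.re_ofReal_mul, y,
      Complex.ofReal_re, hre]
    ring
  rw [h0, Real.exp_zero, one_mul]

theorem isCompact_toricFibre (hS : IsCalabiYauFan S v) (c : Fin m → ℂˣ) :
    IsCompact (toricFibre S v c) := by
  have hK : IsCompact (Set.univ.pi fun i => Metric.sphere (0 : ℂ) ‖(c i : ℂ)‖) :=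
    isCompact_univ_pi fun i => isCompact_sphere _ _
  have hsub : (Set.univ.pi fun i => Metric.sphere (0 : ℂ) ‖(c i : ℂ)‖) ⊆
      Set.range (Subtype.val : {z : Fin m → ℂ // latticeCone (v '' {i | z i = 0}) ∈ S} → _) := by
    intro z hz
    refine ⟨⟨z, mem_of_forall_ne_zero hS fun i h => (c i).ne_zero ?_⟩, rfl⟩
    have := hz i trivial
    rw [mem_sphere_zero_iff_norm, h, norm_zero] at this
    exact norm_eq_zero.1 this.symm
  have h1 := (Topology.IsInducing.subtypeVal (t := {z : Fin m → ℂ |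
    latticeCone (v '' {i | z i = 0}) ∈ S})).isCompact_preimage_iff hsub |>.2 hK
  have e : ((↑) : {z : Fin m → ℂ // latticeCone (v '' {i | z i = 0}) ∈ S} → Fin m → ℂ) ⁻¹'
      (Set.univ.pi fun i => Metric.sphere (0 : ℂ) ‖(c i : ℂ)‖) =
        {z | ∀ i, ‖z.1 i‖ = ‖(c i : ℂ)‖} := by
    ext z
    simp
  have h2 : IsCompact {z : HomogeneousPoints S v | ∀ i, ‖z.1 i‖ = ‖(c i : ℂ)‖} :=
    Eq.mp (congrArg IsCompact e) h1
  exact h2.image continuous_toricMk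

variable {c : Fin m → ℂˣ} {hS : IsCalabiYauFan S v}

theorem boundaryNeZero_of_isRelSquare {F : C(I × I, ToricManifold S v)}
    (h : IsRelSquare (toricFibre S v c) (fibreBase hS c) F) {L : C(I × I, HomogeneousPoints S v)}
    (hL : toricProj.comp L = F) : BoundaryNeZero L := by
  have e (p) : toricMk (L p) = F p := DFunLike.congr_fun hL p
  have ha : torusPoint hS c ∈ toricFibre S v c := (fibreBase hS c).2
  have hm {p : I × I} (hp : F p ∈ toricFibre S v c) (i : Fin m) : (L p).1 i ≠ 0 :=
    ne_zero_of_toricMk_mem (by rw [e]; exact hp) i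
  exact fun i t => ⟨hm ((h.left t).symm ▸ ha) i, hm (h.top t) i, hm ((h.bottom t).symm ▸ ha) i,
    hm ((h.right t).symm ▸ ha) i⟩

theorem boundaryLog_eq_of_toricProj_eq (hspan : ∀ u : N, ∃ a : Fin m → ℤ, ∑ i, a i • v i = u)
    (hS : IsCalabiYauFan S v) {L L' : C(I × I, HomogeneousPoints S v)} (hL : BoundaryNeZero L)
    (e : toricProj.comp L = toricProj.comp L') : boundaryLog L' = boundaryLog L := by
  obtain ⟨g, hg⟩ := exists_isRatio hS hspan e
  exact boundaryLog_eq_of_isRatio hg hL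

theorem boundaryLog_eq_of_toClass_eq (hspan : ∀ u : N, ∃ a : Fin m → ℤ, ∑ i, a i • v i = u)
    {F F' : C(I × I, ToricManifold S v)} (h : IsRelSquare (toricFibre S v c) (fibreBase hS c) F)
    (h' : IsRelSquare (toricFibre S v c) (fibreBase hS c) F') (e : h.toClass = h'.toClass)
    {L L' : C(I × I, HomogeneousPoints S v)} (hL : toricProj.comp L = F)
    (hL' : toricProj.comp L' = F') : boundaryLog L = boundaryLog L' := by
  obtain ⟨H, hH, h0, h1⟩ := exists_homotopy_of_toClass_eq h h' e
  obtain ⟨K, hK⟩ := exists_lift_toric hS hspan H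
  have hKr (r) : toricProj.comp (K.curry r) = H.curry r := by
    ext1 p
    exact DFunLike.congr_fun hK (r, p)
  have hb (r) : BoundaryNeZero (K.curry r) := boundaryNeZero_of_isRelSquare (hH r) (hKr r)
  rw [boundaryLog_eq_of_toricProj_eq hspan hS (hb 0) ((hKr 0).trans (h0.trans hL.symm)),
    boundaryLog_eq_of_toricProj_eq hspan hS (hb 1) ((hKr 1).trans (h1.trans hL'.symm)),
    boundaryLog_eq_of_homotopy K hb]

/-- The logarithmic boundary increment as a homomorphism. -/
theorem exists_relPi2_hom (hS : IsCalabiYauFan S v)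
    (hspan : ∀ u : N, ∃ a : Fin m → ℤ, ∑ i, a i • v i = u) (c : Fin m → ℂˣ) :
    ∃ W : RelPi2 (toricFibre S v c) (fibreBase hS c) →+ (Fin m → ℂ),
      ∀ (F : C(I × I, ToricManifold S v))
        (h : IsRelSquare (toricFibre S v c) (fibreBase hS c) F)
        (L : C(I × I, HomogeneousPoints S v)), toricProj.comp L = F →
        W h.toClass = boundaryLog L := by
  choose F hF e using fun x : RelPi2 (toricFibre S v c) (fibreBase hS c) => exists_isRelSquare x
  have key (x) {G : C(I × I, ToricManifold S v)}
      (h : IsRelSquare (toricFibre S v c) (fibreBase hS c) G)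
      {L : C(I × I, HomogeneousPoints S v)} (hL : toricProj.comp L = G) (hx : h.toClass = x) :
      boundaryLog (toricLift hS hspan (F x)) = boundaryLog L :=
    boundaryLog_eq_of_toClass_eq hspan (hF x) h ((e x).trans hx.symm)
      (toricProj_comp_toricLift hS hspan _) hL
  refine ⟨AddMonoidHom.mk' (fun x => boundaryLog (toricLift hS hspan (F x))) fun x y => ?_,
    fun G h L hL => key _ h hL rfl⟩
  -- The square for `y` is on the left, matching the order of summands in `toClass_eq_add`.
  obtain ⟨G, hG⟩ := exists_concat (P := Unit) ((F y).comp ⟨Prod.snd, continuous_snd⟩)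
    ((F x).comp ⟨Prod.snd, continuous_snd⟩) fun _ t => ((hF y).right t).trans ((hF x).left t).symm
  obtain ⟨hl, hr⟩ := hG ()
  change (G.curry ()).comp leftHalf = F y at hl
  change (G.curry ()).comp rightHalf = F x at hr
  have hG1 : IsRelSquare (toricFibre S v c) (fibreBase hS c) ((G.curry ()).comp leftHalf) :=
    hl.symm ▸ hF y
  have hG2 : IsRelSquare (toricFibre S v c) (fibreBase hS c) ((G.curry ()).comp rightHalf) :=
    hr.symm ▸ hF x
  have hG0 := isRelSquare_of_halves hG1 hG2
  obtain ⟨L, hL⟩ := exists_lift_toric hS hspan (G.curry ())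
  have hL1 : toricProj.comp (L.comp leftHalf) = (G.curry ()).comp leftHalf := by rw [← hL]; rfl
  have hL2 : toricProj.comp (L.comp rightHalf) = (G.curry ()).comp rightHalf := by rw [← hL]; rfl
  have e1 : hG1.toClass = y := (toClass_congr hG1 hl).trans (e y)
  have e2 : hG2.toClass = x := (toClass_congr hG2 hr).trans (e x)
  change boundaryLog _ = boundaryLog _ + boundaryLog _
  rw [key (x + y) hG0 hL (by rw [toClass_eq_add hG0 hG1 hG2, e1, e2]), key y hG1 hL1 e1,
    key x hG2 hL2 e2, boundaryLog_eq_add (boundaryNeZero_of_isRelSquare hG0 hL), add_comm]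

/-- In the evident lift only the `i`-th coordinate moves on the boundary, and only on the top side,
where it is `c i * exp (2 π i t)`. -/
theorem boundaryLog_basicDisk (hS : IsCalabiYauFan S v) (c : Fin m → ℂˣ) (i : Fin m) :
    ∃ L : C(I × I, HomogeneousPoints S v),
      toricProj.comp L = (basicDisk hS c i).toMap.comp chordMap ∧
      boundaryLog L = Pi.single i (2 * Real.pi * Complex.I) := by
  let L : C(I × I, HomogeneousPoints S v) :=
    ⟨fun p => ⟨_, update_mem hS c i (chordMap p : ℂ)⟩, Continuous.subtype_mk
      (continuous_const.update i (continuous_const.mul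
        (continuous_subtype_val.comp chordMap.continuous))) _⟩
  refine ⟨L, rfl, funext fun k => ?_⟩
  have hL1 (p : I × I) (hp : p.1 = 0 ∨ p.1 = 1 ∨ p.2 = 0) : (L p).1 k = c k := by
    change Function.update (fun k => (c k : ℂ)) i (c i * (chordMap p : ℂ)) k = _
    rw [chordMap_eq_one hp]
    by_cases hk : k = i
    · subst hk; simp [diskOne]
    · simp [hk]
  have hc {s : C(I, I × I)} (hs : ∀ t, (s t).1 = 0 ∨ (s t).1 = 1 ∨ (s t).2 = 0) :
      logDiff (coordMap (L.comp s) k) 0 1 = 0 := by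
    have : coordMap (L.comp s) k = ContinuousMap.const I (c k : ℂ) := by
      ext1 t
      exact hL1 _ (hs t)
    rw [this, logDiff_const (c k).ne_zero]
  rw [boundaryLog, hc (s := sideLeft) fun t => Or.inl rfl,
    hc (s := sideRight) fun t => Or.inr (Or.inl rfl),
    hc (s := sideBottom) fun t => Or.inr (Or.inr rfl)]
  by_cases hk : k = i
  · subst hk
    rw [logDiff_eq (u := coordMap (L.comp sideTop) k)
      ⟨fun t : I => Complex.log (c k) + 2 * Real.pi * (t : ℝ) * Complex.I, by fun_prop⟩]
    · simp
    · intro t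
      change Complex.exp (_ + _) = Function.update (fun k => (c k : ℂ)) k
        (c k * (chordMap (t, 1) : ℂ)) k
      rw [Complex.exp_add, Complex.exp_log (c k).ne_zero]
      simp [chordMap]
  · have : coordMap (L.comp sideTop) k = ContinuousMap.const I (c k : ℂ) := by
      ext1 t
      change Function.update (fun k => (c k : ℂ)) i (c i * (chordMap (t, 1) : ℂ)) k = _
      simp [hk]
    rw [this, logDiff_const (c k).ne_zero]
    simp [hk]

end ToricFibre

/-! ### Vanishing winding implies a trivial class -/

section Contraction

variable {N : Type*} [AddCommGroup N] {m : ℕ}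
variable {S : Set (PointedCone ℝ (ℝ ⊗[ℤ] N))} {v : Fin m → N} {c : Fin m → ℂˣ}

/-- The identification of the cube of dimension two with the square. -/
def cubeToSquare : C(Fin 2 → I, I × I) := ⟨fun y => (y 0, y 1), by fun_prop⟩

theorem squareToCube_cubeToSquare (y : Fin 2 → I) : squareToCube (cubeToSquare y) = y := by
  funext i
  fin_cases i <;> rfl

theorem squareToCube_mem_boundary {p : I × I} (hp : p ∈ squareBoundary) :
    squareToCube p ∈ Cube.boundary (Fin 2) := by
  rcases hp with h | h | h | h
  exacts [⟨0, Or.inl h⟩, ⟨0, Or.inr h⟩, ⟨1, Or.inl h⟩, ⟨1, Or.inr h⟩]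

theorem cubeToSquare_mem_squareBoundary {y : Fin 2 → I} (hy : y ∈ Cube.boundary (Fin 2)) :
    cubeToSquare y ∈ squareBoundary := by
  obtain ⟨i, hi⟩ := hy
  fin_cases i
  · rcases hi with h | h
    exacts [Or.inl h, Or.inr (Or.inl h)]
  · rcases hi with h | h
    exacts [Or.inr (Or.inr (Or.inl h)), Or.inr (Or.inr (Or.inr h))]

/-- A map of the square which is constant on the boundary is null-homotopic. -/
theorem exists_nullhomotopy_square (hS : IsCalabiYauFan S v)
    {L : C(I × I, HomogeneousPoints S v)} (h : ∀ p ∈ squareBoundary, L p = torusLift hS c) :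
    ∃ H : C(I × (I × I), HomogeneousPoints S v), H.curry 0 = L ∧
      H.curry 1 = ContinuousMap.const _ (torusLift hS c) ∧
      ∀ r, ∀ p ∈ squareBoundary, H (r, p) = torusLift hS c := by
  obtain ⟨K⟩ := homotopicRel_const_homogeneousPoints hS le_rfl (L.comp cubeToSquare)
    (torusLift hS c) (fun i => (c i).ne_zero)
    fun y hy => h _ (cubeToSquare_mem_squareBoundary hy)
  refine ⟨K.toHomotopy.toContinuousMap.comp ⟨fun q => (q.1, squareToCube q.2), by fun_prop⟩,
    ?_, ?_, fun r p hp => ?_⟩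
  · ext1 p
    exact K.apply_zero _
  · ext1 p
    exact K.apply_one _
  · exact (K.eq_fst r (squareToCube_mem_boundary hp)).trans (h p hp)

/-- If the boundary values of `L` have a logarithm, then `L` is deformed to a map which is constant
on the boundary. -/
theorem exists_boundary_contraction (hS : IsCalabiYauFan S v)
    {L : C(I × I, HomogeneousPoints S v)} {Λ : Fin m → C(I × I, ℂ)}
    (hΛ : ∀ p ∈ squareBoundary, ∀ i, Complex.exp (Λ i p) * c i = (L p).1 i) :
    ∃ H : C(I × (I × I), HomogeneousPoints S v), H.curry 0 = L ∧
      (∀ p ∈ squareBoundary, H (1, p) = torusLift hS c) ∧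
      ∀ r, ∀ p ∈ squareBoundary, ∀ i,
        (H (r, p)).1 i = Complex.exp ((1 - (r : ℝ) : ℝ) * Λ i p) * c i := by
  let H : C(I × (I × I), HomogeneousPoints S v) :=
    expMul (fun i => ⟨fun q => -((q.1 : ℝ) : ℂ) * Λ i q.2, by fun_prop⟩)
      (L.comp ⟨Prod.snd, continuous_snd⟩)
  have hH (r : I) (p : I × I) (i) :
      (H (r, p)).1 i = Complex.exp (-((r : ℝ) : ℂ) * Λ i p) * (L p).1 i := rfl
  have hb (r : I) (p) (hp : p ∈ squareBoundary) (i) :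
      (H (r, p)).1 i = Complex.exp ((1 - (r : ℝ) : ℝ) * Λ i p) * c i := by
    rw [hH, ← hΛ p hp, ← mul_assoc, ← Complex.exp_add]
    congr 2
    push_cast
    ring
  refine ⟨H, ?_, fun p hp => Subtype.ext (funext fun i => ?_), hb⟩
  · ext1 p
    refine Subtype.ext (funext fun i => ?_)
    change (H (0, p)).1 i = _
    rw [hH]
    simp
  · rw [hb 1 p hp]
    simp [torusLift]

theorem exists_log_squareBoundary {L : C(I × I, HomogeneousPoints S v)} (hL : BoundaryNeZero L)
    (h0 : boundaryLog L = 0) (hc : ∀ i, (L (0, 0)).1 i = c i) :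
    ∃ Λ : Fin m → C(I × I, ℂ), (∀ i, Λ i (0, 0) = 0) ∧
      ∀ p ∈ squareBoundary, ∀ i, Complex.exp (Λ i p) * c i = (L p).1 i := by
  obtain ⟨Λ, hΛ0, hΛ⟩ := exists_boundary_log hL h0 hc
  refine ⟨Λ, hΛ0, ?_⟩
  rintro ⟨s, t⟩ (h | h | h | h) i <;> simp only at h <;> subst h
  · exact hΛ sideLeft (by simp) i t
  · exact hΛ sideRight (by simp) i t
  · exact hΛ sideBottom (by simp) i s
  · exact hΛ sideTop (by simp) i s

theorem toricMk_eq_of_mem_kernelSubmodule (hS : IsCalabiYauFan S v) {z : HomogeneousPoints S v}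
    {x : Fin m → ℂ} (hx : x ∈ kernelSubmodule v) {r : ℝ}
    (hz : ∀ i, z.1 i = Complex.exp (r * x i) * c i) : toricMk z = torusPoint hS c :=
  (toricMk_eq_iff.2 ⟨_, exp_mem_quotientGroup ((kernelSubmodule v).smul_mem r hx), fun i => hz i⟩).symm

/-- Along a path which is mapped to the base point, the logarithm stays in the Lie algebra. -/
theorem mem_kernelSubmodule_of_path {hS : IsCalabiYauFan S v} {L : C(I × I, HomogeneousPoints S v)}
    {Λ : Fin m → C(I × I, ℂ)} {s : C(I, I × I)}
    (hΛ : ∀ t i, Complex.exp (Λ i (s t)) * c i = (L (s t)).1 i)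
    (hs : ∀ t, toricMk (L (s t)) = torusPoint hS c)
    (h0 : (fun i => Λ i (s 0)) ∈ kernelSubmodule v) (t : I) :
    (fun i => Λ i (s t)) ∈ kernelSubmodule v := by
  refine mem_kernelSubmodule_of_exp (Λ := fun i => (Λ i).comp s) (fun t => ?_) h0 t
  obtain ⟨g, hg, e⟩ := toricMk_eq_iff.1 (hs t).symm
  refine ⟨g, hg, fun i => mul_right_cancel₀ (c i).ne_zero ?_⟩
  exact (hΛ t i).trans (e i)

/-- Two stages: scaling the logarithm of the boundary values to `0` deforms the lift, through
relative squares, to one that is constant on the boundary; that one contracts in the homogeneous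
points. -/
theorem toClass_eq_zero_of_boundaryLog (hspan : ∀ u : N, ∃ a : Fin m → ℤ, ∑ i, a i • v i = u)
    {hS : IsCalabiYauFan S v} {F : C(I × I, ToricManifold S v)}
    (h : IsRelSquare (toricFibre S v c) (fibreBase hS c) F) {L : C(I × I, HomogeneousPoints S v)}
    (hL : toricProj.comp L = F) (h0 : boundaryLog L = 0) : h.toClass = 0 := by
  obtain ⟨L', hL', hc⟩ := exists_lift_of_value hS hspan F (0, 0) (torusLift hS c) (h.left 0).symm
  have hb := boundaryNeZero_of_isRelSquare h (L := L') (ContinuousMap.ext hL')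
  have h0' : boundaryLog L' = 0 := by
    rw [← h0]
    exact boundaryLog_eq_of_toricProj_eq hspan hS (boundaryNeZero_of_isRelSquare h hL)
      (hL.trans (ContinuousMap.ext hL').symm)
  obtain ⟨Λ, hΛ0, hΛ⟩ := exists_log_squareBoundary (c := c) hb h0' fun i => by rw [hc]; rfl
  obtain ⟨H, hH0, hH1, hHb⟩ := exists_boundary_contraction hS hΛ
  obtain ⟨K, hK0, hK1, hKb⟩ := exists_nullhomotopy_square hS (L := H.curry 1) hH1
  have hz : (fun i => Λ i (0, 0)) ∈ kernelSubmodule v := by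
    simp only [hΛ0]
    exact zero_mem _
  -- On the sides lying over the base point the logarithm takes values in the Lie algebra, so
  -- scaling keeps them over the base point. The property spreads from `(0, 0)` along the left and
  -- bottom sides and then up the right side.
  have kl := mem_kernelSubmodule_of_path (s := sideLeft) (hS := hS)
    (fun t => hΛ _ (Or.inl rfl)) (fun t => (hL' _).trans (h.left t)) hz
  have kb := mem_kernelSubmodule_of_path (s := sideBottom) (hS := hS)
    (fun t => hΛ _ (Or.inr (Or.inr (Or.inl rfl)))) (fun t => (hL' _).trans (h.bottom t)) hz
  have kr := mem_kernelSubmodule_of_path (s := sideRight) (hS := hS)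
    (fun t => hΛ _ (Or.inr (Or.inl rfl))) (fun t => (hL' _).trans (h.right t)) (kb 1)
  have hHr (r) : IsRelSquare (toricFibre S v c) (fibreBase hS c) ((toricProj.comp H).curry r) := by
    refine ⟨fun t => ?_, fun t => ?_, fun s => ?_, fun s => ?_⟩
    · exact toricMk_eq_of_mem_kernelSubmodule hS (kl t) (hHb r _ (Or.inl rfl))
    · exact toricMk_eq_of_mem_kernelSubmodule hS (kr t) (hHb r _ (Or.inr (Or.inl rfl)))
    · exact toricMk_eq_of_mem_kernelSubmodule hS (kb s) (hHb r _ (Or.inr (Or.inr (Or.inl rfl))))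
    · have hp : (s, 1) ∈ squareBoundary := Or.inr (Or.inr (Or.inr rfl))
      exact toricMk_exp_mem_toricFibre ((hL' (s, 1)).symm ▸ h.top s) (fun i => (hΛ _ hp i).symm)
        (hHb r _ hp)
  have hKr (r) : IsRelSquare (toricFibre S v c) (fibreBase hS c) ((toricProj.comp K).curry r) := by
    have e (p) (hp : p ∈ squareBoundary) : toricMk (K (r, p)) = torusPoint hS c :=
      congrArg toricMk (hKb r p hp)
    exact ⟨fun t => e _ (Or.inl rfl), fun t => e _ (Or.inr (Or.inl rfl)),
      fun s => e _ (Or.inr (Or.inr (Or.inl rfl))),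
      fun s => (congrArg (· ∈ toricFibre S v c)
        (e (s, 1) (Or.inr (Or.inr (Or.inr rfl))))).mpr (fibreBase hS c).2⟩
  have e0 : (toricProj.comp H).curry 0 = F := by
    ext1 p
    exact (congrArg toricMk (DFunLike.congr_fun hH0 p)).trans (hL' p)
  have e1 : (toricProj.comp K).curry 0 = (toricProj.comp H).curry 1 := by
    ext1 p
    exact congrArg toricMk (DFunLike.congr_fun hK0 p)
  have e2 : (toricProj.comp K).curry 1 = ContinuousMap.const _ (fibreBase hS c : ToricManifold S v) := by
    ext1 p
    exact congrArg toricMk (DFunLike.congr_fun hK1 p)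
  calc h.toClass = (hHr 0).toClass := toClass_congr h e0.symm
    _ = (hHr 1).toClass := toClass_eq_of_homotopy _ hHr
    _ = (hKr 0).toClass := toClass_congr (hHr 1) e1.symm
    _ = (hKr 1).toClass := toClass_eq_of_homotopy _ hKr
    _ = 0 := toClass_congr (hKr 1) e2

theorem hurewicz_const {X : Type} [TopologicalSpace X] {x : X} {f : Ω^ (Fin 2) X x}
    (hf : ∀ y, f y = x) : hurewicz f = 0 := by
  refine homologyι_injective ?_
  have e : (f : C(Fin 2 → I, X)) = ContinuousMap.const _ x := ContinuousMap.ext hf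
  rw [homologyι_hurewicz, e]
  exact (sub_self _).trans (map_zero _).symm

/-- The same deformation as in `toClass_eq_zero_of_boundaryLog`. Here the top side also lies over
the base point, so the whole boundary stays there and the sphere is deformed as a sphere. -/
theorem hurewicz_eq_zero_of_boundaryLog
    (hspan : ∀ u : N, ∃ a : Fin m → ℤ, ∑ i, a i • v i = u) {hS : IsCalabiYauFan S v}
    (f : Ω^ (Fin 2) (ToricManifold S v) (fibreBase hS c : ToricManifold S v))
    {L : C(I × I, HomogeneousPoints S v)}
    (hL : toricProj.comp L = (f : C(Fin 2 → I, ToricManifold S v)).comp squareToCube)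
    (h0 : boundaryLog L = 0) : hurewicz f = 0 := by
  have h := isRelSquare_sphere (A := toricFibre S v c) f
  set F := (f : C(Fin 2 → I, ToricManifold S v)).comp squareToCube with hF
  have hFb (p) (hp : p ∈ squareBoundary) : F p = torusPoint hS c :=
    GenLoop.boundary f _ (squareToCube_mem_boundary hp)
  obtain ⟨L', hL', hc⟩ := exists_lift_of_value hS hspan F (0, 0) (torusLift hS c) (h.left 0).symm
  have hb := boundaryNeZero_of_isRelSquare h (L := L') (ContinuousMap.ext hL')
  have h0' : boundaryLog L' = 0 := by
    rw [← h0]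
    exact boundaryLog_eq_of_toricProj_eq hspan hS (boundaryNeZero_of_isRelSquare h hL)
      (hL.trans (ContinuousMap.ext hL').symm)
  obtain ⟨Λ, hΛ0, hΛ⟩ := exists_log_squareBoundary (c := c) hb h0' fun i => by rw [hc]; rfl
  obtain ⟨H, hH0, hH1, hHb⟩ := exists_boundary_contraction hS hΛ
  obtain ⟨K, hK0, hK1, hKb⟩ := exists_nullhomotopy_square hS (L := H.curry 1) hH1
  have hz : (fun i => Λ i (0, 0)) ∈ kernelSubmodule v := by
    simp only [hΛ0]
    exact zero_mem _
  have kl := mem_kernelSubmodule_of_path (s := sideLeft) (hS := hS)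
    (fun t => hΛ _ (Or.inl rfl)) (fun t => (hL' _).trans (h.left t)) hz
  have kb := mem_kernelSubmodule_of_path (s := sideBottom) (hS := hS)
    (fun t => hΛ _ (Or.inr (Or.inr (Or.inl rfl)))) (fun t => (hL' _).trans (h.bottom t)) hz
  have kr := mem_kernelSubmodule_of_path (s := sideRight) (hS := hS)
    (fun t => hΛ _ (Or.inr (Or.inl rfl))) (fun t => (hL' _).trans (h.right t)) (kb 1)
  have kt := mem_kernelSubmodule_of_path (s := sideTop) (hS := hS)
    (fun t => hΛ _ (Or.inr (Or.inr (Or.inr rfl))))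
    (fun t => (hL' _).trans (hFb _ (Or.inr (Or.inr (Or.inr rfl))))) (kl 1)
  have hk (p) (hp : p ∈ squareBoundary) : (fun i => Λ i p) ∈ kernelSubmodule v := by
    obtain ⟨s, t⟩ := p
    rcases hp with h | h | h | h <;> simp only at h <;> subst h
    exacts [kl t, kr t, kb s, kt s]
  have hHr (r) (y) (hy : y ∈ Cube.boundary (Fin 2)) :
      toricMk (H (r, cubeToSquare y)) = torusPoint hS c :=
    have hp := cubeToSquare_mem_squareBoundary hy
    toricMk_eq_of_mem_kernelSubmodule hS (hk _ hp) (hHb r _ hp)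
  let f₁ : Ω^ (Fin 2) (ToricManifold S v) (fibreBase hS c : ToricManifold S v) :=
    ⟨(toricProj.comp (H.curry 1)).comp cubeToSquare, hHr 1⟩
  let f₂ : Ω^ (Fin 2) (ToricManifold S v) (fibreBase hS c : ToricManifold S v) :=
    ⟨ContinuousMap.const _ _, fun _ _ => rfl⟩
  have e1 : hurewicz f = hurewicz f₁ := by
    refine hurewicz_eq_of_homotopy f f₁
      ((toricProj.comp H).comp ⟨fun q => (q.1, cubeToSquare q.2), by fun_prop⟩)
      (fun _ => torusPoint hS c) hHr (fun y => ?_) fun y => rfl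
    refine (congrArg toricMk (DFunLike.congr_fun hH0 (cubeToSquare y))).trans ((hL' _).trans ?_)
    exact congrArg f (squareToCube_cubeToSquare y)
  have e2 : hurewicz f₁ = hurewicz f₂ :=
    hurewicz_eq_of_homotopy f₁ f₂
      ((toricProj.comp K).comp ⟨fun q => (q.1, cubeToSquare q.2), by fun_prop⟩)
      (fun _ => torusPoint hS c)
      (fun r y hy => congrArg toricMk (hKb r _ (cubeToSquare_mem_squareBoundary hy)))
      (fun y => congrArg toricMk (DFunLike.congr_fun hK0 (cubeToSquare y)))
      fun y => congrArg toricMk (DFunLike.congr_fun hK1 (cubeToSquare y))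
  rw [e1, e2, hurewicz_const fun _ => rfl]

end Contraction

/-! ### Spheres and integral relations among the ray generators -/

section Spheres

variable {N : Type*} [AddCommGroup N] {m : ℕ}
variable {S : Set (PointedCone ℝ (ℝ ⊗[ℤ] N))} {v : Fin m → N} {c : Fin m → ℂˣ}

/-- On each side the lift is `g c` with `g` in `G`, so the monomial with exponents `μ (v i)` is
constant there and its logarithm has increment `0`. -/
theorem sum_mul_boundaryLog_sphere {hS : IsCalabiYauFan S v}
    (f : Ω^ (Fin 2) (ToricManifold S v) (fibreBase hS c : ToricManifold S v))
    {L : C(I × I, HomogeneousPoints S v)}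
    (hL : toricProj.comp L = (f : C(Fin 2 → I, ToricManifold S v)).comp squareToCube)
    (μ : Module.Dual ℤ N) : ∑ i, (μ (v i) : ℂ) * boundaryLog L i = 0 := by
  have hLb (p) (hp : p ∈ squareBoundary) : torusPoint hS c = toricMk (L p) :=
    (GenLoop.boundary f _ (squareToCube_mem_boundary hp)).symm.trans (DFunLike.congr_fun hL p).symm
  have key {s : C(I, I × I)} (hs : ∀ t, s t ∈ squareBoundary) :
      ∑ i, (μ (v i) : ℂ) * logDiff (coordMap (L.comp s) i) 0 1 = 0 := by
    refine sum_mul_logDiff_eq_zero (fun i t => ?_) (fun i => μ (v i))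
      (∏ i, (c i : ℂ) ^ μ (v i)) (fun t => ?_) 0 1
    · obtain ⟨g, -, e⟩ := toricMk_eq_iff.1 (hLb _ (hs t))
      rw [coordMap_apply, ContinuousMap.comp_apply, e]
      exact mul_ne_zero (g i).ne_zero (c i).ne_zero
    · obtain ⟨g, hg, e⟩ := toricMk_eq_iff.1 (hLb _ (hs t))
      have h1 := congrArg (fun u : ℂˣ => (u : ℂ)) (hg μ)
      simp only [Units.coe_prod, Units.val_zpow_eq_zpow_val, Units.val_one] at h1
      simp only [coordMap_apply, ContinuousMap.comp_apply, e, mul_zpow, Finset.prod_mul_distrib, h1,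
        one_mul]
  simp only [boundaryLog, mul_sub, mul_add, Finset.sum_sub_distrib, Finset.sum_add_distrib]
  rw [key fun t => Or.inl rfl, key fun t => Or.inr (Or.inr (Or.inr rfl)),
    key fun t => Or.inr (Or.inr (Or.inl rfl)), key fun t => Or.inr (Or.inl rfl)]
  simp

/-- Every integral relation between the vectors `v` is realized by a sphere. -/
theorem exists_sphere_of_relation (hS : IsCalabiYauFan S v) (c : Fin m → ℂˣ) {κ : Fin m → ℤ}
    (hκ : ∑ i, κ i • v i = 0) :
    ∃ (f : Ω^ (Fin 2) (ToricManifold S v) (fibreBase hS c : ToricManifold S v))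
      (L : C(I × I, HomogeneousPoints S v)),
      toricProj.comp L = (f : C(Fin 2 → I, ToricManifold S v)).comp squareToCube ∧
      boundaryLog L = fun i => κ i * (2 * Real.pi * Complex.I) := by
  let x : Fin m → ℂ := fun i => κ i * (2 * Real.pi * Complex.I)
  have hx : x ∈ kernelSubmodule v := by
    intro μ
    have h1 := congrArg μ hκ
    simp only [map_sum, map_zsmul, smul_eq_mul, map_zero] at h1
    have h2 : ∑ i, (κ i : ℂ) * (μ (v i) : ℂ) = 0 := by exact_mod_cast h1
    calc _ = (∑ i, (κ i : ℂ) * (μ (v i) : ℂ)) * (2 * Real.pi * Complex.I) := by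
          rw [Finset.sum_mul]
          exact Finset.sum_congr rfl fun i _ => by simp only [x]; ring
      _ = 0 := by rw [h2, zero_mul]
  -- The loop `exp (2 π i s κ) c` stays in a `G`-orbit because `κ` is a relation, and it winds `κ i`
  -- times in the `i`-th coordinate.
  let γ : C(Fin 1 → I, HomogeneousPoints S v) :=
    expMul (fun i => ⟨fun y => ((y 0 : ℝ) : ℂ) * x i, by fun_prop⟩)
      (ContinuousMap.const _ (torusLift hS c))
  have hγ (y : Fin 1 → I) (i) : (γ y).1 i = Complex.exp (((y 0 : ℝ) : ℂ) * x i) * c i := rfl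
  have hγb (y) (hy : y ∈ Cube.boundary (Fin 1)) : γ y = torusLift hS c := by
    obtain ⟨j, hj⟩ := hy
    obtain rfl : j = 0 := Subsingleton.elim _ _
    refine Subtype.ext (funext fun i => ?_)
    rw [hγ]
    rcases hj with hj | hj
    · simp [hj, torusLift]
    · simp [hj, torusLift, x, Complex.exp_int_mul_two_pi_mul_I]
  obtain ⟨K⟩ := homotopicRel_const_homogeneousPoints hS (k := 1) (by norm_num) γ (torusLift hS c)
    (fun i => (c i).ne_zero) hγb
  -- The null-homotopy of `γ`, turned so that `γ` is the top side and the other sides are constant.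
  -- Its projection is constant on the boundary.
  let L : C(I × I, HomogeneousPoints S v) :=
    K.toHomotopy.toContinuousMap.comp ⟨fun p => (unitInterval.symm p.2, fun _ => p.1), by fun_prop⟩
  have hL (s t : I) : L (s, t) = K (unitInterval.symm t, fun _ => s) := rfl
  have hL0 (t : I) : L (0, t) = torusLift hS c := by
    have hb : (fun _ => 0 : Fin 1 → I) ∈ Cube.boundary (Fin 1) := ⟨0, Or.inl rfl⟩
    rw [hL, K.eq_fst _ hb, hγb _ hb]
  have hL1 (t : I) : L (1, t) = torusLift hS c := by
    have hb : (fun _ => 1 : Fin 1 → I) ∈ Cube.boundary (Fin 1) := ⟨0, Or.inr rfl⟩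
    rw [hL, K.eq_fst _ hb, hγb _ hb]
  have hLb (s : I) : L (s, 0) = torusLift hS c := by
    rw [hL, unitInterval.symm_zero, K.apply_one]
    rfl
  have hLt (s : I) : L (s, 1) = γ fun _ => s := by
    rw [hL, unitInterval.symm_one, K.apply_zero]
  refine ⟨⟨(toricProj.comp L).comp cubeToSquare, fun y hy => ?_⟩, L, rfl, funext fun i => ?_⟩
  · have hp := cubeToSquare_mem_squareBoundary hy
    change toricMk (L (cubeToSquare y)) = torusPoint hS c
    generalize cubeToSquare y = p at hp
    obtain ⟨s, t⟩ := p
    rcases hp with h | h | h | h <;> simp only at h <;> subst h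
    · rw [hL0]; rfl
    · rw [hL1]; rfl
    · rw [hLb]; rfl
    · exact toricMk_eq_of_mem_kernelSubmodule hS hx fun i => by rw [hLt, hγ]
  · have hc {s : C(I, I × I)} (hs : ∀ t, L (s t) = torusLift hS c) :
        logDiff (coordMap (L.comp s) i) 0 1 = 0 := by
      have : coordMap (L.comp s) i = ContinuousMap.const I (c i : ℂ) := by
        ext1 t
        rw [coordMap_apply, ContinuousMap.comp_apply, hs]
        rfl
      rw [this, logDiff_const (c i).ne_zero]
    rw [boundaryLog, hc (s := sideLeft) hL0, hc (s := sideRight) hL1, hc (s := sideBottom) hLb,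
      logDiff_eq (u := coordMap (L.comp sideTop) i)
        ⟨fun t : I => Complex.log (c i) + ((t : ℝ) : ℂ) * x i, by fun_prop⟩]
    · simp [x]
    · intro t
      rw [coordMap_apply, ContinuousMap.comp_apply]
      change _ = (L (t, 1)).1 i
      rw [hLt, hγ, ContinuousMap.coe_mk, Complex.exp_add, Complex.exp_log (c i).ne_zero, mul_comm]

end Spheres

/-! ### A basis of the lattice of relations -/

section CurveClasses

variable {N : Type*} [AddCommGroup N] {n l : ℕ}

theorem exists_sum_smul_eq_of_basis {b : Module.Basis (Fin n) ℤ N} {v : Fin (n + l) → N}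
    (hb : ∀ j : Fin n, b j = v (Fin.castAdd l j)) (u : N) :
    ∃ a : Fin (n + l) → ℤ, ∑ i, a i • v i = u := by
  refine ⟨Fin.append (fun j => b.repr u j) 0, ?_⟩
  rw [Fin.sum_univ_add]
  simp only [Fin.append_left, Fin.append_right, Pi.zero_apply, zero_smul, Finset.sum_const_zero,
    add_zero, ← hb]
  exact b.sum_repr u

theorem map_curveClass {G G' : Type*} [AddGroup G] [AddGroup G'] (φ : G →+ G')
    (b : Module.Basis (Fin n) ℤ N) (v : Fin (n + l) → N) (β : Fin (n + l) → G) (k : Fin l) :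
    φ (curveClass b v β k) = curveClass b v (fun i => φ (β i)) k := by
  rw [curveClass, map_sub, map_list_sum, List.map_ofFn]
  congr 3
  funext j
  exact map_zsmul φ _ _

theorem curveClass_eq_sub_sum {G : Type*} [AddCommGroup G]
    (b : Module.Basis (Fin n) ℤ N) (v : Fin (n + l) → N) (β : Fin (n + l) → G) (k : Fin l) :
    curveClass b v β k = β (Fin.natAdd n k) -
      ∑ j, b.coord j (v (Fin.natAdd n k)) • β (Fin.castAdd l j) := by
  rw [curveClass, List.sum_ofFn]

/-- The relation between the vectors `v` which expresses `v_{n+k}` in the basis `b`. -/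
def curveRelation (b : Module.Basis (Fin n) ℤ N) (v : Fin (n + l) → N) (k : Fin l) :
    Fin (n + l) → ℤ :=
  curveClass b v (fun i => Pi.single i 1) k

theorem curveRelation_natAdd (b : Module.Basis (Fin n) ℤ N) (v : Fin (n + l) → N) (k k' : Fin l) :
    curveRelation b v k (Fin.natAdd n k') = if k = k' then 1 else 0 := by
  have h (j : Fin n) : Fin.natAdd n k' ≠ Fin.castAdd l j := fun h => by
    have := congrArg Fin.val h
    simp at this
    omega
  rw [curveRelation, curveClass_eq_sub_sum]
  simp [h, Pi.single_apply, eq_comm]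

theorem sum_curveRelation_smul {b : Module.Basis (Fin n) ℤ N} {v : Fin (n + l) → N}
    (hb : ∀ j : Fin n, b j = v (Fin.castAdd l j)) (k : Fin l) :
    ∑ i, curveRelation b v k i • v i = 0 := by
  let φ : (Fin (n + l) → ℤ) →+ N := (Fintype.linearCombination ℤ v).toAddMonoidHom
  have h1 : φ (curveRelation b v k) = curveClass b v v k := by
    rw [curveRelation, map_curveClass]
    congr 1
    funext i
    change Fintype.linearCombination ℤ v (Pi.single i 1) = v i
    simp
  change φ (curveRelation b v k) = 0
  rw [h1, curveClass_eq_sub_sum, sub_eq_zero]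
  simp only [← hb, Module.Basis.coord_apply]
  exact (b.sum_repr _).symm

theorem eq_zero_of_relation {b : Module.Basis (Fin n) ℤ N} {v : Fin (n + l) → N}
    (hb : ∀ j : Fin n, b j = v (Fin.castAdd l j)) {κ : Fin (n + l) → ℤ}
    (h : ∑ i, κ i • v i = 0) (h0 : ∀ k, κ (Fin.natAdd n k) = 0) : κ = 0 := by
  rw [Fin.sum_univ_add] at h
  simp only [h0, zero_smul, Finset.sum_const_zero, add_zero, ← hb] at h
  have h1 := Fintype.linearIndependent_iff.1 b.linearIndependent _ h
  funext i
  induction i using Fin.addCases with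
  | left j => exact h1 j
  | right k => exact h0 k

/-- A group of multiples of relations between the vectors `v` has a basis consisting of the
relations expressing `v_{n+k}` in the basis `b`. -/
theorem exists_basis_of_relations {b : Module.Basis (Fin n) ℤ N} {v : Fin (n + l) → N}
    (hb : ∀ j : Fin n, b j = v (Fin.castAdd l j)) {H : Type*} [AddCommGroup H] [inst : Module ℤ H]
    (Ψ : H →+ (Fin (n + l) → ℂ)) (hΨ : Function.Injective Ψ) {w : ℂ} (hw : w ≠ 0)
    (h1 : ∀ h, ∃ κ : Fin (n + l) → ℤ, ∑ i, κ i • v i = 0 ∧ Ψ h = fun i => κ i * w)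
    (h2 : ∀ κ : Fin (n + l) → ℤ, ∑ i, κ i • v i = 0 → ∃ h, Ψ h = fun i => κ i * w) :
    ∃ B : Module.Basis (Fin l) ℤ H, ∀ k, Ψ (B k) = fun i => curveRelation b v k i * w := by
  obtain rfl : inst = AddCommGroup.toIntModule H := Subsingleton.elim _ _
  choose e he using fun k => h2 _ (sum_curveRelation_smul (b := b) hb k)
  have hsum (a : Fin l → ℤ) (i) : Ψ (∑ k, a k • e k) i =
      ((∑ k, a k * curveRelation b v k i : ℤ) : ℂ) * w := by
    simp only [map_sum, Finset.sum_apply]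
    push_cast
    rw [Finset.sum_mul]
    refine Finset.sum_congr rfl fun k _ => ?_
    rw [map_zsmul, Pi.smul_apply, he]
    simp [mul_assoc]
  -- The coordinates with index `n + k` of the chosen relations form a unit matrix, so they recover
  -- the coefficients.
  have hli : LinearIndependent ℤ e := by
    refine Fintype.linearIndependent_iff.2 fun a ha k => ?_
    have h := hsum a (Fin.natAdd n k)
    rw [ha, map_zero, Pi.zero_apply] at h
    have h' := (mul_eq_zero.1 h.symm).resolve_right hw
    simpa [curveRelation_natAdd] using h'
  have hsp : ⊤ ≤ Submodule.span ℤ (Set.range e) := by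
    intro h _
    obtain ⟨κ, hκ, hκΨ⟩ := h1 h
    suffices h = ∑ k, κ (Fin.natAdd n k) • e k by
      rw [this]
      exact Submodule.sum_mem _ fun k _ =>
        Submodule.smul_mem _ _ (Submodule.subset_span (Set.mem_range_self k))
    -- After this subtraction only `v_0, …, v_{n-1}` occur in the relation, and they are
    -- independent.
    have hz : (fun i => κ i - ∑ k, κ (Fin.natAdd n k) * curveRelation b v k i) = 0 := by
      refine eq_zero_of_relation hb ?_ fun k => ?_
      · simp only [sub_smul, Finset.sum_sub_distrib, hκ, Finset.sum_smul, mul_smul, zero_sub]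
        rw [Finset.sum_comm]
        simp only [← Finset.smul_sum, sum_curveRelation_smul hb, smul_zero, Finset.sum_const_zero,
          neg_zero]
      · simp [curveRelation_natAdd]
    refine hΨ (funext fun i => ?_)
    rw [hsum, hκΨ, ← sub_eq_zero.1 (congrFun hz i)]
  exact ⟨Module.Basis.mk hli hsp, fun k => by rw [Module.Basis.mk_apply, he]⟩

end CurveClasses

/-! ### The basis theorem for the toric fibre and along isotopies -/

section MainResult

variable {N : Type*} [AddCommGroup N] {n l : ℕ}
variable {S : Set (PointedCone ℝ (ℝ ⊗[ℤ] N))} {v : Fin (n + l) → N}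

theorem injective_of_boundaryLog {m : ℕ} {v : Fin m → N} {hS : IsCalabiYauFan S v}
    (hspan : ∀ u : N, ∃ a : Fin m → ℤ, ∑ i, a i • v i = u) {c : Fin m → ℂˣ}
    {W : RelPi2 (toricFibre S v c) (fibreBase hS c) →+ (Fin m → ℂ)}
    (hW : ∀ (F : C(I × I, ToricManifold S v))
      (h : IsRelSquare (toricFibre S v c) (fibreBase hS c) F)
      (L : C(I × I, HomogeneousPoints S v)), toricProj.comp L = F →
      W h.toClass = boundaryLog L) : Function.Injective W := by
  refine (injective_iff_map_eq_zero W).2 fun x hx => ?_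
  obtain ⟨F, h, rfl⟩ := exists_isRelSquare x
  obtain ⟨L, hL⟩ := exists_lift_toric hS hspan F
  exact toClass_eq_zero_of_boundaryLog hspan h hL ((hW F h L hL).symm.trans hx)

/-- Both groups embed in `ℂ^m`, by `W` and `Ψ`, and the two winding vectors of a sphere agree. Every
claim is therefore checked on winding vectors. -/
theorem isBasisOfH2_toricFibre (hS : IsCalabiYauFan S v) (b : Module.Basis (Fin n) ℤ N)
    (hb : ∀ j : Fin n, b j = v (Fin.castAdd l j)) (c : Fin (n + l) → ℂˣ) :
    (∀ x y : RelPi2 (toricFibre S v c) (fibreBase hS c), x + y = y + x) ∧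
      IsBasisOfH2 (toricFibre S v c) (fibreBase hS c)
        (curveClass b v (basicDiskClass hS c)) := by
  have hspan := exists_sum_smul_eq_of_basis hb
  have := simplyConnectedSpace_toricManifold hS hspan
  have hw : (2 * Real.pi * Complex.I : ℂ) ≠ 0 := Complex.two_pi_I_ne_zero
  obtain ⟨W, hW⟩ := exists_relPi2_hom hS hspan c
  have hWi := injective_of_boundaryLog hspan hW
  have hsurj := hurewicz_surjective (fibreBase hS c : ToricManifold S v)
  obtain ⟨Ψ, hΨ⟩ := exists_homology_hom hS hspan
  have hΨL (f : Ω^ (Fin 2) (ToricManifold S v) (fibreBase hS c : ToricManifold S v))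
      (L : C(I × I, HomogeneousPoints S v))
      (hL : toricProj.comp L = (f : C(Fin 2 → I, ToricManifold S v)).comp squareToCube) :
      Ψ (hurewicz f) = boundaryLog L :=
    hΨ (torusLift hS c) _ f L (fun i => (c i).ne_zero) rfl hL
  have hWΨ (f : Ω^ (Fin 2) (ToricManifold S v) (fibreBase hS c : ToricManifold S v)) :
      W (sphereClass _ _ f) = Ψ (hurewicz f) := by
    obtain ⟨L, hL⟩ := exists_lift_toric hS hspan
      ((f : C(Fin 2 → I, ToricManifold S v)).comp squareToCube)
    rw [sphereClass_eq_toClass, hW _ _ L hL, hΨL f L hL]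
  have hΨi : Function.Injective Ψ := by
    refine (injective_iff_map_eq_zero Ψ).2 fun h hh => ?_
    obtain ⟨f, rfl⟩ := hsurj h
    obtain ⟨L, hL⟩ := exists_lift_toric hS hspan
      ((f : C(Fin 2 → I, ToricManifold S v)).comp squareToCube)
    exact hurewicz_eq_zero_of_boundaryLog hspan f hL ((hΨL f L hL).symm.trans hh)
  obtain ⟨B, hB⟩ := exists_basis_of_relations hb Ψ hΨi hw (fun h => by
    obtain ⟨f, rfl⟩ := hsurj h
    obtain ⟨L, hL⟩ := exists_lift_toric hS hspan
      ((f : C(Fin 2 → I, ToricManifold S v)).comp squareToCube)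
    obtain ⟨κ, hκ⟩ := exists_int_boundaryLog
      (boundaryNeZero_of_isRelSquare (isRelSquare_sphere (A := toricFibre S v c) f) hL)
    refine ⟨κ, b.ext_elem fun j => ?_, (hΨL f L hL).trans (funext hκ)⟩
    have h1 := sum_mul_boundaryLog_sphere f hL (b.coord j)
    have h2 : (∑ i, (b.coord j (v i) : ℂ) * κ i) * (2 * Real.pi * Complex.I) = 0 := by
      rw [← h1, Finset.sum_mul]
      exact Finset.sum_congr rfl fun i _ => by rw [hκ, mul_assoc]
    replace h2 := (mul_eq_zero.1 h2).resolve_right hw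
    have h3 : ∑ i, b.coord j (v i) * κ i = 0 := by exact_mod_cast h2
    rw [← Module.Basis.coord_apply, ← Module.Basis.coord_apply, map_sum, map_zero, ← h3]
    exact Finset.sum_congr rfl fun i _ => by rw [map_smul, smul_eq_mul, mul_comm])
    fun κ hκ => by
      obtain ⟨f, L, hL, e⟩ := exists_sphere_of_relation hS c hκ
      exact ⟨hurewicz f, (hΨL f L hL).trans e⟩
  -- Any choice of spheres defines `ι`. It is additive and independent of the choice because its
  -- composite with the injective `W` is `Ψ`.
  choose s hs using hsurj
  have hWs (h) : W (sphereClass (toricFibre S v c) (fibreBase hS c) (s h)) = Ψ h := by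
    rw [hWΨ, hs]
  refine ⟨fun x y => hWi (by rw [map_add, map_add, add_comm (W x)]), fun h => ⟨s h, hs h⟩,
    AddMonoidHom.mk' (fun h => sphereClass (toricFibre S v c) (fibreBase hS c) (s h))
      fun h h' => hWi (by rw [map_add, hWs, hWs, hWs, map_add]), fun f => hWi ?_,
      fun h h' e => hΨi ?_, B, fun k => hWi ?_⟩
  · exact (hWs _).trans (hWΨ f).symm
  · exact (hWs h).symm.trans ((congrArg W e).trans (hWs h'))
  · refine (hWs _).trans ((hB k).trans ?_)
    have hβ (i) : W (basicDiskClass hS c i) = Pi.single i (2 * Real.pi * Complex.I) := by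
      obtain ⟨L, hL, e⟩ := boundaryLog_basicDisk hS c i
      rw [basicDiskClass, BasedDisk.toClass_eq_toClass, hW _ _ L hL, e]
    rw [map_curveClass]
    simp only [hβ, curveRelation, curveClass_eq_sub_sum]
    funext i
    simp only [Pi.sub_apply, Finset.sum_apply, Pi.single_apply, Pi.mul_apply, Pi.intCast_apply,
      zsmul_eq_mul]
    push_cast
    rw [sub_mul, Finset.sum_mul]
    congr 1
    · split_ifs <;> simp
    · exact Finset.sum_congr rfl fun j _ => by split_ifs <;> simp

/-- The embedding is composed with `τ`. It sends a sphere at the end to its relative class because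
this sphere comes from one at the start with the same homology class. -/
theorem Isotopy.isBasisOfH2 {X : Type} [TopologicalSpace X] [T2Space X] [SimplyConnectedSpace X]
    {A : Set X} [CompactSpace A] {a : A} (Φ : Isotopy A)
    {τ : RelPi2 A a ≃+ RelPi2 (Φ.image 1) (Φ.point 1 a)}
    (hτ : ∀ (H : C(I × (I × I), X)) (h₀ : IsRelSquare A a (H.curry 0))
      (h : ∀ r, IsRelSquare (Φ.image r) (Φ.point r a) (H.curry r)), τ h₀.toClass = (h 1).toClass)
    {s : Fin l → RelPi2 A a} (hs : IsBasisOfH2 A a s) :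
    IsBasisOfH2 (Φ.image 1) (Φ.point 1 a) fun k => τ (s k) := by
  obtain ⟨-, ι, hι, hi, B, hB⟩ := hs
  refine ⟨hurewicz_surjective _, τ.toAddMonoidHom.comp ι, fun f' => ?_,
    τ.injective.comp hi, B, fun k => congrArg τ (hB k)⟩
  obtain ⟨f, e, e'⟩ := Φ.exists_sphere a hτ f'
  rw [← e, ← e', ← hι f]
  rfl

end MainResult

end ToricCY

end

theorem mainTheorem9 {N : Type*} [AddCommGroup N] (n l : ℕ)
    (S : Set (PointedCone ℝ (ℝ ⊗[ℤ] N))) (v : Fin (n + l) → N)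
    (hS : ToricCY.IsCalabiYauFan S v)
    (b : Module.Basis (Fin n) ℤ N) (hb : ∀ j : Fin n, b j = v (Fin.castAdd l j))
    (hcone : ToricCY.latticeCone (Set.range b) ∈ S)
    (c : Fin (n + l) → ℂˣ) :
    -- disks bounded by the toric fibre `T` through `[c]`
    ((∀ x y : ToricCY.RelPi2 (ToricCY.toricFibre S v c) (ToricCY.fibreBase hS c),
        x + y = y + x) ∧
      ToricCY.IsBasisOfH2 (ToricCY.toricFibre S v c) (ToricCY.fibreBase hS c)
        (ToricCY.curveClass b v (ToricCY.basicDiskClass hS c))) ∧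
    -- disks bounded by a torus `L` which is isotopic to `T`
    ∀ Φ : ToricCY.Isotopy (ToricCY.toricFibre S v c),
      (∀ x y : ToricCY.RelPi2 (Φ.image 1) (Φ.point 1 (ToricCY.fibreBase hS c)),
        x + y = y + x) ∧
      ∃ β : Fin (n + l) → ToricCY.RelPi2 (Φ.image 1) (Φ.point 1 (ToricCY.fibreBase hS c)),
        (∀ i γ, Φ.Corresponds (ToricCY.fibreBase hS c) (ToricCY.basicDiskClass hS c i) γ ↔
          γ = β i) ∧
        ToricCY.IsBasisOfH2 (Φ.image 1) (Φ.point 1 (ToricCY.fibreBase hS c))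
          (ToricCY.curveClass b v β) := by
  have hspan := ToricCY.exists_sum_smul_eq_of_basis hb
  have := ToricCY.t2Space_toricManifold hS b hspan
  have := ToricCY.simplyConnectedSpace_toricManifold hS hspan
  have := isCompact_iff_compactSpace.1 (ToricCY.isCompact_toricFibre hS c)
  have hT := ToricCY.isBasisOfH2_toricFibre hS b hb c
  refine ⟨hT, fun Φ => ?_⟩
  -- The corresponding classes are the images under `τ`; being a homomorphism, it also carries the
  -- integral combinations `curveClass` along.
  obtain ⟨τ, hτ⟩ := Φ.exists_equiv (ToricCY.fibreBase hS c)
  refine ⟨fun x y => ?_, fun i => τ (ToricCY.basicDiskClass hS c i),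
    fun i γ => Φ.corresponds_iff (ToricCY.fibreBase hS c) hτ (ToricCY.basicDisk hS c i) γ, ?_⟩
  · obtain ⟨x, rfl⟩ := τ.surjective x
    obtain ⟨y, rfl⟩ := τ.surjective y
    rw [← map_add, ← map_add, hT.1]
  · have h := Φ.isBasisOfH2 hτ hT.2
    have e := funext fun k => ToricCY.map_curveClass τ.toAddMonoidHom b v
      (ToricCY.basicDiskClass hS c) k
    exact e ▸ h
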